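/- A \emph{trigraph} $T$ is a finite set $V(T)$ with a symmetric function $\theta$ assigning to each pair of distinct vertices a value $1$ (strong edge), $-1$ (strong antiedge) or $0$ (switchable pair). Two distinct vertices are adjacent if $\theta\ge 0$ and antiadjacent if $\theta\le 0$; the complement $\overline T$ has adjacency function $-\theta$. Strongly complete (anticomplete) means that all pairs in question are strong edges (strong antiedges). A path is a sequence of distinct vertices, consecutive ones being adjacent and all others antiadjacent; its length is its number of edges. Holes (cyclic sequences of at least $4$ distinct vertices, cyclically consecutive ones adjacent and all others antiadjacent) are defined likewise; antipaths and antiholes are paths and holes of $\overline T$. A set $X$ of vertices is connected if the graph of adjacent pairs on $X$ is connected (the empty set counts as connected), and its components are those of this graph; $X$ is anticonnected if it is connected in $\overline T$. $T$ is Berge if it has no odd hole and no odd antihole. \emph{Balanced skew-partition}: a partition $(A,B)$ of $V(T)$ such that $A$ is not connected, $B$ is not anticonnected, no odd path of length greater than $1$ has its ends in $B$ and its interior in $A$, and no odd antipath of length greater than $1$ has its ends in $A$ and its interior in $B$. \emph{Class $\mathcal F$}: the Berge trigraphs $T$ such that, in the graph $\Sigma(T)$ of switchable pairs, every component has at most two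 edges, and for every vertex $v$ whose $\Sigma(T)$-neighborhood consists of two vertices $x\neq y$, either $v$ is strongly complete to $V(T)\setminus\{v,x,y\}$ and $xy$ is a strong edge, or $v$ is strongly anticomplete to $V(T)\setminus\{v,x,y\}$ and $xy$ is a strong antiedge. \emph{$2$-join}: a partition $(X_1,X_2)$ of $V(T)$ with $X_i=A_i\sqcup B_i\sqcup C_i$ and $A_i,B_i\ne\emptyset$, where $A_1$ is strongly complete to $A_2$, $B_1$ is strongly complete to $B_2$, all other pairs between $X_1$ and $X_2$ are strong antiedges, $|X_i|\ge 3$, and, if $|A_i|=|B_i|=1$, the graph of adjacent pairs on $X_i$ is not a path of length two joining $A_i$ to $B_i$. It is \emph{proper} if each component of $T|X_i$ meets both $A_i$ and $B_i$, $i=1,2$. It is odd (even) if all paths with one end in $A_i$, the other in $B_i$ and interior in $C_i$, $i=1,2$, have odd (even) length. A (proper, odd, even) complement $2$-join of $T$ is a (proper, odd, even) $2$-join of $\overline T$. \emph{Proper homogeneous pair}: disjoint $A,B\subseteq V(T)$ with $|A|,|B|\ge 2$ such that, if $A_1$ and $A_2$ ($B_1$ and $B_2$) are the sets of vertices outside $A$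 (outside $B$) that are strongly complete and strongly anticomplete to $A$ (to $B$), then $A_1\cup A_2=B_1\cup B_2=V(T)\setminus(A\cup B)$ and the four sets $A_i\cap B_j$ are non-empty. A \emph{proper fragment} of $T$ is a set $X$ such that $(X,V(T)\setminus X)$ is a proper $2$-join or a proper complement $2$-join, or $X=A\cup B$ for a proper homogeneous pair $(A,B)$. An \emph{end} is an inclusion-minimal proper fragment. The \emph{block} $T_X$ of a proper fragment $X$ is $T|X$ together with marker vertices; all pairs with a marker that are not listed are strong antiedges. (i) Odd $2$-join, $X=X_1$: markers $a,b$, with $a$ strongly complete to $A_1$, $b$ strongly complete to $B_1$, and $ab$ switchable. (ii) Even $2$-join, $X=X_1$: markers $a,b,c$, with $a$ strongly complete to $A_1$, $b$ strongly complete to $B_1$, and $ac,cb$ switchable. (iii) Odd complement $2$-join, $X=X_1$: markers $a,b$, with $a$ strongly complete to $B_1\cup C_1$, $b$ strongly complete to $A_1\cup C_1$, and $ab$ switchable. (iv) Even complement $2$-join, $X=X_1$: markers $a,b,c$, with $a$ strongly complete to $B_1\cup C_1$, $b$ strongly complete to $A_1\cup C_1$, $c$ strongly complete to $X$, $ac,cb$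 switchable, and $ab$ a strong edge. (v) $X=A\cup B$ for a proper homogeneous pair: markers $c,d$, with $c$ strongly complete to $A$, $d$ strongly complete to $B$, and $cd$ switchable. \textbf{Theorem.} There is an algorithm (a single program for a random access machine with words of $O(\log n)$ bits and unit-cost operations) that, given the adjacency matrix of any trigraph $T\in\mathcal F$ on $n$ vertices with no balanced skew-partition, halts in time $O(n^5)$ and outputs an end $X$ of $T$ together with a block $T_X$ if $T$ has an end, and otherwise reports that $T$ has no end. -/

import Mathlib

/-- A trigraph with (finite) vertex set `V`: a symmetric adjacency function with values in
`{-1, 0, 1}`.  The value on the diagonal carries no information and is normalized to `0`;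
all predicates below concern distinct vertices only. -/
structure Trigraph (V : Type*) [Finite V] where
  θ : V → V → SignType
  symm : ∀ u v, θ u v = θ v u
  diag : ∀ v, θ v v = 0

namespace Trigraph

section Basic

variable {V : Type*} [Finite V] (T : Trigraph V)

/-- `uv` is a strong edge (this forces `u ≠ v`). -/
def StrongAdj (u v : V) : Prop := T.θ u v = 1

/-- `uv` is a strong antiedge (this forces `u ≠ v`). -/
def StrongAnti (u v : V) : Prop := T.θ u v = -1

/-- `uv` is a switchable pair. -/
def Semi (u v : V) : Prop := u ≠ v ∧ T.θ u v = 0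

/-- `u` and `v` are adjacent: strongly adjacent or semiadjacent. -/
def Adj (u v : V) : Prop := T.StrongAdj u v ∨ T.Semi u v

/-- `u` and `v` are antiadjacent: strongly antiadjacent or semiadjacent. -/
def Anti (u v : V) : Prop := T.StrongAnti u v ∨ T.Semi u v

/-- The complement of a trigraph. -/
def compl : Trigraph V where
  θ u v := -T.θ u v
  symm u v := by rw [T.symm u v]
  diag v := by rw [T.diag v]; rfl

/-- `A` is strongly complete to `B`. -/
def StrongComplete (A B : Set V) : Prop := ∀ a ∈ A, ∀ b ∈ B, T.StrongAdj a b

/-- `A` is strongly anticomplete to `B`. -/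
def StrongAnticomplete (A B : Set V) : Prop := ∀ a ∈ A, ∀ b ∈ B, T.StrongAnti a b

/-- The full realization: the graph whose edges are the strong edges and the switchable pairs. -/
def full : SimpleGraph V where
  Adj u v := T.Adj u v
  symm := ⟨fun u v h => by
    rcases h with h | ⟨h1, h2⟩
    · exact Or.inl ((T.symm v u).trans h)
    · exact Or.inr ⟨h1.symm, (T.symm v u).trans h2⟩⟩
  loopless := ⟨fun v h => by
    rcases h with h | h
    · have h' : T.θ v v = 1 := h
      rw [T.diag v] at h'
      exact absurd h' (by decide)
    · exact h.1 rfl⟩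

/-- The graph `Σ(T)` whose edges are the switchable pairs. -/
def switchGraph : SimpleGraph V where
  Adj u v := T.Semi u v
  symm := ⟨fun u v h => ⟨h.1.symm, (T.symm v u).trans h.2⟩⟩
  loopless := ⟨fun _ h => h.1 rfl⟩

/-- `X` is connected in `T`.  The empty set is connected. -/
def IsConnected (X : Set V) : Prop := (T.full.induce X).Preconnected

/-- `X` is anticonnected in `T`.  The empty set is anticonnected. -/
def IsAnticonnected (X : Set V) : Prop := T.compl.IsConnected X

/-- `p` is a path `p 0, …, p k` of length `k` in `T`. -/
def IsPath {k : ℕ} (p : Fin (k + 1) → V) : Prop :=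
  Function.Injective p ∧ ∀ i j : Fin (k + 1), i < j →
    ((j : ℕ) = i + 1 → T.Adj (p i) (p j)) ∧ ((i : ℕ) + 1 < j → T.Anti (p i) (p j))

/-- The path `p` goes from `A` to `B` and has its interior in `C`. -/
def PathVia {k : ℕ} (p : Fin (k + 1) → V) (A B C : Set V) : Prop :=
  T.IsPath p ∧ p 0 ∈ A ∧ p (Fin.last k) ∈ B ∧ ∀ i, i ≠ 0 → i ≠ Fin.last k → p i ∈ C

/-- `h` lists the vertices of a hole of length `k` in cyclic order. -/
def IsHole {k : ℕ} (h : Fin k → V) : Prop :=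
  4 ≤ k ∧ Function.Injective h ∧ ∀ i j : Fin k, i < j →
    (((j : ℕ) = i + 1 ∨ (j : ℕ) = i + (k - 1)) → T.Adj (h i) (h j)) ∧
    (((i : ℕ) + 1 < j ∧ (j : ℕ) < i + (k - 1)) → T.Anti (h i) (h j))

/-- `T` contains no odd hole and no odd antihole. -/
def IsBerge : Prop :=
  ∀ (k : ℕ) (h : Fin k → V), Odd k → ¬ T.IsHole h ∧ ¬ T.compl.IsHole h

/-- `v` is a heavy vertex, with neighbors `x` and `y` in `Σ(T)`. -/
def IsHeavy (v x y : V) : Prop :=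
  T.StrongComplete {v} {v, x, y}ᶜ ∧ T.StrongAdj x y

/-- `v` is a light vertex, with neighbors `x` and `y` in `Σ(T)`. -/
def IsLight (v x y : V) : Prop :=
  T.StrongAnticomplete {v} {v, x, y}ᶜ ∧ T.StrongAnti x y

/-- The class `F`. -/
structure InF : Prop where
  berge : T.IsBerge
  /-- every connected component of `Σ(T)` has at most two edges -/
  components : ∀ c : T.switchGraph.ConnectedComponent,
    {e ∈ T.switchGraph.edgeSet | ∀ v ∈ e, v ∈ c.supp}.ncard ≤ 2
  heavy_or_light : ∀ v x y : V, x ≠ y → T.switchGraph.neighborSet v = {x, y} →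
    T.IsHeavy v x y ∨ T.IsLight v x y

/-- The pair `(A, B)` is balanced. -/
def IsBalanced (A B : Set V) : Prop :=
  (¬ ∃ (k : ℕ) (p : Fin (k + 1) → V), Odd k ∧ 1 < k ∧ T.PathVia p B B A) ∧
  (¬ ∃ (k : ℕ) (p : Fin (k + 1) → V), Odd k ∧ 1 < k ∧ T.compl.PathVia p A A B)

/-- `(A, B)` is a skew-partition of `T`. -/
def IsSkewPartition (A B : Set V) : Prop :=
  Disjoint A B ∧ A ∪ B = Set.univ ∧ ¬ T.IsConnected A ∧ ¬ T.IsAnticonnected B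

/-- `T` admits a balanced skew-partition. -/
def HasBalancedSkewPartition : Prop :=
  ∃ A B : Set V, T.IsSkewPartition A B ∧ T.IsBalanced A B

/-- The full realization of `T|X` is a path of length two from `a` to `b`. -/
def IsTwoPath (X : Set V) (a b : V) : Prop :=
  ∃ c, a ≠ b ∧ X = {a, c, b} ∧ T.full.Adj a c ∧ T.full.Adj c b ∧ ¬ T.full.Adj a b

/-- `(A₁, B₁, C₁, A₂, B₂, C₂)` is a split of a `2`-join
`(A₁ ∪ B₁ ∪ C₁, A₂ ∪ B₂ ∪ C₂)` of `T`. -/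
structure IsTwoJoinSplit (A₁ B₁ C₁ A₂ B₂ C₂ : Set V) : Prop where
  disj : [A₁, B₁, C₁, A₂, B₂, C₂].Pairwise Disjoint
  cover : (A₁ ∪ B₁ ∪ C₁) ∪ (A₂ ∪ B₂ ∪ C₂) = Set.univ
  nonempty : A₁.Nonempty ∧ B₁.Nonempty ∧ A₂.Nonempty ∧ B₂.Nonempty
  noSemi : ∀ u ∈ A₁ ∪ B₁ ∪ C₁, ∀ v ∈ A₂ ∪ B₂ ∪ C₂, ¬ T.Semi u v
  completeA : T.StrongComplete A₁ A₂
  completeB : T.StrongComplete B₁ B₂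
  noOther : ∀ u ∈ A₁ ∪ B₁ ∪ C₁, ∀ v ∈ A₂ ∪ B₂ ∪ C₂, T.StrongAdj u v →
    (u ∈ A₁ ∧ v ∈ A₂) ∨ (u ∈ B₁ ∧ v ∈ B₂)
  card₁ : 3 ≤ (A₁ ∪ B₁ ∪ C₁).ncard
  card₂ : 3 ≤ (A₂ ∪ B₂ ∪ C₂).ncard
  notPath₁ : ∀ a b, A₁ = {a} → B₁ = {b} → ¬ T.IsTwoPath (A₁ ∪ B₁ ∪ C₁) a b
  notPath₂ : ∀ a b, A₂ = {a} → B₂ = {b} → ¬ T.IsTwoPath (A₂ ∪ B₂ ∪ C₂) a b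

/-- Every connected component of `T|X` meets both `A` and `B`. -/
def ComponentsMeet (X A B : Set V) : Prop :=
  ∀ c : (T.full.induce X).ConnectedComponent,
    (∃ v ∈ c.supp, (v : V) ∈ A) ∧ (∃ v ∈ c.supp, (v : V) ∈ B)

/-- A split of a proper `2`-join of `T`. -/
structure IsProperTwoJoinSplit (A₁ B₁ C₁ A₂ B₂ C₂ : Set V) : Prop extends
    T.IsTwoJoinSplit A₁ B₁ C₁ A₂ B₂ C₂ where
  meet₁ : T.ComponentsMeet (A₁ ∪ B₁ ∪ C₁) A₁ B₁
  meet₂ : T.ComponentsMeet (A₂ ∪ B₂ ∪ C₂) A₂ B₂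

/-- The `2`-join with the given split is odd: on both sides, all paths from `Aᵢ` to `Bᵢ` with
interior in `Cᵢ` have odd length. -/
def IsOddSplit (A₁ B₁ C₁ A₂ B₂ C₂ : Set V) : Prop :=
  ∀ (k : ℕ) (p : Fin (k + 1) → V), T.PathVia p A₁ B₁ C₁ ∨ T.PathVia p A₂ B₂ C₂ → Odd k

/-- The `2`-join with the given split is even. -/
def IsEvenSplit (A₁ B₁ C₁ A₂ B₂ C₂ : Set V) : Prop :=
  ∀ (k : ℕ) (p : Fin (k + 1) → V), T.PathVia p A₁ B₁ C₁ ∨ T.PathVia p A₂ B₂ C₂ → Even k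

/-- `(X, V ∖ X)` is a proper `2`-join of `T`. -/
def IsProperTwoJoinSide (X : Set V) : Prop :=
  ∃ A₁ B₁ C₁ A₂ B₂ C₂ : Set V,
    T.IsProperTwoJoinSplit A₁ B₁ C₁ A₂ B₂ C₂ ∧ X = A₁ ∪ B₁ ∪ C₁

/-- The vertices that are strongly complete to `A`. -/
def completeTo (A : Set V) : Set V := {v | v ∉ A ∧ ∀ a ∈ A, T.StrongAdj v a}

/-- The vertices that are strongly anticomplete to `A`. -/
def anticompleteTo (A : Set V) : Set V := {v | v ∉ A ∧ ∀ a ∈ A, T.StrongAnti v a}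

/-- `(A, B)` is a proper homogeneous pair of `T`. -/
structure IsProperHomogeneousPair (A B : Set V) : Prop where
  disj : Disjoint A B
  cardA : 1 < A.ncard
  cardB : 1 < B.ncard
  unionA : T.completeTo A ∪ T.anticompleteTo A = (A ∪ B)ᶜ
  unionB : T.completeTo B ∪ T.anticompleteTo B = (A ∪ B)ᶜ
  ne₁₁ : (T.completeTo A ∩ T.completeTo B).Nonempty
  ne₁₂ : (T.completeTo A ∩ T.anticompleteTo B).Nonempty
  ne₂₁ : (T.anticompleteTo A ∩ T.completeTo B).Nonempty
  ne₂₂ : (T.anticompleteTo A ∩ T.anticompleteTo B).Nonempty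

/-- `X` is a proper fragment of `T`. -/
def IsProperFragment (X : Set V) : Prop :=
  T.IsProperTwoJoinSide X ∨ T.compl.IsProperTwoJoinSide X ∨
    ∃ A B : Set V, T.IsProperHomogeneousPair A B ∧ X = A ∪ B

/-- `X` is an end of `T`: an inclusion-minimal proper fragment. -/
def IsEnd (X : Set V) : Prop :=
  T.IsProperFragment X ∧ ∀ Y : Set V, Y ⊂ X → ¬ T.IsProperFragment Y

open Classical in
/-- Start with `T|X`, add the trigraph `M` of marker vertices, make the marker `k` strongly
complete to `N k ∩ X`, and strongly anticomplete to the rest of `X`. -/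
noncomputable def addMarkers (X : Set V) {ι : Type*} [Finite ι] (M : Trigraph ι)
    (N : ι → Set V) : Trigraph (X ⊕ ι) where
  θ
    | .inl u, .inl v => T.θ u v
    | .inl u, .inr k => if (u : V) ∈ N k then 1 else -1
    | .inr k, .inl u => if (u : V) ∈ N k then 1 else -1
    | .inr k, .inr l => M.θ k l
  symm := by
    rintro (u | k) (v | l)
    · exact T.symm _ _
    · rfl
    · rfl
    · exact M.symm _ _
  diag := by
    rintro (u | k)
    · exact T.diag _
    · exact M.diag _

end Basic

/-- Two marker vertices that form a switchable pair. -/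
def markerPair : Trigraph (Fin 2) where
  θ _ _ := 0
  symm _ _ := rfl
  diag _ := rfl

/-- Three marker vertices `a = 0`, `b = 1`, `c = 2`, where `ac` and `cb` are switchable pairs
and `ab` is a strong antiedge. -/
def markerLight : Trigraph (Fin 3) where
  θ := ![![0, -1, 0], ![-1, 0, 0], ![0, 0, 0]]
  symm := by decide
  diag := by decide

/-- Three marker vertices `a = 0`, `b = 1`, `c = 2`, where `ac` and `cb` are switchable pairs
and `ab` is a strong edge. -/
def markerHeavy : Trigraph (Fin 3) where
  θ := ![![0, 1, 0], ![1, 0, 0], ![0, 0, 0]]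
  symm := by decide
  diag := by decide

/-- `T.IsBlock X r T'`: the trigraph `T'`, whose vertices are those of `X` and `r` markers, is
the block of decomposition `T_X` of `T` with respect to the proper fragment `X`. -/
inductive IsBlock {V : Type*} [Finite V] (T : Trigraph V) (X : Set V) :
    (r : ℕ) → Trigraph (X ⊕ Fin r) → Prop
  | oddTwoJoin (A₁ B₁ C₁ A₂ B₂ C₂ : Set V) :
      T.IsProperTwoJoinSplit A₁ B₁ C₁ A₂ B₂ C₂ → T.IsOddSplit A₁ B₁ C₁ A₂ B₂ C₂ →
      X = A₁ ∪ B₁ ∪ C₁ →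
      IsBlock T X 2 (T.addMarkers X markerPair ![A₁, B₁])
  | evenTwoJoin (A₁ B₁ C₁ A₂ B₂ C₂ : Set V) :
      T.IsProperTwoJoinSplit A₁ B₁ C₁ A₂ B₂ C₂ → T.IsEvenSplit A₁ B₁ C₁ A₂ B₂ C₂ →
      X = A₁ ∪ B₁ ∪ C₁ →
      IsBlock T X 3 (T.addMarkers X markerLight ![A₁, B₁, ∅])
  | oddComplTwoJoin (A₁ B₁ C₁ A₂ B₂ C₂ : Set V) :
      T.compl.IsProperTwoJoinSplit A₁ B₁ C₁ A₂ B₂ C₂ →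
      T.compl.IsOddSplit A₁ B₁ C₁ A₂ B₂ C₂ →
      X = A₁ ∪ B₁ ∪ C₁ →
      IsBlock T X 2 (T.addMarkers X markerPair ![B₁ ∪ C₁, A₁ ∪ C₁])
  | evenComplTwoJoin (A₁ B₁ C₁ A₂ B₂ C₂ : Set V) :
      T.compl.IsProperTwoJoinSplit A₁ B₁ C₁ A₂ B₂ C₂ →
      T.compl.IsEvenSplit A₁ B₁ C₁ A₂ B₂ C₂ →
      X = A₁ ∪ B₁ ∪ C₁ →
      IsBlock T X 3 (T.addMarkers X markerHeavy ![B₁ ∪ C₁, A₁ ∪ C₁, X])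
  | homogeneousPair (A B : Set V) :
      T.IsProperHomogeneousPair A B → X = A ∪ B →
      IsBlock T X 2 (T.addMarkers X markerPair ![A, B])

end Trigraph

/-! ### The machine model

A word RAM, programmed in a structured language.  A program refers to finitely many
word-sized variables and finitely many arrays of words.  One time unit is charged for every
arithmetic operation, comparison, memory access, literal, assignment and test. -/

namespace RAM

/-- Contents of the memory: variables and arrays. -/
structure State where
  var : ℕ → ℕ
  arr : ℕ → ℕ → ℕ

/-- Elementary operations; subtraction is truncated, comparisons return `0` or `1`. -/
inductive Op
  | add | sub | mul | lt | eq

def Op.apply : Op → ℕ → ℕ → ℕ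
  | .add, x, y => x + y
  | .sub, x, y => x - y
  | .mul, x, y => x * y
  | .lt, x, y => if x < y then 1 else 0
  | .eq, x, y => if x = y then 1 else 0

/-- Expressions; `get a e` reads the array `a` at the index given by `e`. -/
inductive Expr
  | lit (k : ℕ)
  | var (x : ℕ)
  | get (a : ℕ) (e : Expr)
  | op (o : Op) (e f : Expr)

namespace Expr

def eval (s : State) : Expr → ℕ
  | lit k => k
  | var x => s.var x
  | get a e => s.arr a (e.eval s)
  | op o e f => o.apply (e.eval s) (f.eval s)

/-- The time needed to evaluate an expression. -/
def cost : Expr → ℕ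
  | lit _ => 1
  | var _ => 1
  | get _ e => e.cost + 1
  | op _ e f => e.cost + f.cost + 1

/-- All values met in the evaluation of the expression (in particular, all addresses) are
smaller than `W`, so that there is no overflow. -/
def Fits (W : ℕ) (s : State) : Expr → Prop
  | lit k => k < W
  | var x => s.var x < W
  | get a e => e.Fits W s ∧ s.arr a (e.eval s) < W
  | op o e f => e.Fits W s ∧ f.Fits W s ∧ o.apply (e.eval s) (f.eval s) < W

end Expr

/-- Programs; `store a e f` writes the value of `f` into the array `a` at the index `e`. -/
inductive Cmd
  | skip
  | assign (x : ℕ) (e : Expr)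
  | store (a : ℕ) (e f : Expr)
  | seq (c d : Cmd)
  | ite (e : Expr) (c d : Cmd)
  | loop (e : Expr) (c : Cmd)

/-- `c.Runs W s t s'`: on a machine whose words hold the numbers below `W`, the program `c`,
started with memory `s`, halts after exactly `t` time units with memory `s'`, and no overflow
occurs.  The value `0` of a test means "false", every other value means "true". -/
inductive Cmd.Runs (W : ℕ) : Cmd → State → ℕ → State → Prop
  | skip (s : State) : Runs W .skip s 1 s
  | assign (x : ℕ) (e : Expr) (s : State) : e.Fits W s →
      Runs W (.assign x e) s (e.cost + 1) ⟨Function.update s.var x (e.eval s), s.arr⟩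
  | store (a : ℕ) (e f : Expr) (s : State) : e.Fits W s → f.Fits W s →
      Runs W (.store a e f) s (e.cost + f.cost + 1)
        ⟨s.var, Function.update s.arr a (Function.update (s.arr a) (e.eval s) (f.eval s))⟩
  | seq {c d : Cmd} {s s' s'' : State} {t t' : ℕ} :
      Runs W c s t s' → Runs W d s' t' s'' → Runs W (.seq c d) s (t + t') s''
  | iteTrue {e : Expr} {c d : Cmd} {s s' : State} {t : ℕ} :
      e.Fits W s → e.eval s ≠ 0 → Runs W c s t s' → Runs W (.ite e c d) s (e.cost + 1 + t) s'
  | iteFalse {e : Expr} {c d : Cmd} {s s' : State} {t : ℕ} :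
      e.Fits W s → e.eval s = 0 → Runs W d s t s' → Runs W (.ite e c d) s (e.cost + 1 + t) s'
  | loopDone {e : Expr} {c : Cmd} {s : State} :
      e.Fits W s → e.eval s = 0 → Runs W (.loop e c) s (e.cost + 1) s
  | loopStep {e : Expr} {c : Cmd} {s s' s'' : State} {t t' : ℕ} :
      e.Fits W s → e.eval s ≠ 0 → Runs W c s t s' → Runs W (.loop e c) s' t' s'' →
      Runs W (.loop e c) s (e.cost + 1 + t + t') s''

end RAM

namespace Trigraph

/-- The machine word that stands for a value of the adjacency function. -/
def code : SignType → ℕ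
  | .neg => 0
  | .zero => 1
  | .pos => 2

/-- The initial memory for the input `T`: the variable `0` holds the number `n` of vertices,
the array `0` holds the `n × n` adjacency matrix row by row, everything else is `0`. -/
def inputState {n : ℕ} (T : Trigraph (Fin n)) : RAM.State where
  var x := if x = 0 then n else 0
  arr a k :=
    if h : a = 0 ∧ k < n * n then
      code (T.θ ⟨k / n, Nat.div_lt_of_lt_mul h.2⟩
        ⟨k % n, Nat.mod_lt _ (Nat.pos_of_ne_zero fun h0 => by simp [h0] at h)⟩)
    else 0

/-- The names of the vertices of a block in the output: a vertex of `X` keeps its name, the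
markers are `n`, `n + 1`, `n + 2`. -/
def blockName {n r : ℕ} {X : Set (Fin n)} : X ⊕ Fin r → ℕ
  | .inl v => (v : Fin n)
  | .inr k => n + k

open Classical in
/-- The memory `s` holds a correct answer for `T`: either the variable `1` is `0` and `T` has no
end; or the variable `1` is `1`, the array `1` is the characteristic vector of an end `X` of `T`,
the variable `2` is the number of markers of a block `T_X`, and the array `2` holds the adjacency
matrix of `T_X`, stored row by row with rows of length `n + 3`. -/
def IsAnswer {n : ℕ} (T : Trigraph (Fin n)) (s : RAM.State) : Prop :=
  (s.var 1 = 0 ∧ ¬ ∃ X : Set (Fin n), T.IsEnd X) ∨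
  (s.var 1 = 1 ∧ ∃ X : Set (Fin n), T.IsEnd X ∧
    (∀ v : Fin n, s.arr 1 v = if v ∈ X then 1 else 0) ∧
    ∃ (r : ℕ) (T' : Trigraph (X ⊕ Fin r)), T.IsBlock X r T' ∧ s.var 2 = r ∧
      ∀ p q : X ⊕ Fin r, s.arr 2 (blockName p * (n + 3) + blockName q) = code (T'.θ p q))

end Trigraph

namespace Trigraph

section BalancedSkewPartitions

variable {V : Type*} [Finite V] {T : Trigraph V}

@[simp] theorem compl_compl : T.compl.compl = T := by
  cases T; simp [compl]

theorem compl_strongAdj {u v : V} : T.compl.StrongAdj u v ↔ T.StrongAnti u v := by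
  simp [StrongAdj, StrongAnti, compl, neg_eq_iff_eq_neg]

theorem compl_strongAnti {u v : V} : T.compl.StrongAnti u v ↔ T.StrongAdj u v := by
  simp [StrongAdj, StrongAnti, compl]

theorem compl_semi {u v : V} : T.compl.Semi u v ↔ T.Semi u v := by
  simp [Semi, compl]

theorem compl_adj {u v : V} : T.compl.Adj u v ↔ T.Anti u v := by
  simp [Adj, Anti, compl_strongAdj, compl_semi]

theorem compl_anti {u v : V} : T.compl.Anti u v ↔ T.Adj u v := by
  simp [Adj, Anti, compl_strongAnti, compl_semi]

theorem StrongAdj.symm {u v : V} (h : T.StrongAdj u v) : T.StrongAdj v u :=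
  (T.symm v u).trans h

theorem StrongAnti.symm {u v : V} (h : T.StrongAnti u v) : T.StrongAnti v u :=
  (T.symm v u).trans h

theorem Semi.symm {u v : V} (h : T.Semi u v) : T.Semi v u :=
  ⟨h.1.symm, (T.symm v u).trans h.2⟩

theorem Adj.symm {u v : V} (h : T.Adj u v) : T.Adj v u :=
  h.imp StrongAdj.symm Semi.symm

theorem Anti.symm {u v : V} (h : T.Anti u v) : T.Anti v u :=
  h.imp StrongAnti.symm Semi.symm

theorem StrongAdj.ne {u v : V} (h : T.StrongAdj u v) : u ≠ v := by
  rintro rfl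
  rw [StrongAdj, T.diag] at h
  exact absurd h (by decide)

theorem StrongAnti.ne {u v : V} (h : T.StrongAnti u v) : u ≠ v := by
  rintro rfl
  rw [StrongAnti, T.diag] at h
  exact absurd h (by decide)

theorem Adj.ne {u v : V} (h : T.Adj u v) : u ≠ v := h.elim StrongAdj.ne And.left

theorem Anti.ne {u v : V} (h : T.Anti u v) : u ≠ v := h.elim StrongAnti.ne And.left

theorem StrongAdj.not_anti {u v : V} (h : T.StrongAdj u v) : ¬ T.Anti u v := by
  unfold StrongAdj at h
  rintro (h' | ⟨-, h'⟩) <;> exact absurd (h.symm.trans h') (by decide)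

theorem StrongAnti.not_adj {u v : V} (h : T.StrongAnti u v) : ¬ T.Adj u v := by
  unfold StrongAnti at h
  rintro (h' | ⟨-, h'⟩) <;> exact absurd (h.symm.trans h') (by decide)

theorem StrongAnti.not_strongAdj {u v : V} (h : T.StrongAnti u v) : ¬ T.StrongAdj u v :=
  fun h' => h.not_adj (Or.inl h')

theorem StrongAdj.not_strongAnti {u v : V} (h : T.StrongAdj u v) : ¬ T.StrongAnti u v :=
  fun h' => h'.not_strongAdj h

theorem trichotomy {u v : V} (h : u ≠ v) : T.StrongAdj u v ∨ T.StrongAnti u v ∨ T.Semi u v := by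
  rcases hθ : T.θ u v with _ | _ | _
  · exact Or.inr (Or.inr ⟨h, hθ⟩)
  · exact Or.inr (Or.inl hθ)
  · exact Or.inl hθ

theorem not_strongAdj {u v : V} (h : u ≠ v) : ¬ T.StrongAdj u v ↔ T.Anti u v := by
  refine ⟨fun h' => ?_, fun h1 h2 => h2.not_anti h1⟩
  rcases T.trichotomy h with h1 | h1 | h1
  · exact absurd h1 h'
  · exact Or.inl h1
  · exact Or.inr h1

theorem not_strongAnti {u v : V} (h : u ≠ v) : ¬ T.StrongAnti u v ↔ T.Adj u v := by
  refine ⟨fun h' => ?_, fun h1 h2 => h2.not_adj h1⟩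
  rcases T.trichotomy h with h1 | h1 | h1
  · exact Or.inl h1
  · exact absurd h1 h'
  · exact Or.inr h1

theorem Adj.not_strongAnti {u v : V} (h : T.Adj u v) : ¬ T.StrongAnti u v :=
  fun h' => h'.not_adj h

theorem IsBerge.compl (h : T.IsBerge) : T.compl.IsBerge := fun k p hk =>
  ⟨(h k p hk).2, by rw [compl_compl]; exact (h k p hk).1⟩

theorem HasBalancedSkewPartition.of_compl (h : T.compl.HasBalancedSkewPartition) :
    T.HasBalancedSkewPartition := by
  obtain ⟨A, B, ⟨h1, h2, h3, h4⟩, h5, h6⟩ := h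
  refine ⟨B, A, ⟨h1.symm, by rw [Set.union_comm, h2], ?_, h3⟩, ?_, h5⟩
  · rwa [IsAnticonnected, compl_compl] at h4
  · rwa [compl_compl] at h6

theorem InF.compl (h : T.InF) : T.compl.InF := by
  have hs : T.compl.switchGraph = T.switchGraph := by
    ext u v
    exact compl_semi
  refine ⟨h.berge.compl, ?_, ?_⟩
  · rw [hs]; exact h.components
  · rw [hs]
    intro v x y hxy hv
    refine (h.heavy_or_light v x y hxy hv).symm.imp ?_ ?_
    · rintro ⟨h1, h2⟩
      exact ⟨fun a ha b hb => compl_strongAdj.2 (h1 a ha b hb), compl_strongAdj.2 h2⟩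
    · rintro ⟨h1, h2⟩
      exact ⟨fun a ha b hb => compl_strongAnti.2 (h1 a ha b hb), compl_strongAnti.2 h2⟩

theorem not_isConnected {P Q A : Set V} (hA : A = P ∪ Q) (hP : P.Nonempty) (hQ : Q.Nonempty)
    (h : T.StrongAnticomplete P Q) : ¬ T.IsConnected A := by
  subst hA
  intro hc
  obtain ⟨p, hp⟩ := hP
  obtain ⟨q, hq⟩ := hQ
  have key : ∀ x y : ↥(P ∪ Q), (T.full.induce (P ∪ Q)).Reachable x y → (x : V) ∈ P →
      (y : V) ∈ P := by
    rintro x y ⟨w⟩ hx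
    induction w with
    | nil => exact hx
    | cons hadj _ ih =>
      refine ih ?_
      rename_i b _ _
      rcases b.2 with hb | hb
      · exact hb
      · exact absurd hadj (h _ hx _ hb).not_adj
  have := key ⟨p, Or.inl hp⟩ ⟨q, Or.inr hq⟩ (hc _ _) hp
  exact (h _ this _ hq).ne rfl

/-- A vertex that is adjacent to the ends and antiadjacent to the interior of an odd path of
length at least three would complete an odd hole. -/
theorem IsBerge.no_path_of_apex (hB : T.IsBerge) {X Y : Set V} {z : V} (hX : ∀ x ∈ X, T.Adj z x)
    (hY : ∀ y ∈ Y, T.Anti z y) {k : ℕ} {p : Fin (k + 1) → V} (hk : Odd k) (hk1 : 1 < k)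
    (hp : T.PathVia p X X Y) : False := by
  obtain ⟨⟨hinj, hpath⟩, h0, hl, hint⟩ := hp
  have hne : ∀ i, z ≠ p i := by
    intro i
    by_cases hi0 : i = 0
    · subst hi0; exact (hX _ h0).ne
    by_cases hil : i = Fin.last k
    · subst hil; exact (hX _ hl).ne
    exact (hY _ (hint i hi0 hil)).ne
  refine (hB (k + 2) (Fin.cons z p : Fin (k + 2) → V) (by
    obtain ⟨m, rfl⟩ := hk; exact ⟨m + 1, by ring⟩)).1 ⟨by omega, ?_, ?_⟩
  · rw [Fin.cons_injective_iff]
    exact ⟨fun ⟨i, hi⟩ => hne i hi.symm, hinj⟩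
  · intro i j
    refine Fin.cases ?_ (fun i => ?_) i <;> refine Fin.cases ?_ (fun j => ?_) j <;> intro hij
    · simp at hij
    · change (((j : ℕ) + 1 = 0 + 1 ∨ (j : ℕ) + 1 = 0 + (k + 1)) → T.Adj z (p j)) ∧
        ((0 + 1 < (j : ℕ) + 1 ∧ (j : ℕ) + 1 < 0 + (k + 1)) → T.Anti z (p j))
      constructor
      · rintro (h | h)
        · have : j = 0 := Fin.ext (by change (j : ℕ) = 0; omega)
          subst this; exact hX _ h0
        · have : j = Fin.last k := Fin.ext (by simp; omega)
          subst this; exact hX _ hl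
      · rintro ⟨h1, h2⟩
        refine hY _ (hint j ?_ ?_)
        · rintro rfl; simp at h1
        · rintro rfl; simp at h2
    · simp at hij
    · simp only [Fin.cons_succ, Fin.val_succ]
      have hij' : i < j := by simpa using hij
      constructor
      · rintro (h | h)
        · exact (hpath i j hij').1 (by omega)
        · have := j.2; omega
      · rintro ⟨h1, h2⟩
        exact (hpath i j hij').2 (by omega)

/-- The vertex `x` has a neighbor and another antineighbor in `Y`. -/
def MixedOn (T : Trigraph V) (x : V) (Y : Set V) : Prop :=
  ∃ y ∈ Y, ∃ y' ∈ Y, y ≠ y' ∧ T.Adj x y ∧ T.Anti x y'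

/-- A condition that rules out long odd paths with ends in `X` and interior in `Y`, and long
odd antipaths with ends in `Y` and interior in `X`. -/
def Tame (T : Trigraph V) (X Y : Set V) : Prop :=
  (∃ z, (∀ x ∈ X, T.Adj z x) ∧ ∀ y ∈ Y, T.Anti z y) ∨ {x | x ∈ X ∧ T.MixedOn x Y}.Subsingleton

theorem Tame.no_path (hB : T.IsBerge) {X Y : Set V} (h : T.Tame X Y) {k : ℕ}
    {p : Fin (k + 1) → V} (hk : Odd k) (hk1 : 1 < k) : ¬ T.PathVia p X X Y := by
  intro hp
  rcases h with ⟨z, hX, hY⟩ | h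
  · exact hB.no_path_of_apex hX hY hk hk1 hp
  obtain ⟨⟨hinj, hpath⟩, h0, hl, hint⟩ := hp
  have hk2 : 2 < k := by obtain ⟨m, rfl⟩ := hk; omega
  let a : Fin (k + 1) := ⟨1, by omega⟩
  let b : Fin (k + 1) := ⟨k - 1, by omega⟩
  have ha : p a ∈ Y := hint a (by simp [a, Fin.ext_iff]) (by simp [a, Fin.ext_iff]; omega)
  have hb : p b ∈ Y := hint b (by simp [b, Fin.ext_iff]; omega) (by simp [b, Fin.ext_iff]; omega)
  have hab : p a ≠ p b := fun e => by have := hinj e; simp [a, b] at this; omega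
  have e1 := hpath 0 a (by simp [a, Fin.lt_def])
  have e2 := hpath 0 b (by simp [b, Fin.lt_def]; omega)
  have e3 := hpath a (Fin.last k) (by simp [a, Fin.lt_def]; omega)
  have e4 := hpath b (Fin.last k) (by simp [b, Fin.lt_def]; omega)
  have := @h (p 0) ⟨h0, p a, ha, p b, hb, hab, e1.1 (by simp [a]), e2.2 (by simp [b]; omega)⟩
    (p (Fin.last k)) ⟨hl, p b, hb, p a, ha, hab.symm, (e4.1 (by simp [b]; omega)).symm,
      (e3.2 (by simp [a]; omega)).symm⟩
  have := hinj this
  simp [Fin.ext_iff] at this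
  omega

theorem Tame.no_antipath (hB : T.IsBerge) {X Y : Set V} (h : T.Tame X Y) {k : ℕ}
    {p : Fin (k + 1) → V} (hk : Odd k) (hk1 : 1 < k) : ¬ T.compl.PathVia p Y Y X := by
  intro hp
  rcases h with ⟨z, hX, hY⟩ | h
  · exact hB.compl.no_path_of_apex (z := z) (fun y hy => compl_adj.2 (hY y hy))
      (fun y hy => compl_anti.2 (hX y hy)) hk hk1 hp
  obtain ⟨⟨hinj, hpath⟩, h0, hl, hint⟩ := hp
  have hk2 : 2 < k := by obtain ⟨m, rfl⟩ := hk; omega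
  let a : Fin (k + 1) := ⟨1, by omega⟩
  let b : Fin (k + 1) := ⟨k - 1, by omega⟩
  have ha : p a ∈ X := hint a (by simp [a, Fin.ext_iff]) (by simp [a, Fin.ext_iff]; omega)
  have hb : p b ∈ X := hint b (by simp [b, Fin.ext_iff]; omega) (by simp [b, Fin.ext_iff]; omega)
  have h0l : p 0 ≠ p (Fin.last k) := fun e => by
    have := hinj e; simp [Fin.ext_iff] at this; omega
  have e1 := hpath 0 a (by simp [a, Fin.lt_def])
  have e2 := hpath 0 b (by simp [b, Fin.lt_def]; omega)
  have e3 := hpath a (Fin.last k) (by simp [a, Fin.lt_def]; omega)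
  have e4 := hpath b (Fin.last k) (by simp [b, Fin.lt_def]; omega)
  simp only [compl_adj, compl_anti] at e1 e2 e3 e4
  have := @h (p a) ⟨ha, _, hl, _, h0, h0l.symm, e3.2 (by simp [a]; omega),
      (e1.1 (by simp [a])).symm⟩
    (p b) ⟨hb, _, h0, _, hl, h0l, (e2.2 (by simp [b]; omega)).symm,
      e4.1 (by simp [b]; omega)⟩
  have := hinj this
  simp [a, b] at this
  omega

theorem PathVia.split {S N P M : Set V} (hSN : T.StrongComplete S N)
    (hPM : T.StrongAnticomplete P M) {k : ℕ} {p : Fin (k + 1) → V} (hk : 1 < k)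
    (hp : T.PathVia p (S ∪ N) (S ∪ N) (P ∪ M)) :
    T.PathVia p S S P ∨ T.PathVia p S S M ∨ T.PathVia p N N P ∨ T.PathVia p N N M := by
  obtain ⟨⟨hinj, hpath⟩, h0, hl, hint⟩ := hp
  have h0l := (hpath 0 (Fin.last k) (by simp [Fin.lt_def]; omega)).2 (by simpa using hk)
  have hends : (p 0 ∈ S ∧ p (Fin.last k) ∈ S) ∨ (p 0 ∈ N ∧ p (Fin.last k) ∈ N) := by
    rcases h0 with h0 | h0 <;> rcases hl with hl | hl
    · exact Or.inl ⟨h0, hl⟩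
    · exact absurd h0l (hSN _ h0 _ hl).not_anti
    · exact absurd h0l.symm (hSN _ hl _ h0).not_anti
    · exact Or.inr ⟨h0, hl⟩
  have hstep : ∀ R : Set V, (∀ (i : ℕ) (hi : i + 1 < k), 1 ≤ i →
      p ⟨i, by omega⟩ ∈ R → p ⟨i + 1, by omega⟩ ∈ R) → p ⟨1, by omega⟩ ∈ R →
      ∀ i, i ≠ 0 → i ≠ Fin.last k → p i ∈ R := by
    intro R hR h1
    have : ∀ (i : ℕ) (hi : i + 1 < k), p ⟨i + 1, by omega⟩ ∈ R := by
      intro i hi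
      induction i with
      | zero => exact h1
      | succ i ih => exact hR (i + 1) hi (by omega) (ih (by omega))
    intro i hi0 hil
    have h1 : (i : ℕ) ≠ 0 := fun h => hi0 (Fin.ext h)
    have h2 : (i : ℕ) ≠ k := fun h => hil (Fin.ext (by simpa using h))
    have := this (i - 1) (by omega)
    convert this using 3
    omega
  have hmem : ∀ (i : ℕ) (_ : 1 ≤ i) (hi : i < k), p ⟨i, by omega⟩ ∈ P ∪ M := fun i h1 hi =>
    hint _ (by simp [Fin.ext_iff]; omega) (by simp [Fin.ext_iff]; omega)
  have hadj : ∀ (i : ℕ) (hi : i + 1 < k), T.Adj (p ⟨i, by omega⟩) (p ⟨i + 1, by omega⟩) :=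
    fun i hi => (hpath _ _ (by simp [Fin.lt_def])).1 rfl
  have hints : (∀ i, i ≠ 0 → i ≠ Fin.last k → p i ∈ P) ∨
      (∀ i, i ≠ 0 → i ≠ Fin.last k → p i ∈ M) := by
    rcases hmem 1 le_rfl hk with h1 | h1
    · refine Or.inl (hstep P (fun i hi hi1 hiP => ?_) h1)
      exact (hmem (i + 1) (by omega) hi).resolve_right fun h =>
        (hPM _ hiP _ h).not_adj (hadj i hi)
    · refine Or.inr (hstep M (fun i hi hi1 hiM => ?_) h1)
      exact (hmem (i + 1) (by omega) hi).resolve_left fun h =>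
        (hPM _ h _ hiM).not_adj (hadj i hi).symm
  have hpp : T.IsPath p := ⟨hinj, hpath⟩
  rcases hends with ⟨a, b⟩ | ⟨a, b⟩ <;> rcases hints with c | c
  · exact Or.inl ⟨hpp, a, b, c⟩
  · exact Or.inr (Or.inl ⟨hpp, a, b, c⟩)
  · exact Or.inr (Or.inr (Or.inl ⟨hpp, a, b, c⟩))
  · exact Or.inr (Or.inr (Or.inr ⟨hpp, a, b, c⟩))

/-- Four sets that give a balanced skew-partition `(P ∪ M, S ∪ N)`. -/
theorem IsBerge.hasBalancedSkewPartition (hB : T.IsBerge) {S N P M : Set V}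
    (hcov : P ∪ M = (S ∪ N)ᶜ) (hS : S.Nonempty) (hN : N.Nonempty) (hP : P.Nonempty)
    (hM : M.Nonempty) (hSN : T.StrongComplete S N) (hPM : T.StrongAnticomplete P M)
    (hSP : T.Tame S P) (hSM : T.Tame S M) (hNP : T.Tame N P) (hNM : T.Tame N M) :
    T.HasBalancedSkewPartition := by
  have hPM' : T.compl.StrongComplete P M := fun a ha b hb => compl_strongAdj.2 (hPM a ha b hb)
  have hSN' : T.compl.StrongAnticomplete S N := fun a ha b hb =>
    compl_strongAnti.2 (hSN a ha b hb)
  refine ⟨P ∪ M, S ∪ N, ⟨?_, ?_, ?_, ?_⟩, ?_, ?_⟩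
  · rw [hcov]; exact disjoint_compl_left
  · rw [hcov]; exact Set.compl_union_self _
  · exact not_isConnected rfl hP hM hPM
  · exact not_isConnected rfl hS hN hSN'
  · rintro ⟨k, p, hk, hk1, hp⟩
    rcases hp.split hSN hPM hk1 with h | h | h | h
    · exact hSP.no_path hB hk hk1 h
    · exact hSM.no_path hB hk hk1 h
    · exact hNP.no_path hB hk hk1 h
    · exact hNM.no_path hB hk hk1 h
  · rintro ⟨k, p, hk, hk1, hp⟩
    rcases hp.split hPM' hSN' hk1 with h | h | h | h
    · exact hSP.no_antipath hB hk hk1 h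
    · exact hNP.no_antipath hB hk hk1 h
    · exact hSM.no_antipath hB hk hk1 h
    · exact hNM.no_antipath hB hk hk1 h

theorem tame_of_subsingleton {X Y : Set V} (h : X.Subsingleton) : T.Tame X Y :=
  Or.inr fun _ ha _ hb => h ha.1 hb.1

theorem tame_of_subsingleton_right {X Y : Set V} (h : Y.Subsingleton) : T.Tame X Y :=
  Or.inr fun _ ⟨_, _, hy, _, hy', hne, _⟩ => absurd (h hy hy') hne

theorem tame_of_apex {X Y : Set V} (z : V) (hX : ∀ x ∈ X, T.Adj z x) (hY : ∀ y ∈ Y, T.Anti z y) :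
    T.Tame X Y :=
  Or.inl ⟨z, hX, hY⟩

theorem tame_of_anticomplete {X Y : Set V} (h : T.StrongAnticomplete X Y) : T.Tame X Y :=
  Or.inr fun _ ⟨hx, _, hy, _, _, _, hadj, _⟩ => absurd hadj (h _ hx _ hy).not_adj

theorem tame_of_complete {X Y : Set V} (h : T.StrongComplete X Y) : T.Tame X Y :=
  Or.inr fun _ ⟨hx, _, _, _, hy', _, _, hanti⟩ => absurd hanti (h _ hx _ hy').not_anti

end BalancedSkewPartitions

end Trigraph

namespace Trigraph

section Obstructions

variable {V : Type*} [Finite V] {T : Trigraph V}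

/-- Every vertex outside `H` is strongly complete or strongly anticomplete to `A`. -/
def Uniform (T : Trigraph V) (A H : Set V) : Prop :=
  ∀ v ∉ H, (∀ a ∈ A, T.StrongAdj v a) ∨ ∀ a ∈ A, T.StrongAnti v a

theorem Uniform.compl {A H : Set V} (h : T.Uniform A H) : T.compl.Uniform A H := fun v hv =>
  (h v hv).symm.imp (fun h a ha => compl_strongAdj.2 (h a ha))
    fun h a ha => compl_strongAnti.2 (h a ha)

theorem IsBerge.no_homogeneous_set (hB : T.IsBerge) (hT : ¬ T.HasBalancedSkewPartition)
    {H : Set V} {a b n m : V} (ha : a ∈ H) (hb : b ∈ H) (hab : a ≠ b) (hn : n ∉ H) (hm : m ∉ H)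
    (hna : T.StrongAdj n a) (hma : T.StrongAnti m a) (hH : T.Uniform H H) : False := by
  have key : ∀ v ∉ H, (T.StrongAdj v a → ∀ h ∈ H, T.StrongAdj v h) ∧
      (¬ T.StrongAdj v a → ∀ h ∈ H, T.StrongAnti v h) := fun v hv =>
    ⟨fun h => (hH v hv).resolve_right fun h' => h.not_strongAnti (h' a ha),
      fun h => (hH v hv).resolve_left fun h' => h (h' a ha)⟩
  refine hT (hB.hasBalancedSkewPartition (S := {a}) (N := {v | v ∉ H ∧ T.StrongAdj v a})
    (P := H \ {a}) (M := {v | v ∉ H ∧ ¬ T.StrongAdj v a}) ?_ ⟨a, rfl⟩ ⟨n, hn, hna⟩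
    ⟨b, hb, hab.symm⟩ ⟨m, hm, hma.not_strongAdj⟩ ?_ ?_ (tame_of_subsingleton (by simp))
    (tame_of_subsingleton (by simp)) ?_ ?_)
  · ext v
    by_cases hv : v ∈ H
    · simp [hv]
    · have : v ≠ a := by rintro rfl; exact hv ha
      simp [hv, this]
  · rintro _ rfl v ⟨-, hv⟩; exact hv.symm
  · rintro v ⟨hv, -⟩ w ⟨hw, hwa⟩; exact ((key w hw).2 hwa v hv).symm
  · exact tame_of_complete fun v ⟨hv, hva⟩ w ⟨hw, _⟩ => (key v hv).1 hva w hw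
  · exact tame_of_apex a (fun v hv => Or.inl hv.2.symm)
      fun v hv => Or.inl ((key v hv.1).2 hv.2 a ha).symm

theorem IsBerge.no_pair_of_strongAdj (hB : T.IsBerge) (hT : ¬ T.HasBalancedSkewPartition)
    {A : Set V} {a a' b n m : V} (ha : a ∈ A) (ha' : a' ∈ A) (hb : b ∉ A)
    (hba : T.StrongAdj b a) (hba' : ¬ T.StrongAdj b a') (hn : n ∉ insert b A)
    (hm : m ∉ insert b A)
    (hna : T.StrongAdj n a) (hma : T.StrongAnti m a) (hA : T.Uniform A (insert b A)) : False := by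
  have key : ∀ v ∉ insert b A, (T.StrongAdj v a → ∀ h ∈ A, T.StrongAdj v h) ∧
      (¬ T.StrongAdj v a → ∀ h ∈ A, T.StrongAnti v h) := fun v hv =>
    ⟨fun h => (hA v hv).resolve_right fun h' => h.not_strongAnti (h' a ha),
      fun h => (hA v hv).resolve_left fun h' => h (h' a ha)⟩
  refine hT (hB.hasBalancedSkewPartition (S := {v | v ∈ A ∧ T.StrongAdj b v})
    (N := insert b {v | v ∉ insert b A ∧ T.StrongAdj v a})
    (P := {v | v ∈ A ∧ ¬ T.StrongAdj b v}) (M := {v | v ∉ insert b A ∧ ¬ T.StrongAdj v a})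
    ?_ ⟨a, ha, hba⟩ ⟨n, Or.inr ⟨hn, hna⟩⟩
    ⟨a', ha', hba'⟩ ⟨m, hm, hma.not_strongAdj⟩ ?_ ?_ ?_ ?_ ?_ ?_)
  · ext v
    by_cases hvb : v = b
    · subst hvb; simp [hb]
    by_cases hv : v ∈ A <;> simp [hv, hvb]
  · rintro v ⟨hv, hvb⟩ w (rfl | ⟨hw, hwa⟩)
    · exact hvb.symm
    · exact ((key w hw).1 hwa v hv).symm
  · rintro v ⟨hv, -⟩ w ⟨hw, hwa⟩; exact ((key w hw).2 hwa v hv).symm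
  · exact tame_of_apex b (fun v hv => Or.inl hv.2) fun v hv =>
      (not_strongAdj (by rintro rfl; exact hb hv.1)).1 hv.2
  · exact tame_of_anticomplete fun v ⟨hv, _⟩ w ⟨hw, hwa⟩ => ((key w hw).2 hwa v hv).symm
  · refine Or.inr ?_
    rintro x ⟨hx, y, hy, y', hy', -, -, hxy'⟩ z ⟨hz, w, hw, w', hw', -, -, hzw'⟩
    have aux : ∀ v ∈ insert b {v | v ∉ insert b A ∧ T.StrongAdj v a}, ∀ u ∈ A, T.Anti v u →
        v = b := by
      rintro v (rfl | ⟨hv, hva⟩) u hu hvu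
      · rfl
      · exact absurd hvu ((key v hv).1 hva u hu).not_anti
    rw [aux x hx y' hy'.1 hxy', aux z hz w' hw'.1 hzw']
  · refine tame_of_apex a ?_ fun v hv => Or.inl ((key v hv.1).2 hv.2 a ha).symm
    rintro v (rfl | hv)
    · exact Or.inl hba.symm
    · exact Or.inl hv.2.symm

theorem IsBerge.no_pair (hB : T.IsBerge) (hT : ¬ T.HasBalancedSkewPartition)
    {A : Set V} {a a' b c n m : V} (ha : a ∈ A) (ha' : a' ∈ A) (haa' : a ≠ a') (hb : b ∉ A)
    (hc : c ∈ A) (hbc : ¬ T.Semi b c) (hn : n ∉ insert b A) (hm : m ∉ insert b A)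
    (hna : T.StrongAdj n a) (hma : T.StrongAnti m a) (hA : T.Uniform A (insert b A)) : False := by
  have hcA : ∀ v ∉ insert b A, (T.StrongAdj v a → T.StrongAdj v c) ∧
      (T.StrongAnti v a → T.StrongAnti v c) := fun v hv => by
    rcases hA v hv with h | h
    · exact ⟨fun _ => h c hc, fun h' => absurd (h a ha) h'.not_strongAdj⟩
    · exact ⟨fun h' => absurd (h a ha) h'.not_strongAnti, fun _ => h c hc⟩
  have hnc := (hcA n hn).1 hna
  have hmc := (hcA m hm).2 hma
  rcases T.trichotomy (u := b) (v := c) (by rintro rfl; exact hb hc) with h | h | h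
  · by_cases hall : ∀ v ∈ A, T.StrongAdj b v
    · refine hB.no_homogeneous_set hT ha ha' haa' (fun h => hn (Or.inr h))
        (fun h => hm (Or.inr h)) hna hma fun v hv => ?_
      by_cases hvb : v = b
      · subst hvb; exact Or.inl hall
      · exact hA v (by simp [hvb, hv])
    · push Not at hall
      obtain ⟨x, hx, hbx⟩ := hall
      exact hB.no_pair_of_strongAdj hT hc hx hb h hbx hn hm hnc hmc hA
  · by_cases hall : ∀ v ∈ A, T.StrongAnti b v
    · refine hB.no_homogeneous_set hT ha ha' haa' (fun h => hn (Or.inr h))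
        (fun h => hm (Or.inr h)) hna hma fun v hv => ?_
      by_cases hvb : v = b
      · subst hvb; exact Or.inr hall
      · exact hA v (by simp [hvb, hv])
    · push Not at hall
      obtain ⟨x, hx, hbx⟩ := hall
      exact hB.compl.no_pair_of_strongAdj (fun h => hT h.of_compl) hc hx hb
        (compl_strongAdj.2 h) (by rwa [compl_strongAdj]) hm hn (compl_strongAdj.2 hmc)
        (compl_strongAnti.2 hnc) hA.compl
  · exact hbc h

theorem IsBerge.no_one_sided (hB : T.IsBerge) (hT : ¬ T.HasBalancedSkewPartition)
    {A C : Set V} {a c n m : V} (ha : a ∈ A) (hc : c ∈ C) (hAC : Disjoint A C)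
    (hn : n ∉ A ∪ C) (hm : m ∉ A ∪ C)
    (hna : T.StrongAdj n a) (hma : T.StrongAnti m a) (hA : T.Uniform A (A ∪ C))
    (hC : ∀ v ∉ A ∪ C, ∀ c ∈ C, T.StrongAnti v c) : False := by
  have key : ∀ v ∉ A ∪ C, (T.StrongAdj v a → ∀ h ∈ A, T.StrongAdj v h) ∧
      (¬ T.StrongAdj v a → ∀ h ∈ A, T.StrongAnti v h) := fun v hv =>
    ⟨fun h => (hA v hv).resolve_right fun h' => h.not_strongAnti (h' a ha),
      fun h => (hA v hv).resolve_left fun h' => h (h' a ha)⟩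
  refine hT (hB.hasBalancedSkewPartition (S := A)
    (N := {v | v ∉ A ∪ C ∧ T.StrongAdj v a})
    (P := C) (M := {v | v ∉ A ∪ C ∧ ¬ T.StrongAdj v a})
    ?_ ⟨a, ha⟩ ⟨n, hn, hna⟩ ⟨c, hc⟩ ⟨m, hm, hma.not_strongAdj⟩ ?_ ?_ ?_ ?_ ?_ ?_)
  · ext v
    by_cases hv : v ∈ A
    · simp [hv, Set.disjoint_left.1 hAC hv]
    by_cases hv' : v ∈ C <;> simp [hv, hv']
  · rintro v hv w ⟨hw, hwa⟩
    exact ((key w hw).1 hwa v hv).symm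
  · rintro v hv w ⟨hw, -⟩; exact (hC w hw v hv).symm
  · exact tame_of_apex n (fun v hv => Or.inl ((key n hn).1 hna v hv)) fun v hv =>
      Or.inl (hC n hn v hv)
  · exact tame_of_anticomplete fun v hv w ⟨hw, hwa⟩ => ((key w hw).2 hwa v hv).symm
  · exact tame_of_anticomplete fun v ⟨hv, _⟩ w hw => hC v hv w hw
  · exact tame_of_apex a (fun v hv => Or.inl hv.2.symm)
      fun v hv => Or.inl ((key v hv.1).2 hv.2 a ha).symm

theorem IsBerge.no_edge_cutset (hB : T.IsBerge) (hT : ¬ T.HasBalancedSkewPartition)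
    {P : Set V} {a b p m : V} (hab : T.StrongAdj a b) (hp : p ∈ P) (haP : a ∉ P) (hbP : b ∉ P)
    (hmP : m ∉ P) (hma : m ≠ a) (hmb : m ≠ b)
    (hP : ∀ v ∈ P, ∀ w ∉ P, w ≠ a → w ≠ b → T.StrongAnti v w) : False := by
  refine hT (hB.hasBalancedSkewPartition (S := {a}) (N := {b}) (P := P)
    (M := {w | w ∉ P ∧ w ≠ a ∧ w ≠ b}) ?_ ⟨a, rfl⟩ ⟨b, rfl⟩ ⟨p, hp⟩ ⟨m, hmP, hma, hmb⟩ ?_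
    (fun v hv w hw => hP v hv w hw.1 hw.2.1 hw.2.2) (tame_of_subsingleton (by simp))
    (tame_of_subsingleton (by simp)) (tame_of_subsingleton (by simp))
    (tame_of_subsingleton (by simp)))
  · ext v
    by_cases hv : v ∈ P
    · have h1 : v ≠ a := by rintro rfl; exact haP hv
      have h2 : v ≠ b := by rintro rfl; exact hbP hv
      simp [hv, h1, h2]
    · simp [hv]; tauto
  · rintro _ rfl _ rfl; exact hab

/-- If `d'` has all the neighbors of `d` and the two are antiadjacent, then there is a balanced
skew-partition. -/
theorem IsBerge.no_dominated (hB : T.IsBerge) (hT : ¬ T.HasBalancedSkewPartition)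
    {N : Set V} {d d' n m : V} (hdd' : d ≠ d') (hdN : d ∉ N) (hn : n ∈ N)
    (hm : m ∉ N) (hmd : m ≠ d) (hmd' : m ≠ d')
    (hd : ∀ v ∈ N, T.StrongAdj d v) (hd' : ∀ v ∈ N, T.StrongAdj d' v)
    (hdM : ∀ v ∉ N, v ≠ d → T.StrongAnti d v) : False := by
  refine hT (hB.hasBalancedSkewPartition (S := {d'}) (N := N) (P := {d})
    (M := {w | w ∉ N ∧ w ≠ d ∧ w ≠ d'}) ?_ ⟨d', rfl⟩ ⟨n, hn⟩ ⟨d, rfl⟩ ⟨m, hm, hmd, hmd'⟩ ?_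
    ?_ (tame_of_subsingleton (by simp)) (tame_of_subsingleton (by simp))
    (tame_of_subsingleton_right (by simp)) ?_)
  · ext v
    by_cases hv : v = d
    · subst hv; simp [hdd', hdN]
    · simp [hv]; tauto
  · rintro _ rfl w hw; exact hd' w hw
  · rintro _ rfl w hw; exact hdM w hw.1 hw.2.1
  · exact tame_of_apex d (fun v hv => Or.inl (hd v hv)) fun v hv => Or.inl (hdM v hv.1 hv.2.1)

theorem InF.eq_or_eq_of_semi (hF : T.InF) {v x y z : V} (hxy : x ≠ y) (hx : T.Semi v x)
    (hy : T.Semi v y) (hz : T.Semi v z) : z = x ∨ z = y := by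
  by_contra! h
  have h3 := hF.components (T.switchGraph.connectedComponentMk v)
  have hadj : ∀ w, T.Semi v w → s(v, w) ∈ {e ∈ T.switchGraph.edgeSet |
      ∀ u ∈ e, u ∈ (T.switchGraph.connectedComponentMk v).supp} := by
    intro w hw
    have hw' : T.switchGraph.Adj v w := hw
    refine ⟨hw', fun u hu => ?_⟩
    rcases Sym2.mem_iff.1 hu with rfl | rfl
    · rfl
    · exact SimpleGraph.ConnectedComponent.sound hw'.reachable.symm
  have hsub : ({s(v, x), s(v, y), s(v, z)} : Set (Sym2 V)) ⊆ {e ∈ T.switchGraph.edgeSet |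
      ∀ u ∈ e, u ∈ (T.switchGraph.connectedComponentMk v).supp} := by
    rintro e (rfl | rfl | rfl)
    · exact hadj x hx
    · exact hadj y hy
    · exact hadj z hz
  have hcard : ({s(v, x), s(v, y), s(v, z)} : Set (Sym2 V)).ncard = 3 := by
    rw [Set.ncard_eq_three]
    refine ⟨_, _, _, ?_, ?_, ?_, rfl⟩ <;> simp [hxy, h.1.symm, h.2.symm, hx.1.symm, hy.1.symm]
  have := Set.ncard_le_ncard hsub (Set.toFinite _)
  omega

theorem InF.strong_of_two_semi (hF : T.InF) {v x y : V} (hxy : x ≠ y) (hx : T.Semi v x)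
    (hy : T.Semi v y) :
    (∀ w, w ≠ v → w ≠ x → w ≠ y → T.StrongAdj v w) ∨
      (∀ w, w ≠ v → w ≠ x → w ≠ y → T.StrongAnti v w) := by
  refine (hF.heavy_or_light v x y hxy ?_).imp ?_ ?_
  · ext z
    simp only [SimpleGraph.mem_neighborSet, Set.mem_insert_iff, Set.mem_singleton_iff]
    refine ⟨fun hz => hF.eq_or_eq_of_semi hxy hx hy hz, ?_⟩
    rintro (rfl | rfl) <;> assumption
  · rintro ⟨h, -⟩ w h1 h2 h3
    exact h v rfl w (by simp [h1, h2, h3])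
  · rintro ⟨h, -⟩ w h1 h2 h3
    exact h v rfl w (by simp [h1, h2, h3])

/-- A vertex with a strong neighbor and a strong antineighbor outside `A` is not semiadjacent
to all vertices of `A`, if `A` has at least two vertices. -/
theorem InF.exists_not_semi (hF : T.InF) {A : Set V} {a a' b x y : V} (ha : a ∈ A) (ha' : a' ∈ A)
    (haa' : a ≠ a') (hx : T.StrongAdj b x) (hy : T.StrongAnti b y) (hxA : x ∉ A) (hyA : y ∉ A) :
    ∃ c ∈ A, ¬ T.Semi b c := by
  by_contra! h
  rcases hF.strong_of_two_semi haa' (h a ha) (h a' ha') with h' | h'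
  · exact hy.not_strongAdj (h' y hy.ne.symm (by rintro rfl; exact hyA ha)
      (by rintro rfl; exact hyA ha'))
  · exact hx.not_strongAnti (h' x hx.ne.symm (by rintro rfl; exact hxA ha)
      (by rintro rfl; exact hxA ha'))

end Obstructions

end Trigraph

namespace Trigraph

section TwoJoins

variable {V : Type*} [Finite V] {T : Trigraph V} {A₁ B₁ C₁ A₂ B₂ C₂ : Set V}

theorem IsTwoPath.symm {X : Set V} {a b : V} (h : T.IsTwoPath X a b) : T.IsTwoPath X b a := by
  obtain ⟨c, h1, h2, h3, h4, h5⟩ := h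
  refine ⟨c, h1.symm, ?_, h4.symm, h3.symm, fun h => h5 h.symm⟩
  rw [h2]; ext; simp; tauto

theorem IsTwoJoinSplit.disj' (h : T.IsTwoJoinSplit A₁ B₁ C₁ A₂ B₂ C₂) (v : V) :
    (v ∈ A₁ → v ∉ B₁ ∧ v ∉ C₁ ∧ v ∉ A₂ ∧ v ∉ B₂ ∧ v ∉ C₂) ∧
    (v ∈ B₁ → v ∉ C₁ ∧ v ∉ A₂ ∧ v ∉ B₂ ∧ v ∉ C₂) ∧
    (v ∈ C₁ → v ∉ A₂ ∧ v ∉ B₂ ∧ v ∉ C₂) ∧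
    (v ∈ A₂ → v ∉ B₂ ∧ v ∉ C₂) ∧ (v ∈ B₂ → v ∉ C₂) := by
  have := h.disj
  simp only [List.pairwise_cons, List.mem_cons, forall_eq_or_imp, Set.disjoint_left] at this
  simp at this
  grind

theorem IsTwoJoinSplit.mem (h : T.IsTwoJoinSplit A₁ B₁ C₁ A₂ B₂ C₂) (v : V) :
    v ∈ A₁ ∨ v ∈ B₁ ∨ v ∈ C₁ ∨ v ∈ A₂ ∨ v ∈ B₂ ∨ v ∈ C₂ := by
  have : v ∈ (A₁ ∪ B₁ ∪ C₁) ∪ (A₂ ∪ B₂ ∪ C₂) := h.cover ▸ Set.mem_univ v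
  simpa [or_assoc] using this

theorem IsTwoJoinSplit.anti (h : T.IsTwoJoinSplit A₁ B₁ C₁ A₂ B₂ C₂) {u v : V}
    (hu : u ∈ A₁ ∪ B₁ ∪ C₁) (hv : v ∈ A₂ ∪ B₂ ∪ C₂) (hA : ¬ (u ∈ A₁ ∧ v ∈ A₂))
    (hB : ¬ (u ∈ B₁ ∧ v ∈ B₂)) : T.StrongAnti u v := by
  have hne : u ≠ v := by
    rintro rfl
    have := h.disj' u
    simp only [Set.mem_union] at hu hv
    tauto
  rcases T.trichotomy hne with h1 | h1 | h1
  · rcases h.noOther u hu v hv h1 with h2 | h2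
    · exact absurd h2 hA
    · exact absurd h2 hB
  · exact h1
  · exact absurd h1 (h.noSemi u hu v hv)

theorem IsTwoJoinSplit.swap (h : T.IsTwoJoinSplit A₁ B₁ C₁ A₂ B₂ C₂) :
    T.IsTwoJoinSplit B₁ A₁ C₁ B₂ A₂ C₂ := by
  have e1 : B₁ ∪ A₁ ∪ C₁ = A₁ ∪ B₁ ∪ C₁ := by rw [Set.union_comm B₁]
  have e2 : B₂ ∪ A₂ ∪ C₂ = A₂ ∪ B₂ ∪ C₂ := by rw [Set.union_comm B₂]
  refine ⟨?_, ?_, ⟨h.nonempty.2.1, h.nonempty.1, h.nonempty.2.2.2, h.nonempty.2.2.1⟩, ?_,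
    h.completeB, h.completeA, ?_, ?_, ?_, ?_, ?_⟩
  · have := h.disj
    simp only [List.pairwise_cons, List.mem_cons, forall_eq_or_imp, Set.disjoint_left] at this ⊢
    simp at this ⊢
    grind
  all_goals simp only [e1, e2]
  · exact h.cover
  · exact h.noSemi
  · exact fun u hu v hv huv => (h.noOther u hu v hv huv).symm
  · exact h.card₁
  · exact h.card₂
  · exact fun a b ha hb hp => h.notPath₁ b a hb ha hp.symm
  · exact fun a b ha hb hp => h.notPath₂ b a hb ha hp.symm

theorem IsTwoJoinSplit.swapSides (h : T.IsTwoJoinSplit A₁ B₁ C₁ A₂ B₂ C₂) :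
    T.IsTwoJoinSplit A₂ B₂ C₂ A₁ B₁ C₁ := by
  refine ⟨?_, by rw [Set.union_comm]; exact h.cover, ⟨h.nonempty.2.2.1, h.nonempty.2.2.2,
    h.nonempty.1, h.nonempty.2.1⟩, fun u hu v hv huv => h.noSemi v hv u hu huv.symm,
    fun u hu v hv => (h.completeA v hv u hu).symm, fun u hu v hv => (h.completeB v hv u hu).symm,
    fun u hu v hv huv => (h.noOther v hv u hu huv.symm).imp And.symm And.symm,
    h.card₂, h.card₁, h.notPath₂, h.notPath₁⟩
  have := h.disj
  simp only [List.pairwise_cons, List.mem_cons, forall_eq_or_imp, Set.disjoint_left] at this ⊢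
  simp at this ⊢
  grind

theorem IsTwoJoinSplit.singleton_attached (hB : T.IsBerge) (hT : ¬ T.HasBalancedSkewPartition)
    (h : T.IsTwoJoinSplit A₁ B₁ C₁ A₂ B₂ C₂) {a : V} (hA₁ : A₁ = {a})
    (ha : ∀ v ∈ B₁ ∪ C₁, T.StrongAnti a v) : False := by
  obtain ⟨-, ⟨b₁, hb₁⟩, ⟨a₂, ha₂⟩, ⟨b₂, hb₂⟩⟩ := h.nonempty
  have hdj := h.disj'
  have hmem := h.mem
  have hanti := @IsTwoJoinSplit.anti _ _ _ _ _ _ _ _ _ h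
  simp only [Set.mem_union] at hanti ha
  have haA : ∀ v, v ∈ A₁ ↔ v = a := fun v => by rw [hA₁]; rfl
  have hCout : ∀ v, v ∉ B₁ ∪ C₁ → ∀ w ∈ C₁, T.StrongAnti v w := by
    intro v hv w hw
    have := hmem v
    have := hdj w
    by_cases hva : v = a
    · subst hva; exact ha w (Or.inr hw)
    · exact (hanti (by grind) (by grind) (by grind) (by grind)).symm
  have hBout : ∀ v, v ∉ B₁ ∪ C₁ → v ∉ B₂ → ∀ w ∈ B₁, T.StrongAnti v w := by
    intro v hv hv2 w hw
    have := hmem v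
    have := hdj w
    by_cases hva : v = a
    · subst hva; exact ha w (Or.inl hw)
    · exact (hanti (by grind) (by grind) (by grind) (by grind)).symm
  have hUni : T.Uniform B₁ (B₁ ∪ C₁) := by
    intro v hv
    by_cases hv2 : v ∈ B₂
    · exact Or.inl fun w hw => (h.completeB _ hw _ hv2).symm
    · exact Or.inr (hBout v hv hv2)
  have hb₂' : b₂ ∉ B₁ ∪ C₁ := by have := hdj b₂; grind
  have ha₂' : a₂ ∉ B₁ ∪ C₁ := by have := hdj a₂; grind
  have ha₂B : a₂ ∉ B₂ := by have := hdj a₂; grind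
  by_cases h5 : ∃ c, c ∈ C₁
  · obtain ⟨c, hc⟩ := h5
    exact hB.no_one_sided hT hb₁ hc
      (Set.disjoint_left.2 fun v hv => ((hdj v).2.1 hv).1) hb₂' ha₂'
      (h.completeB _ hb₁ _ hb₂).symm (hBout _ ha₂' ha₂B _ hb₁) hUni hCout
  · have hC₁ : C₁ = ∅ := Set.eq_empty_of_forall_notMem (not_exists.1 h5)
    have hcard := h.card₁
    have : 1 < B₁.ncard := by
      have h1 := Set.ncard_union_le A₁ B₁
      rw [hC₁, Set.union_empty] at hcard
      rw [hA₁, Set.ncard_singleton] at h1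
      rw [hA₁] at hcard
      omega
    obtain ⟨b, hb, hbb⟩ := Set.exists_ne_of_one_lt_ncard this b₁
    have e : B₁ ∪ C₁ = B₁ := by rw [hC₁, Set.union_empty]
    rw [e] at hUni ha₂' hb₂' hBout
    exact hB.no_homogeneous_set hT hb₁ hb hbb.symm hb₂' ha₂'
      (h.completeB _ hb₁ _ hb₂).symm (hBout _ ha₂' ha₂B _ hb₁) hUni

theorem IsTwoJoinSplit.meets (hB : T.IsBerge) (hT : ¬ T.HasBalancedSkewPartition)
    (h : T.IsTwoJoinSplit A₁ B₁ C₁ A₂ B₂ C₂) {D : Set V} (hD : D ⊆ A₁ ∪ B₁ ∪ C₁)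
    (hne : D.Nonempty) (hDX : ∀ v ∈ D, ∀ w ∈ A₁ ∪ B₁ ∪ C₁, w ∉ D → T.StrongAnti v w) :
    ∃ v ∈ D, v ∈ B₁ := by
  by_contra! hDB
  obtain ⟨d, hd⟩ := hne
  obtain ⟨⟨a₁, ha₁⟩, ⟨b₁, hb₁⟩, ⟨a₂, ha₂⟩, ⟨b₂, hb₂⟩⟩ := h.nonempty
  have hdj := h.disj'
  have hmem := h.mem
  have hanti := @IsTwoJoinSplit.anti _ _ _ _ _ _ _ _ _ h
  simp only [Set.mem_union] at hanti hDX
  simp only [Set.subset_def, Set.mem_union] at hD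
  have hA2D : ∀ v ∈ D, v ∈ A₁ ∨ v ∈ C₁ := fun v hv => by
    have := hD v hv; have := hDB v hv; grind
  have hout : ∀ v ∉ D, ∀ w ∈ D, v ∉ A₂ ∨ w ∉ A₁ → T.StrongAnti v w := by
    intro v hv w hw hvw
    have := hmem v
    by_cases hv1 : (v ∈ A₁ ∨ v ∈ B₁) ∨ v ∈ C₁
    · exact (hDX w hw v hv1 hv).symm
    · exact (hanti (hD w hw) (by grind) (by grind) (fun h => hDB w hw h.1)).symm
  have ha₂D : a₂ ∉ D := fun h => by have := hA2D _ h; have := hdj a₂; grind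
  have hb₁D : b₁ ∉ D := fun h => hDB _ h hb₁
  have hb₁A₂ : b₁ ∉ A₂ := by have := hdj b₁; grind
  by_cases h1 : ∃ a ∈ D, a ∈ A₁
  · obtain ⟨a, haD, ha⟩ := h1
    by_cases h2 : ∃ c ∈ D, c ∈ C₁
    · obtain ⟨c, hcD, hc⟩ := h2
      have hU : D ∩ A₁ ∪ D ∩ C₁ = D := by
        ext v; have := hA2D v; simp; grind
      refine hB.no_one_sided hT (A := D ∩ A₁) (C := D ∩ C₁) (a := a) (c := c) (n := a₂) (m := b₁)
        ⟨haD, ha⟩ ⟨hcD, hc⟩ ?_ ?_ ?_ (h.completeA _ ha _ ha₂).symm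
        (hout _ hb₁D _ haD (Or.inl hb₁A₂)) ?_ ?_
      · rw [Set.disjoint_left]; rintro v ⟨-, hv⟩ ⟨-, hv'⟩; have := hdj v; grind
      · rwa [hU]
      · rwa [hU]
      · intro v hv
        rw [hU] at hv
        by_cases hvA : v ∈ A₂
        · exact Or.inl fun w hw => (h.completeA _ hw.2 _ hvA).symm
        · exact Or.inr fun w hw => hout v hv w hw.1 (Or.inl hvA)
      · intro v hv w hw
        rw [hU] at hv
        refine hout v hv w hw.1 (Or.inr ?_)
        have := hdj w; have := hw.2; grind
    · push Not at h2
      have hDA : ∀ v ∈ D, v ∈ A₁ := fun v hv => (hA2D v hv).resolve_right (h2 v hv)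
      by_cases h3 : ∃ d ∈ D, d ≠ a
      · obtain ⟨d, hdD, hda⟩ := h3
        refine hB.no_homogeneous_set hT haD hdD hda.symm ha₂D hb₁D (h.completeA _ ha _ ha₂).symm
          (hout _ hb₁D _ haD (Or.inl hb₁A₂)) fun v hv => ?_
        by_cases hvA : v ∈ A₂
        · exact Or.inl fun w hw => (h.completeA _ (hDA w hw) _ hvA).symm
        · exact Or.inr fun w hw => hout v hv w hw (Or.inl hvA)
      · push Not at h3
        have hout' : ∀ v ∉ A₂, v ≠ a → T.StrongAnti a v := fun v hv hva =>
          (hout v (fun h => hva (h3 v h)) a haD (Or.inl hv)).symm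
        have haA₂ : a ∉ A₂ := by have := hdj a; grind
        have hb₁a : b₁ ≠ a := by rintro rfl; exact hb₁D haD
        by_cases h4 : ∃ d ∈ A₁, d ≠ a
        · obtain ⟨d, hd, hda⟩ := h4
          exact hB.no_dominated hT (N := A₂) hda.symm haA₂ ha₂ hb₁A₂ hb₁a
            (by rintro rfl; have := hdj b₁; grind) (fun v hv => h.completeA _ ha _ hv)
            (fun v hv => h.completeA _ hd _ hv) hout'
        · push Not at h4
          refine h.singleton_attached hB hT (Set.Subset.antisymm (fun v hv => h4 v hv)
            (by simpa using ha)) (fun v hv => hout' v ?_ ?_)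
          · have := hdj v; grind
          · rintro rfl; have := hdj v; grind
  · push Not at h1
    refine hB.no_edge_cutset hT (h.completeA _ ha₁ _ ha₂) hd (fun h => h1 _ h ha₁) ha₂D hb₁D
      ?_ ?_ fun v hv w hw _ _ => (hout w hw v hv (Or.inr (h1 v hv))).symm
    · rintro rfl; have := hdj b₁; grind
    · rintro rfl; exact hb₁A₂ ha₂

theorem componentsMeet_of {X A B : Set V}
    (h : ∀ D ⊆ X, D.Nonempty → (∀ v ∈ D, ∀ w ∈ X, w ∉ D → T.StrongAnti v w) →
      (∃ v ∈ D, v ∈ A) ∧ ∃ v ∈ D, v ∈ B) : T.ComponentsMeet X A B := by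
  intro c
  obtain ⟨⟨v, hv, hvA⟩, ⟨w, hw, hwB⟩⟩ := h ((↑) '' c.supp) (by rintro _ ⟨v, -, rfl⟩; exact v.2)
    (c.nonempty_supp.image _) (by
      rintro _ ⟨v, hv, rfl⟩ w hw hwD
      by_contra hvw
      have hne : (v : V) ≠ w := by rintro rfl; exact hwD ⟨v, hv, rfl⟩
      have hadj : (T.full.induce X).Adj v ⟨w, hw⟩ := (not_strongAnti hne).1 hvw
      exact hwD ⟨⟨w, hw⟩, c.mem_supp_of_adj_mem_supp hv hadj, rfl⟩)
  obtain ⟨v, hv, rfl⟩ := hv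
  obtain ⟨w, hw, rfl⟩ := hw
  exact ⟨⟨v, hv, hvA⟩, ⟨w, hw, hwB⟩⟩

theorem IsTwoJoinSplit.isProper (hB : T.IsBerge) (hT : ¬ T.HasBalancedSkewPartition)
    (h : T.IsTwoJoinSplit A₁ B₁ C₁ A₂ B₂ C₂) : T.IsProperTwoJoinSplit A₁ B₁ C₁ A₂ B₂ C₂ := by
  have key : ∀ {A₁ B₁ C₁ A₂ B₂ C₂ : Set V}, T.IsTwoJoinSplit A₁ B₁ C₁ A₂ B₂ C₂ →
      T.ComponentsMeet (A₁ ∪ B₁ ∪ C₁) A₁ B₁ := fun {A₁ B₁ C₁ A₂ B₂ C₂} h =>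
    componentsMeet_of fun D hD hne hDX => by
      refine ⟨h.swap.meets hB hT ?_ hne ?_, h.meets hB hT hD hne hDX⟩
      · rwa [Set.union_comm B₁]
      · rwa [Set.union_comm B₁]
  exact ⟨h, key h, key h.swapSides⟩

end TwoJoins

end Trigraph

namespace Trigraph

section Parity

variable {V : Type*} [Finite V] {T : Trigraph V} {A₁ B₁ C₁ A₂ B₂ C₂ : Set V}

/-- The vertices of `X` at distance at most `i` from `A` in `T|X`. -/
def reach (T : Trigraph V) (X A : Set V) : ℕ → Set V
  | 0 => A
  | i + 1 => {v | v ∈ X ∧ ∃ u ∈ T.reach X A i, ¬ T.StrongAnti u v}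

theorem reach_subset {X A : Set V} (hA : A ⊆ X) (i : ℕ) : T.reach X A i ⊆ X := by
  cases i with
  | zero => exact hA
  | succ i => exact fun v hv => hv.1

theorem exists_geodesic {X A : Set V} {i : ℕ} {v : V} (hv : v ∈ T.reach X A i)
    (hv' : ∀ j < i, v ∉ T.reach X A j) :
    ∃ p : ℕ → V, p i = v ∧ (∀ j ≤ i, p j ∈ T.reach X A j ∧ ∀ l < j, p j ∉ T.reach X A l) ∧
      ∀ j < i, ¬ T.StrongAnti (p j) (p (j + 1)) := by
  induction i generalizing v with
  | zero => exact ⟨fun _ => v, rfl, by simpa using hv, by simp⟩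
  | succ i ih =>
    obtain ⟨hvX, u, hu, huv⟩ := hv
    obtain ⟨p, hp, hp1, hp2⟩ := ih hu fun j hj huj => hv' (j + 1) (by omega) ⟨hvX, u, huj, huv⟩
    refine ⟨Function.update p (i + 1) v, by simp, fun j hj => ?_, fun j hj => ?_⟩
    · by_cases h : j = i + 1
      · subst h; simpa using ⟨⟨hvX, u, hu, huv⟩, fun l hl => hv' l (by omega)⟩
      · rw [Function.update_of_ne h]; exact hp1 j (by omega)
    · rw [Function.update_of_ne (by omega)]
      by_cases h : j = i
      · subst h; simpa [hp] using huv
      · rw [Function.update_of_ne (by omega)]; exact hp2 j (by omega)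

theorem exists_pathVia {A B C : Set V} {m : ℕ}
    (hm : (T.reach (A ∪ B ∪ C) A m ∩ B).Nonempty)
    (hm' : ∀ i < m, T.reach (A ∪ B ∪ C) A i ∩ B = ∅) :
    ∃ p : Fin (m + 1) → V, T.PathVia p A B C := by
  obtain ⟨v, hv, hvB⟩ := hm
  obtain ⟨p, rfl, hp, hadj⟩ := exists_geodesic hv fun j hj h =>
    (hm' j hj).subset ⟨h, hvB⟩
  have hne : ∀ i j, i < j → j ≤ m → p i ≠ p j := fun i j hij hj e =>
    (hp j hj).2 i hij (e ▸ (hp i (by omega)).1)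
  refine ⟨fun i => p i, ⟨?_, ?_⟩, (hp 0 (by omega)).1, by simpa using hvB, ?_⟩
  · intro i j hij
    by_contra h
    rcases lt_or_gt_of_ne h with h | h
    · exact hne i j h (by omega) hij
    · exact hne j i h (by omega) hij.symm
  · intro i j hij
    have hij' : (i : ℕ) < j := hij
    refine ⟨fun h => ?_, fun h => ?_⟩
    · have := hadj i (by omega)
      dsimp only
      rw [h]
      exact (not_strongAnti (hne i (i + 1) (by omega) (by omega))).1 this
    · by_contra h'
      have : ¬ T.StrongAnti (p i) (p j) := fun h'' => h' (Or.inl h'')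
      exact (hp j (by omega)).2 (i + 1) h
        ⟨reach_subset (fun v hv => Or.inl (Or.inl hv)) j (hp j (by omega)).1, _,
          (hp i (by omega)).1, this⟩
  · intro i hi hi'
    have h0 : (i : ℕ) ≠ 0 := fun h => hi (Fin.ext h)
    have h1 : (i : ℕ) ≠ m := fun h => hi' (Fin.ext (by simpa using h))
    have him := i.2
    have h2 := hp i (by omega)
    rcases reach_subset (fun v hv => Or.inl (Or.inl hv)) i h2.1 with (h | h) | h
    · exact absurd h (h2.2 0 (by omega))
    · exact ((hm' i (by omega)).subset ⟨h2.1, h⟩).elim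
    · exact h

theorem exists_reach {A B C : Set V} (hA : A.Nonempty)
    (h : T.ComponentsMeet (A ∪ B ∪ C) A B) :
    ∃ m, (T.reach (A ∪ B ∪ C) A m ∩ B).Nonempty := by
  obtain ⟨a, ha⟩ := hA
  obtain ⟨-, w, hw, hwB⟩ := h ((T.full.induce (A ∪ B ∪ C)).connectedComponentMk
    ⟨a, Or.inl (Or.inl ha)⟩)
  have hr := (SimpleGraph.ConnectedComponent.exact hw).symm
  have key : ∀ x y : ↥(A ∪ B ∪ C), (T.full.induce (A ∪ B ∪ C)).Reachable x y →
      (∃ m, (x : V) ∈ T.reach (A ∪ B ∪ C) A m) → ∃ m, (y : V) ∈ T.reach (A ∪ B ∪ C) A m := by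
    rintro x y ⟨p⟩
    induction p with
    | nil => exact id
    | cons hadj _ ih =>
      rintro ⟨m, hm⟩
      refine ih ⟨m + 1, Subtype.property _, _, hm, ?_⟩
      exact Adj.not_strongAnti hadj
  obtain ⟨m, hm⟩ := key _ _ hr ⟨0, ha⟩
  exact ⟨m, _, hm, hwB⟩

open Classical in
theorem exists_least_reach {A B C : Set V} (hA : A.Nonempty)
    (h : T.ComponentsMeet (A ∪ B ∪ C) A B) :
    ∃ m, m < Nat.card V ∧ (T.reach (A ∪ B ∪ C) A m ∩ B).Nonempty ∧
      ∀ i < m, T.reach (A ∪ B ∪ C) A i ∩ B = ∅ := by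
  have hex := exists_reach hA h
  have h1 := Nat.find_spec hex
  have h2 : ∀ i < Nat.find hex, T.reach (A ∪ B ∪ C) A i ∩ B = ∅ := fun i hi =>
    Set.not_nonempty_iff_eq_empty.1 (Nat.find_min hex hi)
  obtain ⟨p, hp⟩ := exists_pathVia h1 h2
  have := Nat.card_le_card_of_injective p hp.1.1
  rw [Nat.card_fin] at this
  exact ⟨_, by omega, h1, h2⟩

theorem IsTwoJoinSplit.even_add (hB : T.IsBerge) (h : T.IsTwoJoinSplit A₁ B₁ C₁ A₂ B₂ C₂)
    {k l : ℕ} {p : Fin (k + 1) → V} {q : Fin (l + 1) → V} (hp : T.PathVia p A₁ B₁ C₁)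
    (hq : T.PathVia q A₂ B₂ C₂) : Even (k + l) := by
  by_contra hodd
  rw [Nat.not_even_iff_odd] at hodd
  have norm : ∀ {k : ℕ} {A B C : Set V} {p : Fin (k + 1) → V}, T.PathVia p A B C →
      Disjoint A B → ∃ P : ℕ → V, 1 ≤ k ∧ P 0 ∈ A ∧ P k ∈ B ∧ (∀ i, 0 < i → i < k → P i ∈ C) ∧
      (∀ i j, i < j → j ≤ k → P i ≠ P j) ∧ (∀ i < k, T.Adj (P i) (P (i + 1))) ∧
      ∀ i j, i + 1 < j → j ≤ k → T.Anti (P i) (P j) := by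
    rintro k A B C p ⟨⟨h1, h2⟩, h3, h4, h5⟩ hAB
    have e : ∀ i (hi : i ≤ k), Fin.ofNat (k + 1) i = ⟨i, by omega⟩ := fun i hi =>
      Fin.ext (Nat.mod_eq_of_lt (by omega))
    have hlast : Fin.ofNat (k + 1) k = Fin.last k := e k le_rfl
    refine ⟨fun i => p (Fin.ofNat (k + 1) i), ?_, h3, by dsimp only; rwa [hlast], ?_, ?_, ?_, ?_⟩
    · by_contra hk
      have : k = 0 := by omega
      subst this
      exact Set.disjoint_left.1 hAB h3 h4
    · intro i h0 hk
      dsimp only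
      rw [e i hk.le]
      exact h5 _ (by simp [Fin.ext_iff]; omega) (by simp [Fin.ext_iff]; omega)
    · intro i j hij hj he
      dsimp only at he
      rw [e i (by omega), e j hj] at he
      have := h1 he
      simp at this
      omega
    · intro i hi
      dsimp only
      rw [e i (by omega), e (i + 1) (by omega)]
      exact (h2 _ _ (by simp [Fin.lt_def])).1 rfl
    · intro i j hij hj
      dsimp only
      rw [e i (by omega), e j (by omega)]
      exact (h2 _ _ (by simp [Fin.lt_def]; omega)).2 (by simpa using hij)
  have hdj := h.disj'
  obtain ⟨P, hk, hP0, hPk, hPC, hPne, hPadj, hPanti⟩ := norm hp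
    (Set.disjoint_left.2 fun v hv => ((hdj v).1 hv).1)
  obtain ⟨Q, hl, hQ0, hQl, hQC, hQne, hQadj, hQanti⟩ := norm hq
    (Set.disjoint_left.2 fun v hv => ((hdj v).2.2.2.1 hv).1)
  have hP : ∀ i, i ≤ k → P i ∈ A₁ ∪ B₁ ∪ C₁ ∧ (P i ∈ A₁ → i = 0) ∧ (P i ∈ B₁ → i = k) := by
    intro i hi
    have := hdj (P i)
    by_cases h0 : i = 0
    · subst h0; grind
    by_cases h1 : i = k
    · subst h1; grind
    have := hPC i (by omega) (by omega)
    grind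
  have hQ : ∀ i, i ≤ l → Q i ∈ A₂ ∪ B₂ ∪ C₂ ∧ (Q i ∈ A₂ → i = 0) ∧ (Q i ∈ B₂ → i = l) := by
    intro i hi
    have := hdj (Q i)
    by_cases h0 : i = 0
    · subst h0; grind
    by_cases h1 : i = l
    · subst h1; grind
    have := hQC i (by omega) (by omega)
    grind
  have hcross : ∀ i j, i ≤ k → j ≤ l → ¬ (i = 0 ∧ j = 0) → ¬ (i = k ∧ j = l) →
      T.StrongAnti (P i) (Q j) := fun i j hi hj h1 h2 =>
    h.anti (hP i hi).1 (hQ j hj).1 (fun h => h1 ⟨(hP i hi).2.1 h.1, (hQ j hj).2.1 h.2⟩)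
      fun h => h2 ⟨(hP i hi).2.2 h.1, (hQ j hj).2.2 h.2⟩
  have hcross_ne : ∀ i j, i ≤ k → j ≤ l → P i ≠ Q j := fun i j hi hj e => by
    have h1 := (hP i hi).1
    have h2 := (hQ j hj).1
    have h3 := hdj (P i)
    rw [← e] at h2
    grind
  set H : ℕ → V := fun i => if i ≤ k then P i else Q (k + l + 1 - i) with hH
  have H1 : ∀ i, i ≤ k → H i = P i := fun i hi => if_pos hi
  have H2 : ∀ i, k < i → H i = Q (k + l + 1 - i) := fun i hi => if_neg (by omega)
  refine (hB (k + l + 2) (fun i => H i) (by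
    obtain ⟨m, hm⟩ := hodd; exact ⟨m + 1, by omega⟩)).1 ⟨by omega, ?_, ?_⟩
  · have hne : ∀ i j : ℕ, i < j → j < k + l + 2 → H i ≠ H j := by
      intro i j hij hj
      by_cases hjk : j ≤ k
      · rw [H1 i (by omega), H1 j hjk]; exact hPne i j hij hjk
      by_cases hik : i ≤ k
      · rw [H1 i hik, H2 j (by omega)]; exact hcross_ne _ _ hik (by omega)
      · rw [H2 i (by omega), H2 j (by omega)]; exact (hQne _ _ (by omega) (by omega)).symm
    intro i j hij
    by_contra h
    rcases lt_or_gt_of_ne h with h | h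
    · exact hne i j h j.2 hij
    · exact hne j i h i.2 hij.symm
  · rintro ⟨i, hi⟩ ⟨j, hj⟩ hij
    simp only [Fin.mk_lt_mk] at hij
    dsimp only
    by_cases hjk : j ≤ k
    · rw [H1 i (by omega), H1 j hjk]
      refine ⟨?_, fun h => hPanti i j h.1 hjk⟩
      rintro (rfl | h)
      · exact hPadj i (by omega)
      · omega
    by_cases hik : i ≤ k
    · rw [H1 i hik, H2 j (by omega)]
      constructor
      · rintro (rfl | h')
        · have : i = k := by omega
          subst this
          rw [show i + l + 1 - (i + 1) = l by omega]
          exact Or.inl (h.completeB _ hPk _ hQl)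
        · have : i = 0 := by omega
          subst this
          rw [show k + l + 1 - j = 0 by omega]
          exact Or.inl (h.completeA _ hP0 _ hQ0)
      · intro h
        exact Or.inl (hcross i _ hik (by omega) (by omega) (by omega))
    · rw [H2 i (by omega), H2 j (by omega)]
      refine ⟨?_, fun h => (hQanti _ _ (by omega) (by omega)).symm⟩
      rintro (rfl | h)
      · have := hQadj (k + l + 1 - (i + 1)) (by omega)
        rw [show k + l + 1 - (i + 1) + 1 = k + l + 1 - i by omega] at this
        exact this.symm
      · omega

theorem IsProperTwoJoinSplit.exists_path (h : T.IsProperTwoJoinSplit A₁ B₁ C₁ A₂ B₂ C₂) :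
    ∃ (k : ℕ) (p : Fin (k + 1) → V), T.PathVia p A₂ B₂ C₂ := by
  obtain ⟨m, -, h1, h2⟩ := exists_least_reach h.nonempty.2.2.1 h.meet₂
  exact ⟨m, exists_pathVia h1 h2⟩

/-- The parity of one path from `A₁` to `B₁` decides whether the `2`-join is odd or even. -/
theorem IsProperTwoJoinSplit.parity (hB : T.IsBerge)
    (h : T.IsProperTwoJoinSplit A₁ B₁ C₁ A₂ B₂ C₂) {m : ℕ} {p : Fin (m + 1) → V}
    (hp : T.PathVia p A₁ B₁ C₁) :
    (Odd m → T.IsOddSplit A₁ B₁ C₁ A₂ B₂ C₂) ∧ (Even m → T.IsEvenSplit A₁ B₁ C₁ A₂ B₂ C₂) := by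
  obtain ⟨l, q, hq⟩ := h.exists_path
  have h0 := h.even_add hB hp hq
  constructor
  · rintro hm k r (hr | hr)
    · have := h.even_add hB hr hq
      grind
    · have := h.even_add hB hp hr
      grind
  · rintro hm k r (hr | hr)
    · have := h.even_add hB hr hq
      grind
    · have := h.even_add hB hp hr
      grind

end Parity

end Trigraph

namespace Trigraph

section Closures

variable {V : Type*} [Finite V] {T : Trigraph V} {A₁ B₁ C₁ A₂ B₂ C₂ : Set V}

/-- The vertices of `S` of type `t`. -/
def part {V : Type*} (τ : V → ℕ) (S : Set V) (t : ℕ) : Set V := {v | v ∈ S ∧ τ v = t}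

/-- `x` is adjacent to a vertex of `S` of type `t`. -/
def Touch (T : Trigraph V) (τ : V → ℕ) (S : Set V) (t : ℕ) (x : V) : Prop :=
  ∃ v ∈ part τ S t, ¬ T.StrongAnti v x

/-- `x` is antiadjacent to a vertex of `S` of type `t`. -/
def Miss (T : Trigraph V) (τ : V → ℕ) (S : Set V) (t : ℕ) (x : V) : Prop :=
  ∃ v ∈ part τ S t, ¬ T.StrongAdj v x

/-- The vertex `x` cannot stay outside a fragment that contains `S`.  The flag `m` tells whether
vertices outside may see both types `1` and `2`. -/
def Bad (T : Trigraph V) (τ : V → ℕ) (m : Bool) (S : Set V) (x : V) : Prop :=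
  (T.Touch τ S 1 x ∧ T.Miss τ S 1 x) ∨ (T.Touch τ S 2 x ∧ T.Miss τ S 2 x) ∨ T.Touch τ S 3 x ∨
    (m = true ∧ T.Touch τ S 1 x ∧ T.Touch τ S 2 x)

def ClosedUnder (T : Trigraph V) (τ : V → ℕ) (m : Bool) (S : Set V) : Prop :=
  ∀ x ∉ S, ¬ T.Bad τ m S x

/-- `S` is the least closed set that contains `y` and `z`. -/
structure IsClosure (T : Trigraph V) (τ : V → ℕ) (m : Bool) (y z : V) (S : Set V) : Prop where
  left_mem : y ∈ S
  right_mem : z ∈ S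
  closed : T.ClosedUnder τ m S
  least : ∀ Y, y ∈ Y → z ∈ Y → T.ClosedUnder τ m Y → S ⊆ Y

structure JoinValid (T : Trigraph V) (τ : V → ℕ) (S : Set V) : Prop where
  left : (part τ S 1).Nonempty
  right : (part τ S 2).Nonempty
  card : 4 ≤ S.ncard
  card_compl : 4 + S.ncard ≤ Nat.card V
  touch₁ : ∃ x, x ∉ S ∧ T.Touch τ S 1 x
  touch₂ : ∃ x, x ∉ S ∧ T.Touch τ S 2 x

structure PairValid (T : Trigraph V) (τ : V → ℕ) (S : Set V) : Prop where
  left : 2 ≤ (part τ S 1).ncard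
  right : 2 ≤ (part τ S 2).ncard
  mixed₁ : ∀ x ∈ part τ S 1, T.Touch τ S 2 x ∧ T.Miss τ S 2 x
  mixed₂ : ∀ x ∈ part τ S 2, T.Touch τ S 1 x ∧ T.Miss τ S 1 x
  ne₁₁ : ∃ x, x ∉ S ∧ T.Touch τ S 1 x ∧ T.Touch τ S 2 x
  ne₁₂ : ∃ x, x ∉ S ∧ T.Touch τ S 1 x ∧ ¬ T.Touch τ S 2 x
  ne₂₁ : ∃ x, x ∉ S ∧ ¬ T.Touch τ S 1 x ∧ T.Touch τ S 2 x
  ne₂₂ : ∃ x, x ∉ S ∧ ¬ T.Touch τ S 1 x ∧ ¬ T.Touch τ S 2 x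

theorem Touch.mono {τ : V → ℕ} {S S' : Set V} (h : S ⊆ S') {t : ℕ} {x : V}
    (hx : T.Touch τ S t x) : T.Touch τ S' t x := by
  obtain ⟨v, hv, hvx⟩ := hx
  exact ⟨v, ⟨h hv.1, hv.2⟩, hvx⟩

theorem Miss.mono {τ : V → ℕ} {S S' : Set V} (h : S ⊆ S') {t : ℕ} {x : V}
    (hx : T.Miss τ S t x) : T.Miss τ S' t x := by
  obtain ⟨v, hv, hvx⟩ := hx
  exact ⟨v, ⟨h hv.1, hv.2⟩, hvx⟩

theorem Bad.mono {τ : V → ℕ} {m : Bool} {S S' : Set V} (h : S ⊆ S') {x : V}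
    (hx : T.Bad τ m S x) : T.Bad τ m S' x := by
  rcases hx with h1 | h1 | h1 | h1
  · exact Or.inl ⟨h1.1.mono h, h1.2.mono h⟩
  · exact Or.inr (Or.inl ⟨h1.1.mono h, h1.2.mono h⟩)
  · exact Or.inr (Or.inr (Or.inl (h1.mono h)))
  · exact Or.inr (Or.inr (Or.inr ⟨h1.1, h1.2.1.mono h, h1.2.2.mono h⟩))

theorem ClosedUnder.not_miss {τ : V → ℕ} {m : Bool} {S : Set V} (h : T.ClosedUnder τ m S) {t : ℕ}
    (ht : t = 1 ∨ t = 2) {x : V} (hx : x ∉ S) (htouch : T.Touch τ S t x) :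
    ∀ v ∈ part τ S t, T.StrongAdj v x := by
  intro v hv
  by_contra hvx
  have hmiss : T.Miss τ S t x := ⟨v, hv, hvx⟩
  rcases ht with rfl | rfl
  · exact h x hx (Or.inl ⟨htouch, hmiss⟩)
  · exact h x hx (Or.inr (Or.inl ⟨htouch, hmiss⟩))

theorem strongAnti_of_not_touch {τ : V → ℕ} {S : Set V} {t : ℕ} {x : V}
    (h : ¬ T.Touch τ S t x) : ∀ v ∈ part τ S t, T.StrongAnti v x := by
  intro v hv
  by_contra hvx
  exact h ⟨v, hv, hvx⟩

theorem ClosedUnder.uniform {τ : V → ℕ} {m : Bool} {S : Set V} (h : T.ClosedUnder τ m S) {t : ℕ}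
    (ht : t = 1 ∨ t = 2) : T.Uniform (part τ S t) S := by
  intro x hx
  by_cases htouch : T.Touch τ S t x
  · exact Or.inl fun v hv => (h.not_miss ht hx htouch v hv).symm
  · exact Or.inr fun v hv => (strongAnti_of_not_touch htouch v hv).symm

theorem ClosedUnder.anti {τ : V → ℕ} {m : Bool} {S : Set V} (h : T.ClosedUnder τ m S) {x : V}
    (hx : x ∉ S) : ∀ v ∈ part τ S 3, T.StrongAnti v x :=
  strongAnti_of_not_touch fun h' => h x hx (Or.inr (Or.inr (Or.inl h')))

theorem part_union {V : Type*} {τ : V → ℕ} (hτ : ∀ v, τ v = 1 ∨ τ v = 2 ∨ τ v = 3) (S : Set V) :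
    part τ S 1 ∪ part τ S 2 ∪ part τ S 3 = S := by
  ext v
  have := hτ v
  simp only [part, Set.mem_union, Set.mem_ofPred_eq]
  tauto

theorem JoinValid.split {τ : V → ℕ} {S : Set V} (hτ : ∀ v, τ v = 1 ∨ τ v = 2 ∨ τ v = 3)
    (hS : T.ClosedUnder τ true S) (h : T.JoinValid τ S) :
    T.IsTwoJoinSplit (part τ S 1) (part τ S 2) (part τ S 3) {x | x ∉ S ∧ T.Touch τ S 1 x}
      {x | x ∉ S ∧ T.Touch τ S 2 x} {x | x ∉ S ∧ ¬ T.Touch τ S 1 x ∧ ¬ T.Touch τ S 2 x} := by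
  have e1 := part_union hτ S
  have e2 : {x | x ∉ S ∧ T.Touch τ S 1 x} ∪ {x | x ∉ S ∧ T.Touch τ S 2 x} ∪
      {x | x ∉ S ∧ ¬ T.Touch τ S 1 x ∧ ¬ T.Touch τ S 2 x} = Sᶜ := by
    ext v
    simp only [Set.mem_union, Set.mem_ofPred_eq, Set.mem_compl_iff]
    tauto
  have hboth : ∀ x ∉ S, T.Touch τ S 1 x → ¬ T.Touch τ S 2 x := fun x hx h1 h2 =>
    hS x hx (Or.inr (Or.inr (Or.inr ⟨rfl, h1, h2⟩)))
  have hcard := h.card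
  have hcardc : 4 ≤ (Sᶜ).ncard := by
    have := Set.ncard_add_ncard_compl S
    have := h.card_compl
    omega
  have hpath : ∀ X : Set V, 4 ≤ X.ncard → ∀ a b, ¬ T.IsTwoPath X a b := by
    rintro X hX a b ⟨c, -, rfl, -⟩
    have h1 := Set.ncard_insert_le a {c, b}
    have h2 := Set.ncard_insert_le c {b}
    rw [Set.ncard_singleton] at h2
    omega
  have hone : ∀ u ∈ S, ∀ v ∉ S, (T.StrongAdj u v → (u ∈ part τ S 1 ∧ T.Touch τ S 1 v) ∨
      (u ∈ part τ S 2 ∧ T.Touch τ S 2 v)) ∧ ¬ T.Semi u v := by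
    intro u hu v hv
    rcases hτ u with h1 | h1 | h1
    · by_cases h2 : T.Touch τ S 1 v
      · exact ⟨fun _ => Or.inl ⟨⟨hu, h1⟩, h2⟩,
          fun h3 => (hS.not_miss (Or.inl rfl) hv h2 u ⟨hu, h1⟩).not_anti (Or.inr h3)⟩
      · have := strongAnti_of_not_touch h2 u ⟨hu, h1⟩
        exact ⟨fun h3 => absurd h3 this.not_strongAdj, fun h3 => this.not_adj (Or.inr h3)⟩
    · by_cases h2 : T.Touch τ S 2 v
      · exact ⟨fun _ => Or.inr ⟨⟨hu, h1⟩, h2⟩,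
          fun h3 => (hS.not_miss (Or.inr rfl) hv h2 u ⟨hu, h1⟩).not_anti (Or.inr h3)⟩
      · have := strongAnti_of_not_touch h2 u ⟨hu, h1⟩
        exact ⟨fun h3 => absurd h3 this.not_strongAdj, fun h3 => this.not_adj (Or.inr h3)⟩
    · have := hS.anti hv u ⟨hu, h1⟩
      exact ⟨fun h3 => absurd h3 this.not_strongAdj, fun h3 => this.not_adj (Or.inr h3)⟩
  refine ⟨?_, ?_, ⟨h.left, h.right, h.touch₁, h.touch₂⟩, ?_, ?_, ?_, ?_, ?_, ?_, ?_, ?_⟩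
  · simp only [List.pairwise_cons, List.mem_cons, forall_eq_or_imp, Set.disjoint_left]
    simp [part]
    refine ⟨⟨?_, ?_, ?_, ?_, ?_⟩, ⟨?_, ?_, ?_, ?_⟩, ⟨?_, ?_, ?_⟩, ⟨?_, ?_⟩, ?_⟩ <;> grind
  · rw [e1, e2, Set.union_compl_self]
  · rw [e1, e2]; exact fun u hu v hv => (hone u hu v hv).2
  · exact fun u hu v hv => hS.not_miss (Or.inl rfl) hv.1 hv.2 u hu
  · exact fun u hu v hv => hS.not_miss (Or.inr rfl) hv.1 hv.2 u hu
  · rw [e1, e2]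
    exact fun u hu v hv huv => ((hone u hu v hv).1 huv).imp (fun h => ⟨h.1, hv, h.2⟩)
      fun h => ⟨h.1, hv, h.2⟩
  · rw [e1]; omega
  · rw [e2]; omega
  · rw [e1]; exact fun a b _ _ => hpath S hcard a b
  · rw [e2]; exact fun a b _ _ => hpath Sᶜ hcardc a b

theorem PairValid.isProperHomogeneousPair {τ : V → ℕ} {S : Set V} {m : Bool}
    (hτ : ∀ v, τ v = 1 ∨ τ v = 2) (hS : T.ClosedUnder τ m S) (h : T.PairValid τ S) :
    T.IsProperHomogeneousPair (part τ S 1) (part τ S 2) ∧ part τ S 1 ∪ part τ S 2 = S := by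
  have hU : part τ S 1 ∪ part τ S 2 = S := by
    ext v
    have := hτ v
    simp only [part, Set.mem_union, Set.mem_ofPred_eq]
    tauto
  have hc : ∀ t, t = 1 ∨ t = 2 → ∀ x ∉ S, T.Touch τ S t x → x ∈ T.completeTo (part τ S t) :=
    fun t ht x hx hxt => ⟨fun h => hx h.1, fun v hv => (hS.not_miss ht hx hxt v hv).symm⟩
  have ha : ∀ t, t = 1 ∨ t = 2 → ∀ x ∉ S, ¬ T.Touch τ S t x →
      x ∈ T.anticompleteTo (part τ S t) :=
    fun t ht x hx hxt => ⟨fun h => hx h.1, fun v hv => (strongAnti_of_not_touch hxt v hv).symm⟩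
  have hdisj : Disjoint (part τ S 1) (part τ S 2) :=
    Set.disjoint_left.2 fun v hv hv' => by have := hv.2; have := hv'.2; omega
  have key : ∀ t, t = 1 ∨ t = 2 → (∀ x ∈ S, x ∉ part τ S t →
      T.Touch τ S t x ∧ T.Miss τ S t x) →
      T.completeTo (part τ S t) ∪ T.anticompleteTo (part τ S t) = Sᶜ := by
    intro t ht hmix
    ext x
    refine ⟨?_, fun hx => ?_⟩
    · rintro (⟨hx, hx'⟩ | ⟨hx, hx'⟩) hxS
      · obtain ⟨-, v, hv, hvx⟩ := hmix x hxS hx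
        exact hvx (hx' v hv).symm
      · obtain ⟨⟨v, hv, hvx⟩, -⟩ := hmix x hxS hx
        exact hvx (hx' v hv).symm
    · by_cases h : T.Touch τ S t x
      · exact Or.inl (hc t ht x hx h)
      · exact Or.inr (ha t ht x hx h)
  obtain ⟨x₁, hx₁, h₁₁, h₁₂⟩ := h.ne₁₁
  obtain ⟨x₂, hx₂, h₂₁, h₂₂⟩ := h.ne₁₂
  obtain ⟨x₃, hx₃, h₃₁, h₃₂⟩ := h.ne₂₁
  obtain ⟨x₄, hx₄, h₄₁, h₄₂⟩ := h.ne₂₂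
  refine ⟨⟨hdisj, h.left, h.right, ?_, ?_, ⟨x₁, hc 1 (Or.inl rfl) x₁ hx₁ h₁₁,
    hc 2 (Or.inr rfl) x₁ hx₁ h₁₂⟩, ⟨x₂, hc 1 (Or.inl rfl) x₂ hx₂ h₂₁,
    ha 2 (Or.inr rfl) x₂ hx₂ h₂₂⟩, ⟨x₃, ha 1 (Or.inl rfl) x₃ hx₃ h₃₁,
    hc 2 (Or.inr rfl) x₃ hx₃ h₃₂⟩, ⟨x₄, ha 1 (Or.inl rfl) x₄ hx₄ h₄₁,
    ha 2 (Or.inr rfl) x₄ hx₄ h₄₂⟩⟩, hU⟩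
  · rw [hU]
    exact key 1 (Or.inl rfl) fun x hx hx' =>
      h.mixed₂ x ⟨hx, (hτ x).resolve_left fun h => hx' ⟨hx, h⟩⟩
  · rw [hU]
    exact key 2 (Or.inr rfl) fun x hx hx' =>
      h.mixed₁ x ⟨hx, (hτ x).resolve_right fun h => hx' ⟨hx, h⟩⟩

end Closures

end Trigraph

namespace Trigraph

section PairSeeds

variable {V : Type*} [Finite V] {T : Trigraph V}

theorem exists_isClosure (T : Trigraph V) (τ : V → ℕ) (m : Bool) (y z : V) :
    ∃ S, T.IsClosure τ m y z S := by
  refine ⟨⋂₀ {Y | y ∈ Y ∧ z ∈ Y ∧ T.ClosedUnder τ m Y}, fun Y hY => hY.1, fun Y hY => hY.2.1, ?_,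
    fun Y hy hz hY => Set.sInter_subset_of_mem ⟨hy, hz, hY⟩⟩
  intro x hx hbad
  rw [Set.mem_sInter] at hx
  push Not at hx
  obtain ⟨Y, hY, hxY⟩ := hx
  exact hY.2.2 x hxY (hbad.mono (Set.sInter_subset_of_mem hY))

theorem IsClosure.unique {τ : V → ℕ} {m : Bool} {y z : V} {S S' : Set V}
    (h : T.IsClosure τ m y z S) (h' : T.IsClosure τ m y z S') : S = S' :=
  Set.Subset.antisymm (h.least S' h'.left_mem h'.right_mem h'.closed)
    (h'.least S h.left_mem h.right_mem h.closed)

open Classical in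
noncomputable def typePair (T : Trigraph V) (c : V) : V → ℕ := fun w =>
  if T.StrongAdj c w then 1 else 2

theorem typePair_eq (T : Trigraph V) (c w : V) : T.typePair c w = 1 ∨ T.typePair c w = 2 := by
  unfold typePair; split_ifs <;> simp

theorem bad_iff {τ : V → ℕ} (hτ : ∀ v, τ v = 1 ∨ τ v = 2) {S : Set V} {x : V} :
    T.Bad τ false S x ↔ ∃ t, (t = 1 ∨ t = 2) ∧ T.Touch τ S t x ∧ T.Miss τ S t x := by
  have h3 : ¬ T.Touch τ S 3 x := by
    rintro ⟨v, hv, -⟩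
    have := hτ v; have := hv.2; omega
  simp only [Bad, h3, Bool.false_eq_true, false_and, or_false]
  constructor
  · rintro (h | h)
    · exact ⟨1, Or.inl rfl, h⟩
    · exact ⟨2, Or.inr rfl, h⟩
  · rintro ⟨t, rfl | rfl, h⟩
    · exact Or.inl h
    · exact Or.inr h

theorem part_union_two {V : Type*} {τ : V → ℕ} (hτ : ∀ v, τ v = 1 ∨ τ v = 2) (S : Set V)
    {t t' : ℕ} (ht : t = 1 ∧ t' = 2 ∨ t = 2 ∧ t' = 1) : part τ S t ∪ part τ S t' = S := by
  ext v
  have := hτ v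
  simp only [part, Set.mem_union, Set.mem_ofPred_eq]
  constructor
  · rintro (h | h) <;> exact h.1
  · intro h
    by_cases h1 : τ v = t
    · exact Or.inl ⟨h, h1⟩
    · exact Or.inr ⟨h, by omega⟩

theorem ClosedUnder.exists_two (hF : T.InF) (hT : ¬ T.HasBalancedSkewPartition) {τ : V → ℕ}
    (hτ : ∀ v, τ v = 1 ∨ τ v = 2) {m : Bool} {S : Set V} (hS : T.ClosedUnder τ m S) {t t' : ℕ}
    (ht : t = 1 ∧ t' = 2 ∨ t = 2 ∧ t' = 1) {u v n k : V} (hu : u ∈ part τ S t)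
    (hv : v ∈ part τ S t) (huv : u ≠ v) (hn : n ∉ S) (hk : k ∉ S) (hnu : T.StrongAdj n u)
    (hku : T.StrongAnti k u) (hb : ∀ b ∈ part τ S t', (∃ x ∉ S, T.StrongAdj b x) ∧
      ∃ y ∉ S, T.StrongAnti b y) : ∃ b ∈ part τ S t', ∃ b' ∈ part τ S t', b ≠ b' := by
  have hU := part_union_two hτ S ht
  have hunif := hS.uniform (t := t) (by omega)
  have hsub : part τ S t ⊆ S := fun x hx => hx.1
  by_contra! hno
  by_cases hne : ∃ b, b ∈ part τ S t'
  · obtain ⟨b, hbt⟩ := hne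
    have hS' : insert b (part τ S t) = S := by
      refine Set.Subset.antisymm ?_ fun x hx => ?_
      · rintro x (rfl | hx)
        · exact hbt.1
        · exact hx.1
      · rw [← hU] at hx
        exact hx.symm.imp (fun hx => hno x hx b hbt) id
    obtain ⟨⟨x, hx, hbx⟩, ⟨y, hy, hby⟩⟩ := hb b hbt
    obtain ⟨c, hc, hbc⟩ := hF.exists_not_semi hu hv huv hbx hby (fun h => hx h.1)
      (fun h => hy h.1)
    refine hF.berge.no_pair hT hu hv huv ?_ hc hbc (by rwa [hS']) (by rwa [hS']) hnu hku
      (by rwa [hS'])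
    intro h
    have := h.2; have := hbt.2; omega
  · have hS' : part τ S t = S := by
      rw [not_exists] at hne
      rw [Set.eq_empty_of_forall_notMem hne, Set.union_empty] at hU
      exact hU
    exact hF.berge.no_homogeneous_set hT hu hv huv (by rwa [hS']) (by rwa [hS']) hnu hku
      (by rwa [hS'] at hunif ⊢)

theorem IsBerge.complete_of_complete (hB : T.IsBerge) (hT : ¬ T.HasBalancedSkewPartition)
    {A B : Set V} {b n m : V} (hb : b ∈ B) (hU : T.Uniform B (A ∪ B))
    (hm : m ∉ A ∪ B) (hnb : T.StrongAdj n b) (hmb : T.StrongAnti m b)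
    (hA : ∀ a ∈ A, T.StrongAdj b a) : ∀ a ∈ B, a ≠ b → T.StrongAdj b a := by
  by_contra! h
  obtain ⟨p, hp, hpb, hbp⟩ := h
  refine hT (hB.hasBalancedSkewPartition (S := {b}) (N := {v | T.StrongAdj b v})
    (P := {v | v ∈ B ∧ v ≠ b ∧ ¬ T.StrongAdj b v}) (M := {v | v ∉ A ∪ B ∧ ¬ T.StrongAdj b v})
    ?_ ⟨b, rfl⟩ ⟨n, hnb.symm⟩ ⟨p, hp, hpb, hbp⟩ ⟨m, hm, hmb.symm.not_strongAdj⟩ ?_ ?_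
    (tame_of_subsingleton (by simp)) (tame_of_subsingleton (by simp)) ?_ ?_)
  · ext v
    have := hA v
    by_cases hvb : v = b
    · subst hvb; simp [hb]
    simp only [Set.mem_union, Set.mem_ofPred_eq, Set.mem_compl_iff, Set.mem_singleton_iff]
    tauto
  · rintro _ rfl v hv; exact hv
  · rintro v ⟨hv, -⟩ w ⟨hw, hwb⟩
    exact ((hU w hw).resolve_left (fun h => hwb (h b hb).symm) v hv).symm
  · exact tame_of_apex b (fun v hv => Or.inl hv) fun v hv => (not_strongAdj hv.2.1.symm).1 hv.2.2
  · refine tame_of_apex b (fun v hv => Or.inl hv) fun v hv => (not_strongAdj ?_).1 hv.2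
    rintro rfl
    exact hv.1 (Or.inr hb)

theorem ClosedUnder.diff_singleton (hB : T.IsBerge) (hT : ¬ T.HasBalancedSkewPartition) {τ : V → ℕ}
    (hτ : ∀ v, τ v = 1 ∨ τ v = 2) {S : Set V} (hS : T.ClosedUnder τ false S) {t t' : ℕ}
    (ht : t = 1 ∧ t' = 2 ∨ t = 2 ∧ t' = 1) {b n m : V} (hb : b ∈ part τ S t) (hn : n ∉ S)
    (hm : m ∉ S) (hnb : T.StrongAdj n b) (hmb : T.StrongAnti m b)
    (hmix : ¬ (T.Touch τ S t' b ∧ T.Miss τ S t' b)) : T.ClosedUnder τ false (S \ {b}) := by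
  have hU := part_union_two hτ S ht
  rw [Set.union_comm] at hU
  have hunif : T.Uniform (part τ S t) (part τ S t' ∪ part τ S t) := by
    rw [hU]; exact hS.uniform (by omega)
  have key : ¬ (T.Touch τ (S \ {b}) t b ∧ T.Miss τ (S \ {b}) t b) := by
    rintro ⟨⟨v, hv, hvb⟩, w, hw, hwb⟩
    rw [not_and_or] at hmix
    rcases hmix with h | h
    · refine hvb (compl_strongAdj.1 (hB.compl.complete_of_complete (fun h => hT h.of_compl) hb
        hunif.compl (n := m) (m := n) ?_ (compl_strongAdj.2 hmb) (compl_strongAnti.2 hnb)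
        (fun a ha => compl_strongAdj.2 (strongAnti_of_not_touch h a ha).symm) v
          ⟨hv.1.1, hv.2⟩ hv.1.2)).symm
      rwa [hU]
    · refine hwb (hB.complete_of_complete hT hb hunif (n := n) (m := m) ?_ hnb hmb
        (fun a ha => ?_) w ⟨hw.1.1, hw.2⟩ hw.1.2).symm
      · rwa [hU]
      · by_contra hba
        exact h ⟨a, ha, fun h => hba h.symm⟩
  intro x hx hbad
  by_cases hxb : x = b
  · subst hxb
    obtain ⟨s, hs, h1, h2⟩ := (bad_iff hτ).1 hbad
    by_cases hst : s = t
    · subst hst; exact key ⟨h1, h2⟩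
    · obtain rfl : s = t' := by omega
      exact hmix ⟨h1.mono Set.sdiff_subset, h2.mono Set.sdiff_subset⟩
  · exact hS x (fun h => hx ⟨h, hxb⟩) (hbad.mono Set.sdiff_subset)

theorem exists_pair_seed (hF : T.InF) (hT : ¬ T.HasBalancedSkewPartition) {A B : Set V}
    (h : T.IsProperHomogeneousPair A B)
    (hmin : ∀ A' B', T.IsProperHomogeneousPair A' B' → ¬ A' ∪ B' ⊂ A ∪ B) :
    ∃ c u v, ∀ S, T.IsClosure (T.typePair c) false u v S →
      T.PairValid (T.typePair c) S ∧ S = A ∪ B := by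
  obtain ⟨n₁₁, h₁₁, h₁₁'⟩ := h.ne₁₁
  obtain ⟨c, h₁₂, h₁₂'⟩ := h.ne₁₂
  obtain ⟨n₂₁, h₂₁, h₂₁'⟩ := h.ne₂₁
  obtain ⟨n₂₂, h₂₂, h₂₂'⟩ := h.ne₂₂
  have hτ := T.typePair_eq c
  have hτA : ∀ v ∈ A, T.typePair c v = 1 := fun v hv => if_pos (h₁₂.2 v hv)
  have hτB : ∀ v ∈ B, T.typePair c v = 2 := fun v hv => if_neg (h₁₂'.2 v hv).not_strongAdj
  have hp1 : ∀ S ⊆ A ∪ B, ∀ v ∈ part (T.typePair c) S 1, v ∈ A := by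
    rintro S hS v ⟨hv, hv1⟩
    rcases hS hv with h | h
    · exact h
    · rw [hτB v h] at hv1; omega
  have hp2 : ∀ S ⊆ A ∪ B, ∀ v ∈ part (T.typePair c) S 2, v ∈ B := by
    rintro S hS v ⟨hv, hv1⟩
    rcases hS hv with h | h
    · rw [hτA v h] at hv1; omega
    · exact h
  have hout : ∀ S ⊆ A ∪ B, n₁₁ ∉ S ∧ c ∉ S ∧ n₂₁ ∉ S ∧ n₂₂ ∉ S := fun S hS =>
    ⟨fun h => (hS h).elim h₁₁.1 h₁₁'.1, fun h => (hS h).elim h₁₂.1 h₁₂'.1,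
      fun h => (hS h).elim h₂₁.1 h₂₁'.1, fun h => (hS h).elim h₂₂.1 h₂₂'.1⟩
  have hX : T.ClosedUnder (T.typePair c) false (A ∪ B) := by
    intro x hx hbad
    obtain ⟨t, rfl | rfl, ⟨v, hv, hvx⟩, w, hw, hwx⟩ := (bad_iff hτ).1 hbad
    · have hxU : x ∈ T.completeTo A ∪ T.anticompleteTo A := h.unionA ▸ hx
      rcases hxU with hx' | hx'
      · exact hwx (hx'.2 w (hp1 _ subset_rfl w hw)).symm
      · exact hvx (hx'.2 v (hp1 _ subset_rfl v hv)).symm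
    · have hxU : x ∈ T.completeTo B ∪ T.anticompleteTo B := h.unionB ▸ hx
      rcases hxU with hx' | hx'
      · exact hwx (hx'.2 w (hp2 _ subset_rfl w hw)).symm
      · exact hvx (hx'.2 v (hp2 _ subset_rfl v hv)).symm
  have htwo1 : ∀ S ⊆ A ∪ B, T.ClosedUnder (T.typePair c) false S →
      ∀ u ∈ part (T.typePair c) S 1, ∀ v ∈ part (T.typePair c) S 1, u ≠ v →
      ∃ b ∈ part (T.typePair c) S 2, ∃ b' ∈ part (T.typePair c) S 2, b ≠ b' :=
    fun S hS hcl u hu v hv huv => hcl.exists_two hF hT hτ (Or.inl ⟨rfl, rfl⟩) hu hv huv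
      (hout S hS).2.1 (hout S hS).2.2.2 (h₁₂.2 u (hp1 S hS u hu)) (h₂₂.2 u (hp1 S hS u hu))
      fun b hb => ⟨⟨n₁₁, (hout S hS).1, (h₁₁'.2 b (hp2 S hS b hb)).symm⟩,
        n₂₂, (hout S hS).2.2.2, (h₂₂'.2 b (hp2 S hS b hb)).symm⟩
  have htwo2 : ∀ S ⊆ A ∪ B, T.ClosedUnder (T.typePair c) false S →
      ∀ u ∈ part (T.typePair c) S 2, ∀ v ∈ part (T.typePair c) S 2, u ≠ v →
      ∃ b ∈ part (T.typePair c) S 1, ∃ b' ∈ part (T.typePair c) S 1, b ≠ b' :=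
    fun S hS hcl u hu v hv huv => hcl.exists_two hF hT hτ (Or.inr ⟨rfl, rfl⟩) hu hv huv
      (hout S hS).2.2.1 (hout S hS).2.2.2 (h₂₁'.2 u (hp2 S hS u hu)) (h₂₂'.2 u (hp2 S hS u hu))
      fun b hb => ⟨⟨n₁₁, (hout S hS).1, (h₁₁.2 b (hp1 S hS b hb)).symm⟩,
        n₂₂, (hout S hS).2.2.2, (h₂₂.2 b (hp1 S hS b hb)).symm⟩
  let Q : ℕ → Prop := fun k => ∃ u ∈ A, ∃ v ∈ A, u ≠ v ∧ ∃ S,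
    T.IsClosure (T.typePair c) false u v S ∧ S.ncard = k
  have hQ : ∃ k, Q k := by
    obtain ⟨u, hu, v, hv, huv⟩ := (Set.one_lt_ncard (Set.toFinite A)).1 h.cardA
    obtain ⟨S, hS⟩ := T.exists_isClosure (T.typePair c) false u v
    exact ⟨_, u, hu, v, hv, huv, S, hS, rfl⟩
  classical
  obtain ⟨u, hu, v, hv, huv, S, hS, hcard⟩ := Nat.find_spec hQ
  have hleast : ∀ w ∈ A, ∀ w' ∈ A, w ≠ w' → ∀ Y, w ∈ Y → w' ∈ Y →
      T.ClosedUnder (T.typePair c) false Y → S.ncard ≤ Y.ncard := by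
    intro w hw w' hw' hww' Y hwY hwY' hY
    obtain ⟨S', hS'⟩ := T.exists_isClosure (T.typePair c) false w w'
    rw [hcard]
    refine (Nat.find_min' hQ ⟨w, hw, w', hw', hww', S', hS', rfl⟩).trans ?_
    exact Set.ncard_le_ncard (hS'.least Y hwY hwY' hY) (Set.toFinite _)
  have hSX : S ⊆ A ∪ B := hS.least _ (Or.inl hu) (Or.inl hv) hX
  have hu1 : u ∈ part (T.typePair c) S 1 := ⟨hS.left_mem, hτA u hu⟩
  have hv1 : v ∈ part (T.typePair c) S 1 := ⟨hS.right_mem, hτA v hv⟩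
  obtain ⟨b, hb, b', hb', hbb'⟩ := htwo1 S hSX hS.closed u hu1 v hv1 huv
  obtain ⟨o₁₁, o₁₂, o₂₁, o₂₂⟩ := hout S hSX
  have hdiff : ∀ x ∈ S, (S \ {x}).ncard < S.ncard := fun x hx =>
    Set.ncard_sdiff_singleton_lt_of_mem hx (Set.toFinite _)
  have touch1 : ∀ n, n ∈ T.completeTo A → T.Touch (T.typePair c) S 1 n := fun n hn =>
    ⟨u, hu1, (hn.2 u hu).symm.not_strongAnti⟩
  have touch2 : ∀ n, n ∈ T.completeTo B → T.Touch (T.typePair c) S 2 n := fun n hn =>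
    ⟨b, hb, (hn.2 b (hp2 S hSX b hb)).symm.not_strongAnti⟩
  have ntouch1 : ∀ n, n ∈ T.anticompleteTo A → ¬ T.Touch (T.typePair c) S 1 n := by
    rintro n hn ⟨x, hx, hxn⟩
    exact hxn (hn.2 x (hp1 S hSX x hx)).symm
  have ntouch2 : ∀ n, n ∈ T.anticompleteTo B → ¬ T.Touch (T.typePair c) S 2 n := by
    rintro n hn ⟨x, hx, hxn⟩
    exact hxn (hn.2 x (hp2 S hSX x hx)).symm
  have hvalid : T.PairValid (T.typePair c) S := by
    refine ⟨(Set.one_lt_ncard (Set.toFinite _)).2 ⟨u, hu1, v, hv1, huv⟩,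
      (Set.one_lt_ncard (Set.toFinite _)).2 ⟨b, hb, b', hb', hbb'⟩, ?_, ?_,
      ⟨n₁₁, o₁₁, touch1 _ h₁₁, touch2 _ h₁₁'⟩, ⟨c, o₁₂, touch1 _ h₁₂, ntouch2 _ h₁₂'⟩,
      ⟨n₂₁, o₂₁, ntouch1 _ h₂₁, touch2 _ h₂₁'⟩, ⟨n₂₂, o₂₂, ntouch1 _ h₂₂, ntouch2 _ h₂₂'⟩⟩
    · intro x hx
      by_contra hmix
      have hxA := hp1 S hSX x hx
      have hcl := hS.closed.diff_singleton hF.berge hT hτ (Or.inl ⟨rfl, rfl⟩) hx o₁₁ o₂₂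
        (h₁₁.2 x hxA) (h₂₂.2 x hxA) hmix
      have hne : ∀ y ∈ part (T.typePair c) S 2, y ∈ part (T.typePair c) (S \ {x}) 2 := by
        intro y hy
        refine ⟨⟨hy.1, ?_⟩, hy.2⟩
        rintro rfl
        have := hx.2; have := hy.2; omega
      obtain ⟨w, hw, w', hw', hww'⟩ := htwo2 _ (Set.sdiff_subset.trans hSX) hcl b (hne b hb) b'
        (hne b' hb') hbb'
      have := hleast w (hp1 _ (Set.sdiff_subset.trans hSX) w hw) w'
        (hp1 _ (Set.sdiff_subset.trans hSX) w' hw') hww' _ hw.1 hw'.1 hcl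
      have := hdiff x hx.1
      omega
    · intro x hx
      by_contra hmix
      have hxB := hp2 S hSX x hx
      have hcl := hS.closed.diff_singleton hF.berge hT hτ (Or.inr ⟨rfl, rfl⟩) hx o₁₁ o₂₂
        (h₁₁'.2 x hxB) (h₂₂'.2 x hxB) hmix
      have hne : ∀ y ∈ part (T.typePair c) S 1, y ∈ S \ {x} := by
        intro y hy
        refine ⟨hy.1, ?_⟩
        rintro rfl
        have := hx.2; have := hy.2; omega
      have := hleast u hu v hv huv _ (hne u hu1) (hne v hv1) hcl
      have := hdiff x hx.1
      omega
  refine ⟨c, u, v, fun S' hS' => ?_⟩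
  obtain rfl := hS'.unique hS
  refine ⟨hvalid, ?_⟩
  by_contra hne
  obtain ⟨h1, h2⟩ := hvalid.isProperHomogeneousPair hτ hS.closed
  exact hmin _ _ h1 (by rw [h2]; exact hSX.ssubset_of_ne hne)

end PairSeeds

end Trigraph

namespace Trigraph

section JoinSeeds

variable {V : Type*} [Finite V] {T : Trigraph V} {A₁ B₁ C₁ A₂ B₂ C₂ : Set V}

theorem pathVia_one {A B : Set V} (C : Set V) {a b : V} (ha : a ∈ A) (hb : b ∈ B)
    (hab : T.Adj a b) : T.PathVia ![a, b] A B C := by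
  refine ⟨⟨?_, ?_⟩, ha, hb, ?_⟩
  · have := hab.ne
    intro i j
    fin_cases i <;> fin_cases j <;> simp [this, this.symm]
  · intro i j
    fin_cases i <;> fin_cases j <;> simp [hab]
  · intro i
    fin_cases i <;> simp

theorem pathVia_two {A B C : Set V} {a b c : V} (ha : a ∈ A) (hb : b ∈ B) (hc : c ∈ C)
    (hac : T.Adj a c) (hcb : T.Adj c b) (hab : T.Anti a b) : T.PathVia ![a, c, b] A B C := by
  refine ⟨⟨?_, ?_⟩, ha, hb, ?_⟩
  · have h1 := hac.ne
    have h2 := hcb.ne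
    have h3 := hab.ne
    intro i j
    fin_cases i <;> fin_cases j <;> simp [h1, h2, h3, h1.symm, h2.symm, h3.symm]
  · intro i j
    fin_cases i <;> fin_cases j <;> simp [hac, hcb, hab]
  · intro i
    fin_cases i <;> simp [hc]

/-- The two paths of lengths one and two have different parities. -/
theorem IsTwoJoinSplit.not_adj (hB : T.IsBerge) (hT : ¬ T.HasBalancedSkewPartition)
    (h : T.IsTwoJoinSplit A₁ B₁ C₁ A₂ B₂ C₂) {a a' b b' c : V} (ha : a ∈ A₁) (hb : b ∈ B₁)
    (hc : c ∈ C₁) (hac : T.Adj a c) (hcb : T.Adj c b) (hab : T.Anti a b) (ha' : a' ∈ A₁)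
    (hb' : b' ∈ B₁) : ¬ T.Adj a' b' := by
  intro hab'
  obtain ⟨l, q, hq⟩ := (h.isProper hB hT).exists_path
  have h1 := h.even_add hB (pathVia_one C₁ ha' hb' hab') hq
  have h2 := h.even_add hB (pathVia_two ha hb hc hac hcb hab) hq
  grind

/-- A vertex of `C₁` with at most one neighbor on each side. -/
theorem IsTwoJoinSplit.pendant (hB : T.IsBerge) (hT : ¬ T.HasBalancedSkewPartition)
    (h : T.IsTwoJoinSplit A₁ B₁ C₁ A₂ B₂ C₂) {a b s : V} (ha : a ∈ A₁) (hb : b ∈ B₁) (hs : s ∈ C₁)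
    (hsN : ∀ v, v ≠ a → v ≠ b → v ≠ s → T.StrongAnti s v) :
    T.Adj a s ∧ T.Adj s b ∧ T.StrongAnti a b := by
  obtain ⟨-, -, ⟨a₂, ha₂⟩, ⟨b₂, hb₂⟩⟩ := h.nonempty
  have da := h.disj' a
  have db := h.disj' b
  have ds := h.disj' s
  have da₂ := h.disj' a₂
  have db₂ := h.disj' b₂
  have hsa : s ≠ a := by rintro rfl; exact (da.1 ha).2.1 hs
  have hsb : s ≠ b := by rintro rfl; exact (db.2.1 hb).1 hs
  have hab : a ≠ b := by rintro rfl; exact (da.1 ha).1 hb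
  have h1 : T.Adj a s := by
    rw [← not_strongAnti hsa.symm]
    intro has
    refine hB.no_edge_cutset hT (P := {s}) (h.completeB _ hb _ hb₂) rfl ?_ ?_ (m := a) ?_ hab ?_ ?_
    · exact fun h => hsb h.symm
    · rintro rfl; exact (ds.2.2.1 hs).2.1 hb₂
    · exact fun h => hsa h.symm
    · rintro rfl; exact (da.1 ha).2.2.2.1 hb₂
    · rintro _ rfl w hw hwb -
      by_cases hwa : w = a
      · subst hwa; exact has.symm
      · exact hsN w hwa hwb hw
  have h2 : T.Adj s b := by
    rw [← not_strongAnti hsb]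
    intro hsb'
    refine hB.no_edge_cutset hT (P := {s}) (h.completeA _ ha _ ha₂) rfl ?_ ?_ (m := b) ?_ hab.symm
      ?_ ?_
    · exact fun h => hsa h.symm
    · rintro rfl; exact (ds.2.2.1 hs).1 ha₂
    · exact fun h => hsb h.symm
    · rintro rfl; exact (db.2.1 hb).2.1 ha₂
    · rintro _ rfl w hw hwa -
      by_cases hwb : w = b
      · subst hwb; exact hsb'
      · exact hsN w hwa hwb hw
  refine ⟨h1, h2, ?_⟩
  rcases T.trichotomy hab with h3 | h3 | h3
  · exfalso
    refine hB.no_edge_cutset hT (P := {s}) h3 rfl ?_ ?_ (m := a₂) ?_ ?_ ?_ ?_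
    · exact fun h => hsa h.symm
    · exact fun h => hsb h.symm
    · rintro rfl; exact (ds.2.2.1 hs).1 ha₂
    · rintro rfl; exact (da.1 ha).2.2.1 ha₂
    · rintro rfl; exact (db.2.1 hb).2.1 ha₂
    · rintro _ rfl w hw hwa hwb; exact hsN w hwa hwb hw
  · exact h3
  · exact absurd (Or.inr h3) (h.not_adj hB hT ha hb hs h1 h2 (Or.inr h3) ha hb)

/-- The only vertex of `A₁ ∪ B₁ ∪ C₁ ∖ A₁` with neighbors in `A₁`. -/
theorem IsTwoJoinSplit.no_single_attachment (hF : T.InF) (hT : ¬ T.HasBalancedSkewPartition)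
    (h : T.IsTwoJoinSplit A₁ B₁ C₁ A₂ B₂ C₂) {a a' s k : V} (ha : a ∈ A₁) (ha' : a' ∈ A₁)
    (haa' : a ≠ a') (hs : s ∈ B₁ ∪ C₁) (hk : k ∉ insert s A₁) (hka : T.StrongAnti k a)
    (hout : ∀ v ∈ B₁ ∪ C₁, v ≠ s → ∀ w ∈ A₁, T.StrongAnti v w)
    (hsemi : ∃ c ∈ A₁, ¬ T.Semi s c) : False := by
  obtain ⟨-, -, ⟨a₂, ha₂⟩, -⟩ := h.nonempty
  obtain ⟨c, hc, hsc⟩ := hsemi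
  refine hF.berge.no_pair hT ha ha' haa' (b := s) ?_ hc hsc (n := a₂) ?_ hk
    (h.completeA _ ha _ ha₂).symm hka ?_
  · intro h1; have := h.disj' s; grind
  · have := h.disj' a₂; grind
  · intro v hv
    have h1 := h.mem v
    by_cases hv2 : v ∈ A₂
    · exact Or.inl fun w hw => (h.completeA _ hw _ hv2).symm
    · refine Or.inr fun w hw => ?_
      have hv3 : v ≠ s ∧ v ∉ A₁ := by simpa using hv
      by_cases hvX : v ∈ B₁ ∪ C₁
      · exact hout v hvX hv3.1 w hw
      · refine (h.anti (u := w) (v := v) (Or.inl (Or.inl hw)) ?_ (fun h => hv2 h.2) fun h' => ?_).symm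
        · grind
        · have := h.disj' w; grind

theorem IsTwoJoinSplit.no_two_one (hF : T.InF) (hT : ¬ T.HasBalancedSkewPartition)
    (h : T.IsTwoJoinSplit A₁ B₁ C₁ A₂ B₂ C₂) (hC : C₁ = ∅) {b : V} (hB : B₁ = {b})
    (hA : 1 < A₁.ncard) : False := by
  obtain ⟨-, -, ⟨a₂, ha₂⟩, ⟨b₂, hb₂⟩⟩ := h.nonempty
  obtain ⟨a, ha, a', ha', haa'⟩ := (Set.one_lt_ncard (Set.toFinite _)).1 hA
  have hb : b ∈ B₁ := by rw [hB]; rfl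
  have db := h.disj' b
  have da₂ := h.disj' a₂
  have db₂ := h.disj' b₂
  have da := h.disj' a
  refine h.no_single_attachment hF hT ha ha' haa' (s := b) (k := b₂) (Or.inl hb) ?_ ?_ ?_ ?_
  · grind
  · exact (h.anti (Or.inl (Or.inl ha)) (Or.inl (Or.inr hb₂)) (by grind) (by grind)).symm
  · intro v hv hvb
    rw [hB, hC, Set.union_empty] at hv
    exact absurd hv hvb
  · refine hF.exists_not_semi ha ha' haa' (h.completeB _ hb _ hb₂)
      (h.anti (Or.inl (Or.inr hb)) (Or.inl (Or.inl ha₂)) (by grind) (by grind)) ?_ ?_ <;> grind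

theorem IsTwoJoinSplit.four_le (hF : T.InF) (hT : ¬ T.HasBalancedSkewPartition)
    (h : T.IsTwoJoinSplit A₁ B₁ C₁ A₂ B₂ C₂) : 4 ≤ (A₁ ∪ B₁ ∪ C₁).ncard := by
  by_contra hlt
  have h3 : (A₁ ∪ B₁ ∪ C₁).ncard = 3 := by have := h.card₁; omega
  have d1 : Disjoint (A₁ ∪ B₁) C₁ := Set.disjoint_left.2 fun v hv hv' => by
    have := h.disj' v; grind
  have d2 : Disjoint A₁ B₁ := Set.disjoint_left.2 fun v hv hv' => by
    have := h.disj' v; grind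
  rw [Set.ncard_union_eq d1, Set.ncard_union_eq d2] at h3
  have hA := (Set.ncard_pos (Set.toFinite _)).2 h.nonempty.1
  have hB := (Set.ncard_pos (Set.toFinite _)).2 h.nonempty.2.1
  rcases Nat.eq_zero_or_pos C₁.ncard with hC | hC
  · have hC' : C₁ = ∅ := (Set.ncard_eq_zero (Set.toFinite _)).1 hC
    by_cases hA1 : A₁.ncard = 1
    · obtain ⟨a, ha⟩ := Set.ncard_eq_one.1 hA1
      exact h.swap.no_two_one hF hT hC' ha (by omega)
    · obtain ⟨b, hb⟩ := Set.ncard_eq_one.1 (show B₁.ncard = 1 by omega)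
      exact h.no_two_one hF hT hC' hb (by omega)
  · obtain ⟨a, ha⟩ := Set.ncard_eq_one.1 (show A₁.ncard = 1 by omega)
    obtain ⟨b, hb⟩ := Set.ncard_eq_one.1 (show B₁.ncard = 1 by omega)
    obtain ⟨s, hs⟩ := Set.ncard_eq_one.1 (show C₁.ncard = 1 by omega)
    have ha' : a ∈ A₁ := by rw [ha]; rfl
    have hb' : b ∈ B₁ := by rw [hb]; rfl
    have hs' : s ∈ C₁ := by rw [hs]; rfl
    obtain ⟨h1, h2, h4⟩ := h.pendant hF.berge hT ha' hb' hs' fun v hva hvb hvs => by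
      have h1 := h.mem v
      have h2 := h.disj' s
      have e1 : v ∈ A₁ ↔ v = a := by rw [ha]; rfl
      have e2 : v ∈ B₁ ↔ v = b := by rw [hb]; rfl
      have e3 : v ∈ C₁ ↔ v = s := by rw [hs]; rfl
      refine h.anti (Or.inr hs') ?_ (by grind) (by grind)
      grind
    refine h.notPath₁ a b ha hb ⟨s, h4.ne, ?_, h1, h2, h4.not_adj⟩
    rw [ha, hb, hs]
    ext; simp; tauto

theorem IsTwoJoinSplit.closedUnder {τ : V → ℕ} (h : T.IsTwoJoinSplit A₁ B₁ C₁ A₂ B₂ C₂)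
    (hA : ∀ v ∈ A₁, τ v = 1) (hB : ∀ v ∈ B₁, τ v = 2) (hC : ∀ v ∈ C₁, τ v = 3) :
    T.ClosedUnder τ true (A₁ ∪ B₁ ∪ C₁) := by
  intro x hx
  have hx2 : x ∈ A₂ ∪ B₂ ∪ C₂ := by have := h.mem x; grind
  have hdx := h.disj' x
  have key : ∀ t, T.Touch τ (A₁ ∪ B₁ ∪ C₁) t x → (t = 1 ∧ x ∈ A₂) ∨ (t = 2 ∧ x ∈ B₂) := by
    rintro t ⟨v, ⟨hv, hvt⟩, hvx⟩
    have h1 : (v ∈ A₁ ∧ x ∈ A₂) ∨ (v ∈ B₁ ∧ x ∈ B₂) := by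
      by_contra! hno
      exact hvx (h.anti hv hx2 (fun h => hno.1 h.1 h.2) fun h => hno.2 h.1 h.2)
    rcases h1 with h1 | h1
    · exact Or.inl ⟨hvt ▸ hA v h1.1, h1.2⟩
    · exact Or.inr ⟨hvt ▸ hB v h1.1, h1.2⟩
  have key1 : x ∈ A₂ → ¬ T.Miss τ (A₁ ∪ B₁ ∪ C₁) 1 x := by
    rintro hxA ⟨v, ⟨hv, hvt⟩, hvx⟩
    refine hvx (h.completeA _ ?_ _ hxA)
    have := hB v
    have := hC v
    grind
  have key2 : x ∈ B₂ → ¬ T.Miss τ (A₁ ∪ B₁ ∪ C₁) 2 x := by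
    rintro hxA ⟨v, ⟨hv, hvt⟩, hvx⟩
    refine hvx (h.completeB _ ?_ _ hxA)
    have := hA v
    have := hC v
    grind
  rintro (⟨h1, h2⟩ | ⟨h1, h2⟩ | h1 | ⟨-, h1, h2⟩)
  · exact key1 (by have := key 1 h1; grind) h2
  · exact key2 (by have := key 2 h1; grind) h2
  · have := key 3 h1; omega
  · have := key 1 h1; have := key 2 h2; grind

/-- A closed subset of a minimal side of a `2`-join that is itself a side of a `2`-join. -/
theorem IsTwoJoinSplit.joinValid {τ : V → ℕ} (hF : T.InF) (hT : ¬ T.HasBalancedSkewPartition)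
    (hτ : ∀ v, τ v = 1 ∨ τ v = 2 ∨ τ v = 3) (h : T.IsTwoJoinSplit A₁ B₁ C₁ A₂ B₂ C₂)
    (hmin : ∀ Y, Y ⊂ A₁ ∪ B₁ ∪ C₁ → ¬ T.IsProperTwoJoinSide Y)
    (hA : ∀ v ∈ A₁, τ v = 1) (hB : ∀ v ∈ B₁, τ v = 2) (hC : ∀ v ∈ C₁, τ v = 3) {S : Set V}
    (hS : S ⊆ A₁ ∪ B₁ ∪ C₁) (hcl : T.ClosedUnder τ true S) (h1 : (part τ S 1).Nonempty)
    (h2 : (part τ S 2).Nonempty) (h4 : 4 ≤ S.ncard) : T.JoinValid τ S ∧ S = A₁ ∪ B₁ ∪ C₁ := by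
  obtain ⟨-, -, ⟨a₂, ha₂⟩, ⟨b₂, hb₂⟩⟩ := h.nonempty
  have hcompl : Disjoint S (A₂ ∪ B₂ ∪ C₂) := Set.disjoint_left.2 fun v hv hv' => by
    have := hS hv; have := h.disj' v; grind
  have hvalid : T.JoinValid τ S := by
    refine ⟨h1, h2, h4, ?_, ⟨a₂, ?_, ?_⟩, ⟨b₂, ?_, ?_⟩⟩
    · have e1 := Set.ncard_union_eq hcompl
      have e2 := Set.ncard_le_ncard (Set.subset_univ (S ∪ (A₂ ∪ B₂ ∪ C₂)))
      rw [Set.ncard_univ] at e2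
      have := h.swapSides.four_le hF hT
      omega
    · exact Set.disjoint_right.1 hcompl (Or.inl (Or.inl ha₂))
    · obtain ⟨v, hv⟩ := h1
      refine ⟨v, hv, (h.completeA _ ?_ _ ha₂).not_strongAnti⟩
      have := hS hv.1; have := hv.2; have := hB v; have := hC v
      grind
    · exact Set.disjoint_right.1 hcompl (Or.inl (Or.inr hb₂))
    · obtain ⟨v, hv⟩ := h2
      refine ⟨v, hv, (h.completeB _ ?_ _ hb₂).not_strongAnti⟩
      have := hS hv.1; have := hv.2; have := hA v; have := hC v
      grind
  refine ⟨hvalid, ?_⟩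
  by_contra hne
  exact hmin S (hS.ssubset_of_ne hne) ⟨_, _, _, _, _, _,
    (hvalid.split hτ hcl).isProper hF.berge hT, (part_union hτ S).symm⟩

open Classical in
noncomputable def typeJoin (T : Trigraph V) (a b : V) : V → ℕ := fun w =>
  if T.StrongAdj a w then 1 else if T.StrongAdj b w then 2 else 3

open Classical in
noncomputable def typeLink (T : Trigraph V) (a : V) : V → ℕ := fun w =>
  if T.StrongAdj a w then 1 else if ∃ u, ¬ T.StrongAnti w u ∧ T.StrongAdj a u then 3 else 2

theorem typePair_eq' (T : Trigraph V) (c w : V) :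
    T.typePair c w = 1 ∨ T.typePair c w = 2 ∨ T.typePair c w = 3 := by
  unfold typePair; split_ifs <;> simp

theorem typeJoin_eq (T : Trigraph V) (a b w : V) :
    T.typeJoin a b w = 1 ∨ T.typeJoin a b w = 2 ∨ T.typeJoin a b w = 3 := by
  unfold typeJoin; split_ifs <;> simp

theorem typeLink_eq (T : Trigraph V) (a w : V) :
    T.typeLink a w = 1 ∨ T.typeLink a w = 2 ∨ T.typeLink a w = 3 := by
  unfold typeLink; split_ifs <;> simp

/-- A seed for a `2`-join side without inner vertices. -/
theorem IsTwoJoinSplit.exists_pair_seed (hF : T.InF) (hT : ¬ T.HasBalancedSkewPartition)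
    (h : T.IsTwoJoinSplit A₁ B₁ C₁ A₂ B₂ C₂)
    (hmin : ∀ Y, Y ⊂ A₁ ∪ B₁ ∪ C₁ → ¬ T.IsProperTwoJoinSide Y) (hC : C₁ = ∅)
    (hA : 1 < A₁.ncard) : ∃ c u v, ∀ S, T.IsClosure (T.typePair c) true u v S →
      T.JoinValid (T.typePair c) S ∧ S = A₁ ∪ B₁ ∪ C₁ := by
  obtain ⟨-, -, ⟨a₂, ha₂⟩, ⟨b₂, hb₂⟩⟩ := h.nonempty
  obtain ⟨u, hu, v, hv, huv⟩ := (Set.one_lt_ncard (Set.toFinite _)).1 hA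
  have hτA : ∀ v ∈ A₁, T.typePair a₂ v = 1 := fun v hv => if_pos (h.completeA _ hv _ ha₂).symm
  have hτB : ∀ v ∈ B₁, T.typePair a₂ v = 2 := fun v hv => if_neg (by
    refine (h.anti (Or.inl (Or.inr hv)) (Or.inl (Or.inl ha₂)) ?_ ?_).symm.not_strongAdj
    · have := h.disj' v; grind
    · have := h.disj' a₂; grind)
  have hτC : ∀ v ∈ C₁, T.typePair a₂ v = 3 := by simp [hC]
  have hcl := h.closedUnder hτA hτB hτC
  refine ⟨a₂, u, v, fun S hS => ?_⟩
  have hSX := hS.least _ (Or.inl (Or.inl hu)) (Or.inl (Or.inl hv)) hcl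
  have hout : ∀ v ∈ A₂ ∪ B₂ ∪ C₂, v ∉ S := fun v hv hvS => by
    have := hSX hvS; have := h.disj' v; grind
  have hu1 : u ∈ part (T.typePair a₂) S 1 := ⟨hS.left_mem, hτA u hu⟩
  have hv1 : v ∈ part (T.typePair a₂) S 1 := ⟨hS.right_mem, hτA v hv⟩
  have da := h.disj' a₂
  have db := h.disj' b₂
  obtain ⟨b, hb, b', hb', hbb'⟩ := hS.closed.exists_two hF hT (T.typePair_eq a₂)
    (Or.inl ⟨rfl, rfl⟩) hu1 hv1 huv (hout a₂ (Or.inl (Or.inl ha₂)))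
    (hout b₂ (Or.inl (Or.inr hb₂))) (h.completeA _ hu _ ha₂).symm
    (h.anti (Or.inl (Or.inl hu)) (Or.inl (Or.inr hb₂)) (by grind)
      (by have := h.disj' u; grind)).symm (by
    intro b hb
    have hbB : b ∈ B₁ := by
      have h1 := hSX hb.1
      have h2 := hb.2
      have h3 := hτA b
      rw [hC] at h1
      grind
    exact ⟨⟨b₂, hout b₂ (Or.inl (Or.inr hb₂)), h.completeB _ hbB _ hb₂⟩,
      ⟨a₂, hout a₂ (Or.inl (Or.inl ha₂)), h.anti (Or.inl (Or.inr hbB)) (Or.inl (Or.inl ha₂))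
        (by have := h.disj' b; grind) (by grind)⟩⟩)
  refine h.joinValid hF hT (T.typePair_eq' a₂) hmin hτA hτB hτC hSX hS.closed ⟨u, hu1⟩ ⟨b, hb⟩ ?_
  have hsub : ({u, v, b, b'} : Set V) ⊆ S := by
    rintro x (rfl | rfl | rfl | rfl)
    exacts [hu1.1, hv1.1, hb.1, hb'.1]
  have hne : ∀ x ∈ part (T.typePair a₂) S 1, ∀ y ∈ part (T.typePair a₂) S 2, x ≠ y := by
    rintro x hx y hy rfl
    have := hx.2; have := hy.2; omega
  have : ({u, v, b, b'} : Set V).ncard = 4 := by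
    rw [Set.ncard_insert_of_notMem (by simp [huv, hne u hu1 b hb, hne u hu1 b' hb'])
      (Set.toFinite _), Set.ncard_insert_of_notMem (by simp [hne v hv1 b hb, hne v hv1 b' hb'])
      (Set.toFinite _), Set.ncard_pair hbb']
  rw [← this]
  exact Set.ncard_le_ncard hsub (Set.toFinite _)

/-- A closed set that contains an inner vertex sees both ends of the `2`-join. -/
theorem IsTwoJoinSplit.part_nonempty {τ : V → ℕ} (hF : T.InF) (hT : ¬ T.HasBalancedSkewPartition)
    (hτ : ∀ v, τ v = 1 ∨ τ v = 2 ∨ τ v = 3) (h : T.IsTwoJoinSplit A₁ B₁ C₁ A₂ B₂ C₂)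
    (hA : ∀ v ∈ A₁, τ v = 1) (hB : ∀ v ∈ B₁, τ v = 2) (hC : ∀ v ∈ C₁, τ v = 3) {S : Set V}
    (hS : S ⊆ A₁ ∪ B₁ ∪ C₁) (hcl : T.ClosedUnder τ true S) {s : V} (hsS : s ∈ S) (hs : s ∈ C₁) :
    (part τ S 1).Nonempty ∧ (part τ S 2).Nonempty := by
  obtain ⟨-, -, ⟨a₂, ha₂⟩, ⟨b₂, hb₂⟩⟩ := h.nonempty
  have da := h.disj' a₂
  have db := h.disj' b₂
  have ha₂S : a₂ ∉ S := fun h' => by have := hS h'; grind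
  have hb₂S : b₂ ∉ S := fun h' => by have := hS h'; grind
  have hs3 : s ∈ part τ S 3 := ⟨hsS, hC s hs⟩
  have hp1 : ∀ v ∈ part τ S 1, v ∈ A₁ := fun v hv => by
    have := hS hv.1; have := hv.2; have := hB v; have := hC v; grind
  have hp2 : ∀ v ∈ part τ S 2, v ∈ B₁ := fun v hv => by
    have := hS hv.1; have := hv.2; have := hA v; have := hC v; grind
  have hp3 : ∀ v ∈ part τ S 3, v ∈ C₁ := fun v hv => by
    have := hS hv.1; have := hv.2; have := hA v; have := hB v; grind
  have hU := part_union hτ S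
  have hdisj : ∀ t, t ≠ 3 → Disjoint (part τ S t) (part τ S 3) := fun t ht =>
    Set.disjoint_left.2 fun v hv hv' => ht (hv.2.symm.trans hv'.2)
  have hanti : ∀ v ∉ S, ∀ c ∈ part τ S 3, T.StrongAnti v c := fun v hv c hc =>
    (hcl.anti hv c hc).symm
  by_cases h1 : (part τ S 1).Nonempty <;> by_cases h2 : (part τ S 2).Nonempty
  · exact ⟨h1, h2⟩
  · exfalso
    obtain ⟨a, ha⟩ := h1
    rw [Set.not_nonempty_iff_eq_empty.1 h2, Set.union_empty] at hU
    refine hF.berge.no_one_sided hT ha hs3 (hdisj 1 (by omega)) (n := a₂) (m := b₂)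
      (by rwa [hU]) (by rwa [hU]) (h.completeA _ (hp1 a ha) _ ha₂).symm ?_
      (by rw [hU]; exact hcl.uniform (Or.inl rfl)) (by rwa [hU])
    have := h.disj' a
    have := hp1 a ha
    exact (h.anti (Or.inl (Or.inl (hp1 a ha))) (Or.inl (Or.inr hb₂)) (by grind) (by grind)).symm
  · exfalso
    obtain ⟨a, ha⟩ := h2
    rw [Set.not_nonempty_iff_eq_empty.1 h1, Set.empty_union] at hU
    refine hF.berge.no_one_sided hT ha hs3 (hdisj 2 (by omega)) (n := b₂) (m := a₂)
      (by rwa [hU]) (by rwa [hU]) (h.completeB _ (hp2 a ha) _ hb₂).symm ?_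
      (by rw [hU]; exact hcl.uniform (Or.inr rfl)) (by rwa [hU])
    have := h.disj' a
    have := hp2 a ha
    exact (h.anti (Or.inl (Or.inr (hp2 a ha))) (Or.inl (Or.inl ha₂)) (by grind) (by grind)).symm
  · exfalso
    rw [Set.not_nonempty_iff_eq_empty.1 h1, Set.not_nonempty_iff_eq_empty.1 h2, Set.empty_union,
      Set.empty_union] at hU
    rw [hU] at hanti hp3
    obtain ⟨v, hv, hvB⟩ := h.meets hF.berge hT hS ⟨s, hsS⟩ fun v hv w _ hwS =>
      (hanti w hwS v hv).symm
    have := h.disj' v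
    have := hp3 v hv
    grind

theorem typeJoin_of_split (h : T.IsTwoJoinSplit A₁ B₁ C₁ A₂ B₂ C₂) {a₂ b₂ : V} (ha₂ : a₂ ∈ A₂)
    (hb₂ : b₂ ∈ B₂) : (∀ v ∈ A₁, T.typeJoin a₂ b₂ v = 1) ∧ (∀ v ∈ B₁, T.typeJoin a₂ b₂ v = 2) ∧
      ∀ v ∈ C₁, T.typeJoin a₂ b₂ v = 3 := by
  have da := h.disj' a₂
  have db := h.disj' b₂
  refine ⟨fun v hv => if_pos (h.completeA _ hv _ ha₂).symm, fun v hv => ?_, fun v hv => ?_⟩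
  · have dv := h.disj' v
    have h1 := h.anti (Or.inl (Or.inr hv)) (Or.inl (Or.inl ha₂)) (by grind) (by grind)
    rw [typeJoin, if_neg h1.symm.not_strongAdj, if_pos (h.completeB _ hv _ hb₂).symm]
  · have dv := h.disj' v
    have h1 := h.anti (Or.inr hv) (Or.inl (Or.inl ha₂)) (by grind) (by grind)
    have h2 := h.anti (Or.inr hv) (Or.inl (Or.inr hb₂)) (by grind) (by grind)
    rw [typeJoin, if_neg h1.symm.not_strongAdj, if_neg h2.symm.not_strongAdj]

end JoinSeeds

end Trigraph

namespace Trigraph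

section JoinSeedsExist

variable {V : Type*} [Finite V] {T : Trigraph V} {A₁ B₁ C₁ A₂ B₂ C₂ : Set V}

theorem part_subset_of_split {V : Type*} {A₁ B₁ C₁ : Set V} {τ : V → ℕ} (hA : ∀ v ∈ A₁, τ v = 1) (hB : ∀ v ∈ B₁, τ v = 2)
    (hC : ∀ v ∈ C₁, τ v = 3) {S : Set V} (hS : S ⊆ A₁ ∪ B₁ ∪ C₁) :
    part τ S 1 ⊆ A₁ ∧ part τ S 2 ⊆ B₁ := by
  constructor
  · intro v hv
    have := hS hv.1; have := hv.2; have := hB v; have := hC v; grind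
  · intro v hv
    have := hS hv.1; have := hv.2; have := hA v; have := hC v; grind

/-- If all inner vertices have degree two and lie in paths of length two between `A₁` and `B₁`,
then two inner vertices form a seed. -/
theorem IsTwoJoinSplit.exists_link_seed (hF : T.InF) (hT : ¬ T.HasBalancedSkewPartition)
    (h : T.IsTwoJoinSplit A₁ B₁ C₁ A₂ B₂ C₂)
    (hmin : ∀ Y, Y ⊂ A₁ ∪ B₁ ∪ C₁ → ¬ T.IsProperTwoJoinSide Y) (hC : C₁.Nonempty)
    (hdeg : ∀ s ∈ C₁, ∃ a ∈ A₁, ∃ b ∈ B₁, ∀ v, v ≠ a → v ≠ b → v ≠ s → T.StrongAnti s v) :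
    ∃ a s s', ∀ S, T.IsClosure (T.typeLink a) true s s' S →
      T.JoinValid (T.typeLink a) S ∧ S = A₁ ∪ B₁ ∪ C₁ := by
  obtain ⟨-, -, ⟨a₂, ha₂⟩, ⟨b₂, hb₂⟩⟩ := h.nonempty
  have hpend : ∀ s ∈ C₁, ∃ a ∈ A₁, ∃ b ∈ B₁, (∀ v, v ≠ a → v ≠ b → v ≠ s → T.StrongAnti s v) ∧
      T.Adj a s ∧ T.Adj s b ∧ T.StrongAnti a b := fun s hs => by
    obtain ⟨a, ha, b, hb, hsN⟩ := hdeg s hs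
    exact ⟨a, ha, b, hb, hsN, h.pendant hF.berge hT ha hb hs hsN⟩
  obtain ⟨s, hs⟩ := hC
  obtain ⟨a, ha, b, hb, hsN, has, hsb, hab⟩ := hpend s hs
  have hAB : ∀ a' ∈ A₁, ∀ b' ∈ B₁, T.StrongAnti a' b' := fun a' ha' b' hb' => by
    by_contra hab'
    refine h.not_adj hF.berge hT ha hb hs has hsb (Or.inl hab) ha' hb' ((not_strongAnti ?_).1 hab')
    rintro rfl
    have := h.disj' a'
    grind
  have hAB2 : T.StrongAnti a₂ b₂ ∧ ∀ b' ∈ B₂, T.StrongAnti a₂ b' := by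
    have key : ∀ b' ∈ B₂, T.StrongAnti a₂ b' := fun b' hb' => by
      by_contra hab'
      have hne : a₂ ≠ b' := by rintro rfl; have := h.disj' a₂; grind
      have h1 := h.even_add hF.berge (pathVia_two ha hb hs has hsb (Or.inl hab))
        (pathVia_one C₂ ha₂ hb' ((not_strongAnti hne).1 hab'))
      grind
    exact ⟨key _ hb₂, key⟩
  have hsA : s ∉ A₁ ∧ s ∉ B₁ := by have := h.disj' s; grind
  have hcard := h.four_le hF hT
  by_cases hC1 : ∃ s' ∈ C₁, s ≠ s'
  · obtain ⟨s', hs', hss'⟩ := hC1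
    have da₂ := h.disj' a₂
    have hτA : ∀ v ∈ A₁, T.typeLink a₂ v = 1 := fun v hv => if_pos (h.completeA _ hv _ ha₂).symm
    have hτB : ∀ v ∈ B₁, T.typeLink a₂ v = 2 := fun v hv => by
      have dv := h.disj' v
      have h1 := h.anti (Or.inl (Or.inr hv)) (Or.inl (Or.inl ha₂)) (by grind) (by grind)
      rw [typeLink, if_neg h1.symm.not_strongAdj, if_neg]
      rintro ⟨u, hvu, hau⟩
      have du := h.disj' u
      rcases h.mem u with hu | hu | hu | hu | hu | hu
      · exact hvu (hAB u hu v hv).symm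
      · exact (h.anti (Or.inl (Or.inr hu)) (Or.inl (Or.inl ha₂)) (by grind)
          (by grind)).symm.not_strongAdj hau
      · exact (h.anti (Or.inr hu) (Or.inl (Or.inl ha₂)) (by grind)
          (by grind)).symm.not_strongAdj hau
      · exact hvu (h.anti (Or.inl (Or.inr hv)) (Or.inl (Or.inl hu)) (by grind) (by grind))
      · exact (hAB2.2 u hu).not_strongAdj hau
      · exact hvu (h.anti (Or.inl (Or.inr hv)) (Or.inr hu) (by grind) (by grind))
    have hτC : ∀ v ∈ C₁, T.typeLink a₂ v = 3 := fun v hv => by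
      have dv := h.disj' v
      obtain ⟨a', ha', b', hb', -, hav, -⟩ := hpend v hv
      have h1 := h.anti (Or.inr hv) (Or.inl (Or.inl ha₂)) (by grind) (by grind)
      rw [typeLink, if_neg h1.symm.not_strongAdj, if_pos]
      exact ⟨a', hav.symm.not_strongAnti, (h.completeA _ ha' _ ha₂).symm⟩
    have hcl := h.closedUnder hτA hτB hτC
    refine ⟨a₂, s, s', fun S hS => ?_⟩
    have hSX := hS.least _ (Or.inr hs) (Or.inr hs') hcl
    obtain ⟨h1, h2⟩ := h.part_nonempty hF hT (T.typeLink_eq a₂) hτA hτB hτC hSX hS.closed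
      hS.left_mem hs
    refine h.joinValid hF hT (T.typeLink_eq a₂) hmin hτA hτB hτC hSX hS.closed h1 h2 ?_
    obtain ⟨x, hx⟩ := h1
    obtain ⟨y, hy⟩ := h2
    have hsub : ({s, s', x, y} : Set V) ⊆ S := by
      rintro z (rfl | rfl | rfl | rfl)
      exacts [hS.left_mem, hS.right_mem, hx.1, hy.1]
    have hne : ∀ z ∈ C₁, z ≠ x ∧ z ≠ y := fun z hz => by
      have := hτC z hz
      have := hx.2
      have := hy.2
      constructor <;> rintro rfl <;> omega
    have hxy : x ≠ y := by rintro rfl; have := hx.2; have := hy.2; omega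
    have : ({s, s', x, y} : Set V).ncard = 4 := by
      rw [Set.ncard_insert_of_notMem (by simp [hss', hne s hs]) (Set.toFinite _),
        Set.ncard_insert_of_notMem (by simp [hne s' hs']) (Set.toFinite _), Set.ncard_pair hxy]
    rw [← this]
    exact Set.ncard_le_ncard hsub (Set.toFinite _)
  · exfalso
    push Not at hC1
    have hCs : ∀ v ∈ C₁, v = s := fun v hv => (hC1 v hv).symm
    have d1 : Disjoint (A₁ ∪ B₁) C₁ := Set.disjoint_left.2 fun v hv hv' => by
      have := h.disj' v; grind
    have d2 : Disjoint A₁ B₁ := Set.disjoint_left.2 fun v hv hv' => by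
      have := h.disj' v; grind
    have hC1' : C₁.ncard ≤ 1 := (Set.ncard_le_one_iff (Set.toFinite _)).2
      fun {x y} hx hy => (hCs x hx).trans (hCs y hy).symm
    rw [Set.ncard_union_eq d1, Set.ncard_union_eq d2] at hcard
    by_cases hA : 1 < A₁.ncard
    · obtain ⟨a', ha', haa'⟩ := Set.exists_ne_of_one_lt_ncard hA a
      refine h.no_single_attachment hF hT ha ha' haa'.symm (s := s) (k := b) (Or.inr hs) ?_
        hab.symm ?_ ⟨a', ha', ?_⟩
      · have := h.disj' b; grind
      · intro v hv hvs w hw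
        exact (hAB w hw v (hv.resolve_right fun h => hvs (hCs v h))).symm
      · intro hsa'
        have := h.disj' a'
        exact (hsN a' haa' (by grind) (by grind)).not_adj (Or.inr hsa')
    · obtain ⟨b', hb', hbb'⟩ := Set.exists_ne_of_one_lt_ncard (by omega : 1 < B₁.ncard) b
      refine h.swap.no_single_attachment hF hT hb hb' hbb'.symm (s := s) (k := a) (Or.inr hs) ?_
        hab ?_ ⟨b', hb', ?_⟩
      · have := h.disj' a; grind
      · intro v hv hvs w hw
        exact hAB v (hv.resolve_right fun h => hvs (hCs v h)) w hw
      · intro hsa'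
        have := h.disj' b'
        exact (hsN b' (by grind) hbb' (by grind)).not_adj (Or.inr hsa')

/-- Every minimal side of a `2`-join is found by one of the three kinds of seeds. -/
theorem IsTwoJoinSplit.exists_seed (hF : T.InF) (hT : ¬ T.HasBalancedSkewPartition)
    (h : T.IsTwoJoinSplit A₁ B₁ C₁ A₂ B₂ C₂)
    (hmin : ∀ Y, Y ⊂ A₁ ∪ B₁ ∪ C₁ → ¬ T.IsProperTwoJoinSide Y) :
    (∃ c u v, ∀ S, T.IsClosure (T.typePair c) true u v S →
      T.JoinValid (T.typePair c) S ∧ S = A₁ ∪ B₁ ∪ C₁) ∨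
    (∃ a b s, ∀ S, T.IsClosure (T.typeJoin a b) true s s S →
      T.JoinValid (T.typeJoin a b) S ∧ S = A₁ ∪ B₁ ∪ C₁) ∨
    (∃ a s s', ∀ S, T.IsClosure (T.typeLink a) true s s' S →
      T.JoinValid (T.typeLink a) S ∧ S = A₁ ∪ B₁ ∪ C₁) := by
  rcases C₁.eq_empty_or_nonempty with hC | hC
  · refine Or.inl ?_
    by_cases hA : 1 < A₁.ncard
    · exact h.exists_pair_seed hF hT hmin hC hA
    · have hcard := h.four_le hF hT
      have h1 := Set.ncard_union_le A₁ B₁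
      rw [hC, Set.union_empty] at hcard
      have e : B₁ ∪ A₁ ∪ C₁ = A₁ ∪ B₁ ∪ C₁ := by rw [Set.union_comm B₁]
      rw [← e] at hmin ⊢
      exact h.swap.exists_pair_seed hF hT hmin hC (by omega)
  · obtain ⟨-, -, ⟨a₂, ha₂⟩, ⟨b₂, hb₂⟩⟩ := h.nonempty
    obtain ⟨hτA, hτB, hτC⟩ := typeJoin_of_split h ha₂ hb₂
    have hcl := h.closedUnder hτA hτB hτC
    refine Or.inr ?_
    by_cases hgood : ∃ s ∈ C₁, ∀ S, T.IsClosure (T.typeJoin a₂ b₂) true s s S → 4 ≤ S.ncard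
    · obtain ⟨s, hs, hS4⟩ := hgood
      refine Or.inl ⟨a₂, b₂, s, fun S hS => ?_⟩
      have hSX := hS.least _ (Or.inr hs) (Or.inr hs) hcl
      obtain ⟨h1, h2⟩ := h.part_nonempty hF hT (T.typeJoin_eq a₂ b₂) hτA hτB hτC hSX hS.closed
        hS.left_mem hs
      exact h.joinValid hF hT (T.typeJoin_eq a₂ b₂) hmin hτA hτB hτC hSX hS.closed h1 h2 (hS4 S hS)
    · refine Or.inr (h.exists_link_seed hF hT hmin hC fun s hs => ?_)
      push Not at hgood
      obtain ⟨S, hS, hS3⟩ := hgood s hs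
      have hSX := hS.least _ (Or.inr hs) (Or.inr hs) hcl
      obtain ⟨⟨a, ha⟩, ⟨b, hb⟩⟩ := h.part_nonempty hF hT (T.typeJoin_eq a₂ b₂) hτA hτB hτC hSX
        hS.closed hS.left_mem hs
      obtain ⟨hpA, hpB⟩ := part_subset_of_split hτA hτB hτC hSX
      refine ⟨a, hpA ha, b, hpB hb, fun v hva hvb hvs => ?_⟩
      refine (hS.closed.anti (fun hv => ?_) s ⟨hS.left_mem, hτC s hs⟩)
      have hsub : ({v, a, b, s} : Set V) ⊆ S := by
        rintro z (rfl | rfl | rfl | rfl)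
        exacts [hv, ha.1, hb.1, hS.left_mem]
      have e1 : a ≠ b := by rintro rfl; have := ha.2; have := hb.2; omega
      have e2 : a ≠ s := by rintro rfl; have := ha.2; have := hτC a hs; omega
      have e3 : b ≠ s := by rintro rfl; have := hb.2; have := hτC b hs; omega
      have h4 : ({v, a, b, s} : Set V).ncard = 4 := by
        rw [Set.ncard_insert_of_notMem (by simp [hva, hvb, hvs]) (Set.toFinite _),
          Set.ncard_insert_of_notMem (by simp [e1, e2]) (Set.toFinite _), Set.ncard_pair e3]
      have := Set.ncard_le_ncard hsub (Set.toFinite _)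
      omega

end JoinSeedsExist

end Trigraph

namespace RAM

/-- Programs whose only loops are counting loops: `range x k c` runs `c` for `x` from `0` to
`n + k - 1`, where `n` is the value of the variable `0`. -/
inductive Prog
  | assign (x : ℕ) (e : Expr)
  | store (a : ℕ) (e f : Expr)
  | seq (c d : Prog)
  | ite (e : Expr) (c d : Prog)
  | skip
  | range (x k : ℕ) (c : Prog)

def State.setVar (s : State) (x v : ℕ) : State := ⟨Function.update s.var x v, s.arr⟩

def State.setArr (s : State) (a i v : ℕ) : State :=
  ⟨s.var, Function.update s.arr a (Function.update (s.arr a) i v)⟩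

@[simp] theorem State.setVar_arr (s : State) (x v : ℕ) : (s.setVar x v).arr = s.arr := rfl

@[simp] theorem State.setArr_var (s : State) (a i v : ℕ) : (s.setArr a i v).var = s.var := rfl

@[simp] theorem State.setVar_var_self (s : State) (x v : ℕ) : (s.setVar x v).var x = v := by
  simp [setVar]

theorem State.setVar_var_of_ne (s : State) {x y : ℕ} (h : y ≠ x) (v : ℕ) :
    (s.setVar x v).var y = s.var y := by
  simp [setVar, h]

theorem State.setArr_arr_of_ne (s : State) {a b : ℕ} (h : b ≠ a) (i v : ℕ) :
    (s.setArr a i v).arr b = s.arr b := by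
  simp [setArr, h]

@[simp] theorem State.setArr_arr_self (s : State) (a i v : ℕ) :
    (s.setArr a i v).arr a = Function.update (s.arr a) i v := by
  simp [setArr]

namespace Prog

/-- The loop body followed by the increment of the counter. -/
def step (f : State → State) (x : ℕ) (s : State) : State :=
  (f s).setVar x ((f s).var x + 1)

def run (n : ℕ) : Prog → State → State
  | assign x e => fun s => s.setVar x (e.eval s)
  | store a e f => fun s => s.setArr a (e.eval s) (f.eval s)
  | seq c d => fun s => d.run n (c.run n s)
  | ite e c d => fun s => if e.eval s ≠ 0 then c.run n s else d.run n s
  | skip => fun s => s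
  | range x k c => fun s => (step (c.run n) x)^[n + k] (s.setVar x 0)

def compile : Prog → Cmd
  | assign x e => .assign x e
  | store a e f => .store a e f
  | seq c d => .seq c.compile d.compile
  | ite e c d => .ite e c.compile d.compile
  | skip => .skip
  | range x k c => .seq (.assign x (.lit 0))
      (.loop (.op .lt (.var x) (.op .add (.var 0) (.lit k)))
        (.seq c.compile (.assign x (.op .add (.var x) (.lit 1)))))

def writesVar (y : ℕ) : Prog → Bool
  | assign x _ => x == y
  | store _ _ _ => false
  | seq c d => c.writesVar y || d.writesVar y
  | ite _ c d => c.writesVar y || d.writesVar y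
  | skip => false
  | range x _ c => x == y || c.writesVar y

def writesArr (b : ℕ) : Prog → Bool
  | assign _ _ => false
  | store a _ _ => a == b
  | seq c d => c.writesArr b || d.writesArr b
  | ite _ c d => c.writesArr b || d.writesArr b
  | skip => false
  | range _ _ c => c.writesArr b

theorem run_var (n : ℕ) (c : Prog) {y : ℕ} (h : c.writesVar y = false) (s : State) :
    (c.run n s).var y = s.var y := by
  induction c generalizing s with
  | assign x e =>
    simp only [writesVar, beq_eq_false_iff_ne] at h
    exact s.setVar_var_of_ne h.symm _
  | store a e f => rfl
  | seq c d ihc ihd =>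
    simp only [writesVar, Bool.or_eq_false_iff] at h
    exact (ihd h.2 _).trans (ihc h.1 s)
  | ite e c d ihc ihd =>
    simp only [writesVar, Bool.or_eq_false_iff] at h
    simp only [run]
    split_ifs
    · exact ihc h.1 s
    · exact ihd h.2 s
  | skip => rfl
  | range x k c ih =>
    simp only [writesVar, Bool.or_eq_false_iff, beq_eq_false_iff_ne] at h
    simp only [run]
    have : ∀ m s, ((step (c.run n) x)^[m] s).var y = s.var y := by
      intro m
      induction m with
      | zero => intro s; rfl
      | succ m ihm =>
        intro s
        rw [Function.iterate_succ_apply, ihm, step, State.setVar_var_of_ne _ (Ne.symm h.1), ih h.2]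
    rw [this, State.setVar_var_of_ne _ (Ne.symm h.1)]

theorem run_arr (n : ℕ) (c : Prog) {b : ℕ} (h : c.writesArr b = false) (s : State) :
    (c.run n s).arr b = s.arr b := by
  induction c generalizing s with
  | assign x e => rfl
  | store a e f =>
    simp only [writesArr, beq_eq_false_iff_ne] at h
    exact s.setArr_arr_of_ne h.symm _ _
  | seq c d ihc ihd =>
    simp only [writesArr, Bool.or_eq_false_iff] at h
    exact (ihd h.2 _).trans (ihc h.1 s)
  | ite e c d ihc ihd =>
    simp only [writesArr, Bool.or_eq_false_iff] at h
    simp only [run]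
    split_ifs
    · exact ihc h.1 s
    · exact ihd h.2 s
  | skip => rfl
  | range x k c ih =>
    simp only [writesArr] at h
    simp only [run]
    have : ∀ m s, ((step (c.run n) x)^[m] s).arr b = s.arr b := by
      intro m
      induction m with
      | zero => intro s; rfl
      | succ m ihm =>
        intro s
        rw [Function.iterate_succ_apply, ihm, step, State.setVar_arr, ih h]
    rw [this, State.setVar_arr]

end Prog

namespace Expr

/-- All literals are at most `10`. -/
def lits : Expr → Bool
  | lit k => decide (k ≤ 10)
  | var _ => true
  | get _ e => e.lits
  | op _ e f => e.lits && f.lits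

/-- The value is at most the largest number in memory, or `10`. -/
def small : Expr → Bool
  | lit _ => true
  | var _ => true
  | get _ _ => true
  | op .sub e _ => e.small
  | op .lt _ _ => true
  | op .eq _ _ => true
  | op .add _ _ => false
  | op .mul _ _ => false

end Expr

/-- All numbers in memory are at most `n + 10`. -/
structure State.Small (n : ℕ) (s : State) : Prop where
  zero : s.var 0 = n
  var : ∀ x, s.var x ≤ n + 10
  arr : ∀ a i, s.arr a i ≤ n + 10

theorem State.Small.setVar {n : ℕ} {s : State} (h : s.Small n) {x v : ℕ} (hx : x ≠ 0)
    (hv : v ≤ n + 10) : (s.setVar x v).Small n := by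
  refine ⟨by rw [s.setVar_var_of_ne hx.symm]; exact h.zero, fun y => ?_, h.arr⟩
  by_cases hy : y = x
  · subst hy; simpa using hv
  · rw [s.setVar_var_of_ne hy]; exact h.var y

theorem State.Small.setArr {n : ℕ} {s : State} (h : s.Small n) {a i v : ℕ}
    (hv : v ≤ n + 10) : (s.setArr a i v).Small n := by
  refine ⟨h.zero, h.var, fun b j => ?_⟩
  by_cases hb : b = a
  · subst hb
    rw [s.setArr_arr_self]
    by_cases hj : j = i
    · subst hj; simpa using hv
    · rw [Function.update_of_ne hj]; exact h.arr _ _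
  · rw [s.setArr_arr_of_ne hb]; exact h.arr _ _

namespace Expr

theorem cost_pos (e : Expr) : 1 ≤ e.cost := by
  cases e <;> simp [cost]

theorem eval_le_of_small {n : ℕ} {s : State} (hs : s.Small n) {e : Expr} (hl : e.lits = true)
    (hsm : e.small = true) : e.eval s ≤ n + 10 := by
  induction e with
  | lit k => simp only [lits, decide_eq_true_eq] at hl; simp only [eval]; omega
  | var x => exact hs.var x
  | get a e => exact hs.arr _ _
  | op o e f ihe ihf =>
    simp only [lits, Bool.and_eq_true] at hl
    cases o with
    | add => simp [small] at hsm
    | mul => simp [small] at hsm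
    | sub => exact (Nat.sub_le _ _).trans (ihe hl.1 hsm)
    | lt => simp only [eval, Op.apply]; split_ifs <;> omega
    | eq => simp only [eval, Op.apply]; split_ifs <;> omega

theorem eval_le {n : ℕ} {s : State} (hs : s.Small n) {e : Expr} (hl : e.lits = true) :
    e.eval s ≤ (n + 10) ^ e.cost := by
  have one : ∀ e : Expr, n + 10 ≤ (n + 10) ^ e.cost := fun e =>
    Nat.le_self_pow (by have := e.cost_pos; omega) _
  induction e with
  | lit k => simp only [lits, decide_eq_true_eq] at hl; simp only [eval, cost, pow_one]; omega
  | var x => simpa [cost, eval] using hs.var x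
  | get a e => exact (hs.arr _ _).trans (one _)
  | op o e f ihe ihf =>
    simp only [lits, Bool.and_eq_true] at hl
    have h1 := ihe hl.1
    have h2 := ihf hl.2
    have h3 : (n + 10) ^ e.cost * (n + 10) ^ f.cost ≤ (n + 10) ^ (op o e f).cost := by
      rw [← pow_add]
      exact Nat.pow_le_pow_right (by omega) (by simp only [cost]; omega)
    have h4 : (n + 10) ^ e.cost + (n + 10) ^ f.cost ≤ (n + 10) ^ e.cost * (n + 10) ^ f.cost :=
      Nat.add_le_mul ((by omega : 2 ≤ n + 10).trans (one e)) ((by omega : 2 ≤ n + 10).trans (one f))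
    have h5 := one (op o e f)
    cases o with
    | add => simp only [eval, Op.apply]; omega
    | mul => exact (Nat.mul_le_mul h1 h2).trans h3
    | sub => simp only [eval, Op.apply]; omega
    | lt => simp only [eval, Op.apply]; split_ifs <;> omega
    | eq => simp only [eval, Op.apply]; split_ifs <;> omega

theorem fits {n W : ℕ} {s : State} (hs : s.Small n) {e : Expr} (hl : e.lits = true)
    (hW : (n + 10) ^ e.cost < W) : e.Fits W s := by
  have hmono : ∀ {a b : ℕ}, a ≤ b → (n + 10) ^ a ≤ (n + 10) ^ b := fun h =>
    Nat.pow_le_pow_right (by omega) h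
  induction e with
  | lit k => exact (eval_le hs hl).trans_lt hW
  | var x => exact (eval_le (e := var x) hs hl).trans_lt hW
  | get a e ih =>
    refine ⟨ih hl ((hmono ?_).trans_lt hW), (eval_le (e := get a e) hs hl).trans_lt hW⟩
    simp [cost]
  | op o e f ihe ihf =>
    have hl' := hl
    simp only [lits, Bool.and_eq_true] at hl
    refine ⟨ihe hl.1 ((hmono ?_).trans_lt hW), ihf hl.2 ((hmono ?_).trans_lt hW),
      (eval_le (e := op o e f) hs hl').trans_lt hW⟩ <;> simp only [cost] <;> omega

end Expr

namespace Prog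

def ok : Prog → Bool
  | assign x e => x != 0 && e.lits && e.small
  | store _ e f => e.lits && f.lits && f.small
  | seq c d => c.ok && d.ok
  | ite e c d => e.lits && c.ok && d.ok
  | skip => true
  | range x k c => x != 0 && decide (k ≤ 10) && !c.writesVar x && c.ok

/-- An upper bound for the costs of the expressions in the program. -/
def size : Prog → ℕ
  | assign _ e => e.cost
  | store _ e f => e.cost + f.cost
  | seq c d => c.size + d.size
  | ite e c d => e.cost + c.size + d.size
  | skip => 1
  | range _ _ c => 10 + c.size

/-- An upper bound for the running time. -/
def time (n : ℕ) : Prog → ℕ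
  | assign _ e => e.cost + 1
  | store _ e f => e.cost + f.cost + 1
  | seq c d => c.time n + d.time n
  | ite e c d => e.cost + 1 + c.time n + d.time n
  | skip => 1
  | range _ k c => 8 + (n + k) * (10 + c.time n)

/-- The nesting depth of the loops. -/
def depth : Prog → ℕ
  | assign _ _ => 0
  | store _ _ _ => 0
  | seq c d => max c.depth d.depth
  | ite _ c d => max c.depth d.depth
  | skip => 0
  | range _ _ c => c.depth + 1

def coef : Prog → ℕ
  | assign _ e => e.cost + 1
  | store _ e f => e.cost + f.cost + 1
  | seq c d => c.coef + d.coef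
  | ite e c d => e.cost + 1 + c.coef + d.coef
  | skip => 1
  | range _ k c => 8 + (k + 1) * (10 + c.coef)

theorem time_le (n : ℕ) (c : Prog) {m : ℕ} (hm : c.depth ≤ m) :
    c.time n ≤ c.coef * (n + 1) ^ m := by
  have hpos : ∀ m, 1 ≤ (n + 1) ^ m := fun m => Nat.one_le_pow _ _ (by omega)
  have hmul : ∀ k m, k ≤ k * (n + 1) ^ m := fun k m => Nat.le_mul_of_pos_right _ (hpos m)
  induction c generalizing m with
  | assign x e => exact hmul _ _
  | store a e f => exact hmul _ _
  | skip => exact hmul _ _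
  | seq c d ihc ihd =>
    simp only [depth, sup_le_iff] at hm
    simp only [time, coef, add_mul]
    exact add_le_add (ihc hm.1) (ihd hm.2)
  | ite e c d ihc ihd =>
    simp only [depth, sup_le_iff] at hm
    have := hmul (e.cost + 1) m
    simp only [time, coef, add_mul] at this ⊢
    have := ihc hm.1
    have := ihd hm.2
    omega
  | range x k c ih =>
    simp only [depth] at hm
    obtain ⟨m, rfl⟩ : ∃ m', m = m' + 1 := ⟨m - 1, by omega⟩
    have h1 := ih (m := m) (by omega)
    have h2 : n + k ≤ (k + 1) * (n + 1) := by nlinarith [Nat.zero_le (n * k)]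
    have h3 : 10 + c.time n ≤ (10 + c.coef) * (n + 1) ^ m := by
      have := hmul 10 m
      rw [add_mul]
      omega
    calc 8 + (n + k) * (10 + c.time n)
        ≤ 8 * (n + 1) ^ (m + 1) + (k + 1) * (n + 1) * ((10 + c.coef) * (n + 1) ^ m) :=
          add_le_add (hmul _ _) (Nat.mul_le_mul h2 h3)
      _ = (8 + (k + 1) * (10 + c.coef)) * (n + 1) ^ (m + 1) := by ring

theorem runs {n W : ℕ} (c : Prog) (hok : c.ok = true) (hW : (n + 10) ^ c.size < W) {s : State}
    (hs : s.Small n) :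
    (c.run n s).Small n ∧ ∃ t ≤ c.time n, c.compile.Runs W s t (c.run n s) := by
  have hmono : ∀ {a b : ℕ}, a ≤ b → (n + 10) ^ a ≤ (n + 10) ^ b := fun h =>
    Nat.pow_le_pow_right (by omega) h
  induction c generalizing s with
  | assign x e =>
    simp only [ok, Bool.and_eq_true, bne_iff_ne] at hok
    exact ⟨hs.setVar hok.1.1 (Expr.eval_le_of_small hs hok.1.2 hok.2),
      _, le_rfl, .assign x e s (Expr.fits hs hok.1.2 hW)⟩
  | store a e f =>
    simp only [ok, Bool.and_eq_true] at hok
    refine ⟨hs.setArr (Expr.eval_le_of_small hs hok.1.2 hok.2), _, le_rfl,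
      .store a e f s (Expr.fits hs hok.1.1 ((hmono ?_).trans_lt hW))
        (Expr.fits hs hok.1.2 ((hmono ?_).trans_lt hW))⟩ <;> simp [size]
  | skip => exact ⟨hs, 1, le_rfl, .skip s⟩
  | seq c d ihc ihd =>
    simp only [ok, Bool.and_eq_true] at hok
    obtain ⟨h1, t1, ht1, hr1⟩ := ihc hok.1 ((hmono (by simp [size])).trans_lt hW) hs
    obtain ⟨h2, t2, ht2, hr2⟩ := ihd hok.2 ((hmono (by simp [size])).trans_lt hW) h1
    exact ⟨h2, t1 + t2, add_le_add ht1 ht2, .seq hr1 hr2⟩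
  | ite e c d ihc ihd =>
    simp only [ok, Bool.and_eq_true] at hok
    have hfit := Expr.fits hs hok.1.1 ((hmono (by simp only [size]; omega)).trans_lt hW)
    simp only [run]
    split_ifs with he
    · obtain ⟨h1, t1, ht1, hr1⟩ := ihc hok.1.2 ((hmono (by simp only [size]; omega)).trans_lt hW) hs
      exact ⟨h1, _, by simp only [time]; omega, .iteTrue hfit he hr1⟩
    · obtain ⟨h1, t1, ht1, hr1⟩ := ihd hok.2 ((hmono (by simp only [size]; omega)).trans_lt hW) hs
      exact ⟨h1, _, by simp only [time]; omega, .iteFalse hfit (not_not.1 he) hr1⟩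
  | range x k c ih =>
    simp only [ok, Bool.and_eq_true, bne_iff_ne, decide_eq_true_eq, Bool.not_eq_true'] at hok
    obtain ⟨⟨⟨hx, hk⟩, hxc⟩, hc⟩ := hok
    have hW10 : ∀ {b}, b ≤ 10 → (n + 10) ^ b < W := fun hb =>
      (hmono (by simp only [size]; omega)).trans_lt hW
    have key : ∀ r s, s.Small n → s.var x + r = n + k →
        ((step (c.run n) x)^[r] s).Small n ∧ ∃ t ≤ r * (10 + c.time n) + 6,
          Cmd.Runs W (.loop (.op .lt (.var x) (.op .add (.var 0) (.lit k)))
            (.seq c.compile (.assign x (.op .add (.var x) (.lit 1))))) s t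
            ((step (c.run n) x)^[r] s) := by
      intro r
      induction r with
      | zero =>
        intro s hs hr
        refine ⟨hs, 6, by omega, ?_⟩
        refine Cmd.Runs.loopDone (Expr.fits hs (by simpa [Expr.lits] using hk) (hW10 ?_)) ?_
        · simp [Expr.cost]
        · simp only [Expr.eval, Op.apply, hs.zero]
          rw [if_neg]
          omega
      | succ r ihr =>
        intro s hs hr
        obtain ⟨h1, t1, ht1, hr1⟩ := ih hc ((hmono (by simp [size])).trans_lt hW) hs
        have hvx : (c.run n s).var x = s.var x := run_var n c hxc s
        have h2 : (step (c.run n) x s).Small n := h1.setVar hx (by rw [hvx]; omega)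
        obtain ⟨h3, t3, ht3, hr3⟩ := ihr (step (c.run n) x s) h2 (by
          rw [step, State.setVar_var_self, hvx]; omega)
        rw [Function.iterate_succ_apply]
        refine ⟨h3, _, ?_, Cmd.Runs.loopStep (Expr.fits hs (by simpa [Expr.lits] using hk)
          (hW10 ?_)) ?_ (Cmd.Runs.seq hr1 (Cmd.Runs.assign x _ _ (Expr.fits h1 ?_ (hW10 ?_)))) hr3⟩
        · simp only [Expr.cost]
          rw [add_mul]
          omega
        · simp [Expr.cost]
        · simp only [Expr.eval, Op.apply, hs.zero]
          rw [if_pos (by omega)]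
          omega
        · simp [Expr.lits]
        · simp [Expr.cost]
    have hs0 : (s.setVar x 0).Small n := hs.setVar hx (by omega)
    obtain ⟨h1, t, ht, hr⟩ := key (n + k) (s.setVar x 0) hs0 (by simp)
    refine ⟨h1, 2 + t, by simp only [time]; omega, ?_⟩
    exact Cmd.Runs.seq (Cmd.Runs.assign x (.lit 0) s
      (Expr.fits hs (by simp [Expr.lits]) (hW10 (by simp [Expr.cost])))) hr

/-- The invariant rule for counting loops. -/
theorem range_invariant {n : ℕ} {x k : ℕ} {c : Prog} (I : ℕ → State → Prop) {s : State}
    (hx : c.writesVar x = false) (h0 : I 0 (s.setVar x 0))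
    (hstep : ∀ j t, j < n + k → t.var x = j → I j t → I (j + 1) ((c.run n t).setVar x (j + 1))) :
    I (n + k) ((range x k c).run n s) ∧ ((range x k c).run n s).var x = n + k := by
  have key : ∀ m ≤ n + k, I m ((step (c.run n) x)^[m] (s.setVar x 0)) ∧
      ((step (c.run n) x)^[m] (s.setVar x 0)).var x = m := by
    intro m
    induction m with
    | zero => exact fun _ => ⟨h0, by simp⟩
    | succ m ih =>
      intro hm
      obtain ⟨h1, h2⟩ := ih (by omega)
      rw [Function.iterate_succ_apply']
      have h3 := hstep m _ (by omega) h2 h1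
      have h4 := run_var n c hx ((step (c.run n) x)^[m] (s.setVar x 0))
      rw [step, h4, h2]
      exact ⟨h3, by simp⟩
  exact key (n + k) le_rfl

end Prog

end RAM

namespace RAM

namespace Expr

/-- The expression, read as a condition, is true. -/
def Holds (s : State) (e : Expr) : Prop := e.eval s ≠ 0

def and (e f : Expr) : Expr := op .mul e f

def or (e f : Expr) : Expr := op .add e f

def not (e : Expr) : Expr := op .sub (lit 1) e

/-- The truth value of a condition, as a number `0` or `1`. -/
def truth (e : Expr) : Expr := not (not e)

def isEq (e f : Expr) : Expr := op .eq e f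

def isLt (e f : Expr) : Expr := op .lt e f

@[simp] theorem holds_and {s : State} {e f : Expr} : (and e f).Holds s ↔ e.Holds s ∧ f.Holds s := by
  simp [Holds, and, eval, Op.apply]

@[simp] theorem holds_or {s : State} {e f : Expr} : (or e f).Holds s ↔ e.Holds s ∨ f.Holds s := by
  simp only [Holds, or, eval, Op.apply]
  omega

@[simp] theorem holds_not {s : State} {e : Expr} : (not e).Holds s ↔ ¬ e.Holds s := by
  simp only [Holds, not, eval, Op.apply]
  omega

@[simp] theorem holds_truth {s : State} {e : Expr} : (truth e).Holds s ↔ e.Holds s := by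
  simp [truth]

@[simp] theorem holds_isEq {s : State} {e f : Expr} :
    (isEq e f).Holds s ↔ e.eval s = f.eval s := by
  simp [Holds, isEq, eval, Op.apply]

@[simp] theorem holds_isLt {s : State} {e f : Expr} :
    (isLt e f).Holds s ↔ e.eval s < f.eval s := by
  simp [Holds, isLt, eval, Op.apply]

def readsVar (y : ℕ) : Expr → Bool
  | lit _ => false
  | var x => x == y
  | get _ e => e.readsVar y
  | op _ e f => e.readsVar y || f.readsVar y

/-- The array `a` is read at the index given by the variable `x` only. -/
def readsOnly (a x : ℕ) : Expr → Bool
  | lit _ => true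
  | var _ => true
  | get b (var y) => b != a || y == x
  | get b e => b != a && e.readsOnly a x
  | op _ e f => e.readsOnly a x && f.readsOnly a x

theorem eval_setVar {y : ℕ} {e : Expr} (h : e.readsVar y = false) (s : State) (v : ℕ) :
    e.eval (s.setVar y v) = e.eval s := by
  induction e with
  | lit k => rfl
  | var x =>
    simp only [readsVar, beq_eq_false_iff_ne] at h
    exact s.setVar_var_of_ne h v
  | get a e ih => simp only [eval, ih h, State.setVar_arr]
  | op o e f ihe ihf =>
    simp only [readsVar, Bool.or_eq_false_iff] at h
    simp only [eval, ihe h.1, ihf h.2]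

theorem eval_eq_of_readsOnly {a x : ℕ} {e : Expr} (h : e.readsOnly a x = true) {s t : State}
    (hvar : s.var = t.var) (harr : ∀ b, b ≠ a → s.arr b = t.arr b)
    (ha : s.arr a (s.var x) = t.arr a (s.var x)) : e.eval s = e.eval t := by
  induction e with
  | lit k => rfl
  | var y => simp only [eval, hvar]
  | get b e ih =>
    by_cases hb : b = a
    · subst hb
      cases e with
      | var y =>
        simp only [readsOnly, bne_self_eq_false, Bool.false_or, beq_iff_eq] at h
        subst h
        simp only [eval, ← hvar]
        exact ha
      | lit k => simp [readsOnly] at h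
      | get c f => simp [readsOnly] at h
      | op o f g => simp [readsOnly] at h
    · have he : e.eval s = e.eval t := by
        cases e with
        | var y => simp only [eval, hvar]
        | lit k => rfl
        | get c f =>
          refine ih ?_
          rw [readsOnly] at h
          · simp only [Bool.and_eq_true] at h; exact h.2
          · simp
        | op o f g =>
          refine ih ?_
          rw [readsOnly] at h
          · simp only [Bool.and_eq_true] at h; exact h.2
          · simp
      simp only [eval, he, harr b hb]
  | op o e f ihe ihf =>
    simp only [readsOnly, Bool.and_eq_true] at h
    simp only [eval, ihe h.1, ihf h.2]

end Expr

def State.setRow (s : State) (a : ℕ) (f : ℕ → ℕ) : State := ⟨s.var, Function.update s.arr a f⟩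

@[simp] theorem State.setRow_var (s : State) (a : ℕ) (f : ℕ → ℕ) : (s.setRow a f).var = s.var := rfl

@[simp] theorem State.setRow_arr_self (s : State) (a : ℕ) (f : ℕ → ℕ) :
    (s.setRow a f).arr a = f := by
  simp [setRow]

theorem State.setRow_arr_of_ne (s : State) {a b : ℕ} (h : b ≠ a) (f : ℕ → ℕ) :
    (s.setRow a f).arr b = s.arr b := by
  simp [setRow, h]

theorem State.setVar_comm (s : State) {x y : ℕ} (h : x ≠ y) (v w : ℕ) :
    (s.setVar x v).setVar y w = (s.setVar y w).setVar x v := by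
  simp only [setVar]
  rw [Function.update_comm h]

@[simp] theorem State.setVar_setVar (s : State) (x v w : ℕ) :
    (s.setVar x v).setVar x w = s.setVar x w := by
  simp [setVar]

theorem State.setVar_eq_self {s : State} {x v : ℕ} (h : s.var x = v) : s.setVar x v = s := by
  simp [setVar, ← h]

namespace Prog

/-- Sets the variable `c` to the number of values of `x` below `n` for which `e` holds. -/
def count (c x : ℕ) (e : Expr) : Prog :=
  seq (assign c (.lit 0)) (range x 0 (ite e
    (assign c (.op .sub (.var 0) (.op .sub (.var 0) (.op .add (.var c) (.lit 1))))) skip))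

open Classical in
theorem run_count {n c x : ℕ} {e : Expr} {s : State} (hn : s.var 0 = n) (hc : c ≠ 0) (hx : x ≠ 0)
    (hcx : c ≠ x) (he : e.readsVar c = false) : (count c x e).run n s =
      (s.setVar c ((Finset.range n).filter fun j => e.Holds (s.setVar x j)).card).setVar x n := by
  set K : ℕ → ℕ := fun j => ((Finset.range j).filter fun j => e.Holds (s.setVar x j)).card with hK
  have hKle : ∀ j, K j ≤ j := fun j => (Finset.card_filter_le _ _).trans (by simp)
  refine (range_invariant (n := n) (x := x) (k := 0)
    (fun j t => t = (s.setVar c (K j)).setVar x j) (s := s.setVar c 0) ?_ ?_ ?_).1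
  · simp [writesVar, hcx]
  · simp [hK]
  · rintro j t hj - rfl
    have h0 : ∀ v w, ((s.setVar c v).setVar x w).var 0 = n := fun v w => by
      rw [State.setVar_var_of_ne _ hx.symm, State.setVar_var_of_ne _ hc.symm, hn]
    have h1 : e.eval ((s.setVar c (K j)).setVar x j) = e.eval (s.setVar x j) := by
      rw [State.setVar_comm _ hcx, Expr.eval_setVar he]
    have h2 : K (j + 1) = if e.Holds (s.setVar x j) then K j + 1 else K j := by
      simp only [hK, Finset.range_add_one, Finset.filter_insert]
      split_ifs
      · rw [Finset.card_insert_of_notMem (by simp)]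
      · rfl
    simp only [run, h1]
    have := hKle j
    rw [h2]
    by_cases h3 : e.Holds (s.setVar x j)
    · rw [if_pos h3, if_pos (show e.eval (s.setVar x j) ≠ 0 from h3)]
      simp only [Expr.eval, Op.apply, h0]
      rw [State.setVar_var_of_ne _ hcx, State.setVar_var_self, State.setVar_comm _ hcx.symm,
        State.setVar_setVar, State.setVar_setVar, Nat.sub_sub_self (by omega)]
    · rw [if_neg h3, if_neg (show ¬ e.eval (s.setVar x j) ≠ 0 from h3), State.setVar_setVar]

/-- Stores the values of `e`, for `x` below `n`, into the array `a`. -/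
def fill (a x : ℕ) (e : Expr) : Prog := range x 0 (store a (.var x) e)

theorem run_fill {n a x : ℕ} {e : Expr} {s : State} (he : e.readsOnly a x = true) :
    (fill a x e).run n s =
      (s.setRow a fun j => if j < n then e.eval (s.setVar x j) else s.arr a j).setVar x n := by
  refine (range_invariant (n := n) (x := x) (k := 0)
    (fun j t => t = (s.setRow a fun i => if i < j then e.eval (s.setVar x i) else s.arr a i).setVar
      x j) (s := s) rfl ?_ ?_).1
  · simp only [Nat.not_lt_zero, if_false]
    simp [State.setRow]
  · rintro j t hj - rfl
    simp only [run, Expr.eval, State.setVar_var_self]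
    have h1 : e.eval ((s.setRow a fun i => if i < j then e.eval (s.setVar x i) else s.arr a i).setVar
        x j) = e.eval (s.setVar x j) := by
      refine Expr.eval_eq_of_readsOnly he rfl (fun b hb => ?_) ?_
      · simp [State.setRow, hb]
      · simp
    rw [h1]
    · simp only [State.setVar, State.setArr, State.setRow, Function.update_idem,
        Function.update_self, State.mk.injEq, true_and]
      congr 1
      funext i
      by_cases hi : i = j
      · subst hi; simp
      · rw [Function.update_of_ne hi]
        have : i < j ↔ i < j + 1 := by omega
        simp only [this]

/-- Sets `g` to a value of `x` below `n` for which `e` holds, if there is one. -/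
def find (g x : ℕ) (e : Expr) : Prog := range x 0 (ite e (assign g (.var x)) skip)

theorem run_find {n g x : ℕ} {e : Expr} {s : State} (hgx : g ≠ x) (he : e.readsVar g = false)
    (hex : ∃ j < n, e.Holds (s.setVar x j)) : ∃ v < n, e.Holds (s.setVar x v) ∧
      (find g x e).run n s = (s.setVar g v).setVar x n := by
  obtain ⟨⟨v, h1, h2⟩, -⟩ := range_invariant (n := n) (x := x) (k := 0)
    (c := ite e (assign g (.var x)) skip)
    (fun j t => ∃ v, t = (s.setVar g v).setVar x j ∧ ((∃ i < j, e.Holds (s.setVar x i)) →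
      v < n ∧ e.Holds (s.setVar x v))) (s := s) (by simp [writesVar, hgx])
    ⟨s.var g, by rw [State.setVar_eq_self rfl], by simp⟩ (by
      rintro j t hj - ⟨v, rfl, hv⟩
      have h1 : e.eval ((s.setVar g v).setVar x j) = e.eval (s.setVar x j) := by
        rw [State.setVar_comm _ hgx, Expr.eval_setVar he]
      simp only [run, h1]
      by_cases h3 : e.Holds (s.setVar x j)
      · refine ⟨j, ?_, fun _ => ⟨hj, h3⟩⟩
        rw [if_pos (show e.eval (s.setVar x j) ≠ 0 from h3)]
        simp only [Expr.eval, State.setVar_var_self]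
        rw [State.setVar_comm _ hgx.symm, State.setVar_setVar, State.setVar_setVar]
      · refine ⟨v, ?_, ?_⟩
        · rw [if_neg (show ¬ e.eval (s.setVar x j) ≠ 0 from h3), State.setVar_setVar]
        · rintro ⟨i, hi, hi'⟩
          refine hv ⟨i, ?_, hi'⟩
          have : i ≠ j := by rintro rfl; exact h3 hi'
          omega)
  exact ⟨v, (h2 hex).1, (h2 hex).2, h1⟩

/-- Stores the values of `e`, for `x` and `y` below `n + k`, into the array `a`, row by row. -/
def fillMatrix (a x y k : ℕ) (e : Expr) : Prog :=
  range x k (range y k (store a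
    (.op .add (.op .mul (.var x) (.op .add (.var 0) (.lit k))) (.var y)) e))

def _root_.RAM.Expr.readsArr (a : ℕ) : Expr → Bool
  | .lit _ => false
  | .var _ => false
  | .get b e => b == a || e.readsArr a
  | .op _ e f => e.readsArr a || f.readsArr a

theorem _root_.RAM.Expr.eval_setRow {a : ℕ} {e : Expr} (h : e.readsArr a = false) (s : State)
    (f : ℕ → ℕ) : e.eval (s.setRow a f) = e.eval s := by
  induction e with
  | lit k => rfl
  | var x => rfl
  | get b e ih =>
    simp only [Expr.readsArr, Bool.or_eq_false_iff, beq_eq_false_iff_ne] at h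
    simp only [Expr.eval, ih h.2, s.setRow_arr_of_ne h.1]
  | op o e f ihe ihf =>
    simp only [Expr.readsArr, Bool.or_eq_false_iff] at h
    simp only [Expr.eval, ihe h.1, ihf h.2]

theorem run_fillMatrix {n a x y k : ℕ} {e : Expr} {s : State} (hn : s.var 0 = n) (hx : x ≠ 0)
    (hy : y ≠ 0) (hxy : x ≠ y) (he : e.readsArr a = false) :
    ∃ f : ℕ → ℕ, (∀ i < n + k, ∀ j < n + k, f (i * (n + k) + j) =
      e.eval ((s.setVar x i).setVar y j)) ∧
      ((fillMatrix a x y k e).run n s).arr a = f := by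
  let J : ℕ → ℕ → State → Prop := fun i j t => ∃ f v, t = ((s.setVar x i).setVar y v).setRow a f ∧
    ∀ i' < n + k, ∀ j' < n + k, (i' < i ∨ i' = i ∧ j' < j) →
      f (i' * (n + k) + j') = e.eval ((s.setVar x i').setVar y j')
  obtain ⟨⟨f, v, h1, h2⟩, -⟩ := range_invariant (n := n) (x := x) (k := k)
    (c := range y k (store a (.op .add (.op .mul (.var x) (.op .add (.var 0) (.lit k))) (.var y)) e))
    (fun i t => J i 0 t) (s := s) (by simp [writesVar, hxy.symm])
    ⟨s.arr a, s.var y, by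
      rw [State.setVar_eq_self (s := s.setVar x 0) (s.setVar_var_of_ne hxy.symm 0)]
      simp [State.setRow, State.setVar], by
      rintro i' hi' j' hj' (h | h) <;> omega⟩ (by
      rintro i t hi - ht
      obtain ⟨⟨f, v, h1, h2⟩, h3⟩ := range_invariant (n := n) (x := y) (k := k)
        (c := store a (.op .add (.op .mul (.var x) (.op .add (.var 0) (.lit k))) (.var y)) e)
        (fun j t => J i j t) (s := t) rfl (by
          obtain ⟨f, v, rfl, h2⟩ := ht
          exact ⟨f, 0, by simp [State.setRow, State.setVar], h2⟩) (by
          rintro j t hj htj ⟨f, v, rfl, h2⟩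
          have hv : v = j := by simpa using htj
          subst hv
          refine ⟨Function.update f (i * (n + k) + v) (e.eval ((s.setVar x i).setVar y v)), v + 1,
            ?_, ?_⟩
          · simp only [run]
            rw [Expr.eval_setRow he]
            have e1 : ((s.setVar x i).setVar y v).var 0 = n := by
              rw [State.setVar_var_of_ne _ hy.symm, State.setVar_var_of_ne _ hx.symm, hn]
            have e2 : ((s.setVar x i).setVar y v).var x = i := by
              rw [State.setVar_var_of_ne _ hxy, State.setVar_var_self]
            simp only [Expr.eval, Op.apply, State.setRow_var, e1, e2, State.setVar_var_self]
            simp [State.setRow, State.setVar, State.setArr]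
          · intro i' hi' j' hj' hlt
            by_cases heq : i' = i ∧ j' = v
            · rw [heq.1, heq.2, Function.update_self]
            · rw [Function.update_of_ne, h2 i' hi' j' hj' (by omega)]
              intro h
              apply heq
              have h3 := congrArg (· / (n + k)) h
              have h4 := congrArg (· % (n + k)) h
              simp only [Nat.add_comm _ j', Nat.add_comm _ v, Nat.add_mul_div_right _ _ (by omega : 0 < n + k), Nat.div_eq_of_lt hj',
                Nat.div_eq_of_lt hj, Nat.add_mul_mod_self_right, Nat.mod_eq_of_lt hj',
                Nat.mod_eq_of_lt hj] at h3 h4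
              omega)
      refine ⟨f, v, ?_, fun i' hi' j' hj' hlt => h2 i' hi' j' hj' (by omega)⟩
      simp only [run] at h1 ⊢
      rw [h1]
      simp only [State.setRow, State.setVar, State.mk.injEq, and_true]
      rw [Function.update_comm hxy.symm, Function.update_idem, Function.update_comm hxy])
  refine ⟨f, fun i hi j hj => h2 i hi j hj (Or.inl hi), ?_⟩
  rw [fillMatrix, h1]
  simp

end Prog

end RAM

namespace RAM

namespace Expr

@[simp] theorem holds_var {s : State} {x : ℕ} : (var x).Holds s ↔ s.var x ≠ 0 := Iff.rfl

@[simp] theorem holds_get_var {s : State} {a x : ℕ} :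
    (get a (var x)).Holds s ↔ s.arr a (s.var x) ≠ 0 := Iff.rfl

theorem eval_truth (s : State) (e : Expr) : (truth e).eval s = 0 ∨ (truth e).eval s = 1 := by
  simp only [truth, not, eval, Op.apply]
  omega

/-- The entry of the array `a`, read as an `n × n` matrix, in the row `i` and the column `j`. -/
def entry (a i j : ℕ) : Expr := get a (op .add (op .mul (var i) (var 0)) (var j))

theorem eval_entry {s : State} {a i j : ℕ} :
    (entry a i j).eval s = s.arr a (s.var i * s.var 0 + s.var j) := rfl

end Expr

namespace Prog

theorem fill_arr {n a x : ℕ} {e : Expr} (he : e.readsOnly a x = true) (s : State) {j : ℕ}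
    (hj : j < n) : ((fill a x e).run n s).arr a j = e.eval (s.setVar x j) := by
  rw [run_fill he]
  simp [hj]

theorem count_var {n c x : ℕ} {e : Expr} {s : State} (hn : s.var 0 = n) (hc : c ≠ 0) (hx : x ≠ 0)
    (hcx : c ≠ x) (he : e.readsVar c = false) {p : Fin n → Prop}
    (hp : ∀ v : Fin n, e.Holds (s.setVar x v) ↔ p v) :
    ((count c x e).run n s).var c = {v | p v}.ncard := by
  classical
  rw [run_count hn hc hx hcx he, State.setVar_var_of_ne _ hcx, State.setVar_var_self]
  rw [← Set.ncard_image_of_injective _ Fin.val_injective, ← Set.ncard_coe_finset]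
  congr 1
  ext j
  simp only [Finset.coe_filter, Finset.mem_range, Set.mem_ofPred_eq, Set.mem_image]
  constructor
  · exact fun h => ⟨⟨j, h.1⟩, (hp ⟨j, h.1⟩).1 h.2, rfl⟩
  · rintro ⟨v, hv, rfl⟩
    exact ⟨v.2, (hp v).2 hv⟩

end Prog

end RAM

namespace Trigraph

open RAM RAM.Expr

variable {n : ℕ} {T : Trigraph (Fin n)}

theorem code_eq_two {a : SignType} : code a = 2 ↔ a = 1 := by
  cases a <;> simp [code]

theorem code_eq_zero {a : SignType} : code a = 0 ↔ a = -1 := by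
  cases a <;> simp [code]

theorem code_neg (a : SignType) : code (-a) = 2 - code a := by
  cases a <;> rfl

theorem code_le (a : SignType) : code a ≤ 2 := by
  cases a <;> simp [code]

/-- The array `3` holds the adjacency matrix of `T`. -/
structure Loaded (T : Trigraph (Fin n)) (s : State) : Prop where
  var_zero : s.var 0 = n
  arr : ∀ u v : Fin n, s.arr 3 (u * n + v) = code (T.θ u v)

theorem Loaded.of_eq {s t : State} (h : T.Loaded s) (h0 : t.var 0 = s.var 0)
    (h3 : t.arr 3 = s.arr 3) : T.Loaded t :=
  ⟨h0.trans h.var_zero, fun u v => by rw [h3]; exact h.arr u v⟩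

theorem Loaded.setVar {s : State} (h : T.Loaded s) {x : ℕ} (hx : x ≠ 0) (v : ℕ) :
    T.Loaded (s.setVar x v) :=
  h.of_eq (s.setVar_var_of_ne hx.symm v) rfl

theorem Loaded.run {s : State} (h : T.Loaded s) (c : Prog) (h0 : c.writesVar 0 = false)
    (h3 : c.writesArr 3 = false) : T.Loaded (c.run n s) :=
  h.of_eq (c.run_var n h0 s) (c.run_arr n h3 s)

theorem Loaded.eval_entry {s : State} (h : T.Loaded s) {i j : ℕ} {u v : Fin n} (hi : s.var i = u)
    (hj : s.var j = v) : (entry 3 i j).eval s = code (T.θ u v) := by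
  rw [Expr.eval_entry, hi, hj, h.var_zero, h.arr]

theorem Loaded.holds_entry {s : State} (h : T.Loaded s) {i j : ℕ} {u v : Fin n} (hi : s.var i = u)
    (hj : s.var j = v) : (entry 3 i j).Holds s ↔ ¬ T.StrongAnti u v := by
  rw [Holds, h.eval_entry hi hj, Ne, code_eq_zero]
  rfl

theorem Loaded.holds_entry_eq {s : State} (h : T.Loaded s) {i j : ℕ} {u v : Fin n}
    (hi : s.var i = u) (hj : s.var j = v) :
    (isEq (entry 3 i j) (lit 2)).Holds s ↔ T.StrongAdj u v := by
  rw [holds_isEq, h.eval_entry hi hj]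
  exact code_eq_two

/-- The array `a` marks the vertices with the property `p`. -/
def Marks (a : ℕ) (p : Fin n → Prop) (s : State) : Prop := ∀ v : Fin n, s.arr a v ≠ 0 ↔ p v

/-- The arrays `5`, …, `10` describe the set `S`. -/
structure Describes (T : Trigraph (Fin n)) (τ : Fin n → ℕ) (S : Set (Fin n)) (s : State) :
    Prop where
  mem : Marks 5 (· ∈ S) s
  touch₁ : Marks 6 (T.Touch τ S 1) s
  miss₁ : Marks 7 (T.Miss τ S 1) s
  touch₂ : Marks 8 (T.Touch τ S 2) s
  miss₂ : Marks 9 (T.Miss τ S 2) s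
  touch₃ : Marks 10 (T.Touch τ S 3) s

theorem Describes.of_eq {τ : Fin n → ℕ} {S : Set (Fin n)} {s t : State} (h : T.Describes τ S s)
    (he : ∀ a, 5 ≤ a → a ≤ 10 → t.arr a = s.arr a) : T.Describes τ S t := by
  refine ⟨?_, ?_, ?_, ?_, ?_, ?_⟩ <;> intro v <;> rw [he _ (by norm_num) (by norm_num)]
  · exact h.mem v
  · exact h.touch₁ v
  · exact h.miss₁ v
  · exact h.touch₂ v
  · exact h.miss₂ v
  · exact h.touch₃ v

/-- Empties the set described by the arrays `5`, …, `10`. -/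
def clearProg : Prog :=
  .seq (.fill 5 9 (lit 0)) (.seq (.fill 6 9 (lit 0)) (.seq (.fill 7 9 (lit 0))
    (.seq (.fill 8 9 (lit 0)) (.seq (.fill 9 9 (lit 0)) (.fill 10 9 (lit 0))))))

theorem describes_clear (T : Trigraph (Fin n)) (τ : Fin n → ℕ) (s : State) :
    T.Describes τ ∅ (clearProg.run n s) := by
  have h : ∀ (a : ℕ) (s : State) (v : Fin n), ((Prog.fill a 9 (lit 0)).run n s).arr a v = 0 :=
    fun a s v => by rw [Prog.fill_arr rfl _ v.2]; rfl
  refine ⟨?_, ?_, ?_, ?_, ?_, ?_⟩ <;> intro v <;> simp only [clearProg, Prog.run]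
  · rw [Prog.run_arr n (.fill 10 9 (lit 0)) rfl, Prog.run_arr n (.fill 9 9 (lit 0)) rfl,
      Prog.run_arr n (.fill 8 9 (lit 0)) rfl, Prog.run_arr n (.fill 7 9 (lit 0)) rfl,
      Prog.run_arr n (.fill 6 9 (lit 0)) rfl, h]
    simp
  · rw [Prog.run_arr n (.fill 10 9 (lit 0)) rfl, Prog.run_arr n (.fill 9 9 (lit 0)) rfl,
      Prog.run_arr n (.fill 8 9 (lit 0)) rfl, Prog.run_arr n (.fill 7 9 (lit 0)) rfl, h]
    simp [Touch, part]
  · rw [Prog.run_arr n (.fill 10 9 (lit 0)) rfl, Prog.run_arr n (.fill 9 9 (lit 0)) rfl,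
      Prog.run_arr n (.fill 8 9 (lit 0)) rfl, h]
    simp [Miss, part]
  · rw [Prog.run_arr n (.fill 10 9 (lit 0)) rfl, Prog.run_arr n (.fill 9 9 (lit 0)) rfl, h]
    simp [Touch, part]
  · rw [Prog.run_arr n (.fill 10 9 (lit 0)) rfl, h]
    simp [Miss, part]
  · rw [h]
    simp [Touch, part]

/-- The vertex `9` has to be added to the set, which shall contain the vertices in the variables
`y` and `z`. -/
def wantedExpr (m : Bool) (y z : ℕ) : Expr :=
  and (not (get 5 (var 9))) (or (or (isEq (var 9) (var y)) (isEq (var 9) (var z)))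
    (or (and (get 6 (var 9)) (get 7 (var 9))) (or (and (get 8 (var 9)) (get 9 (var 9)))
      (or (get 10 (var 9)) (and (lit m.toNat) (and (get 6 (var 9)) (get 8 (var 9))))))))

theorem Describes.holds_wantedExpr {τ : Fin n → ℕ} {S : Set (Fin n)} {s : State}
    (h : T.Describes τ S s) (m : Bool) {y z : ℕ} (hy9 : y ≠ 9) (hz9 : z ≠ 9) {u v : Fin n}
    (hy : s.var y = u) (hz : s.var z = v) (w : Fin n) :
    (wantedExpr m y z).Holds (s.setVar 9 w) ↔ w ∉ S ∧ (w = u ∨ w = v ∨ T.Bad τ m S w) := by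
  have hm : (lit m.toNat).Holds (s.setVar 9 w) ↔ m = true := by
    cases m <;> simp [Holds, eval]
  simp only [wantedExpr, holds_and, holds_or, holds_not, holds_isEq, holds_get_var, hm, eval,
    State.setVar_var_self, State.setVar_arr, State.setVar_var_of_ne _ hy9,
    State.setVar_var_of_ne _ hz9, hy, hz, Fin.val_inj, Bad, h.mem w, h.touch₁ w, h.miss₁ w,
    h.touch₂ w, h.miss₂ w, h.touch₃ w]
  tauto

/-- The adjacency of the vertex in the variable `12`, which is added to the set, is taken into
account in the array `a` of neighbors of type `t`. -/
def touchExpr (a t : ℕ) : Expr :=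
  truth (or (get a (var 9)) (and (isEq (get 4 (var 12)) (lit t)) (entry 3 12 9)))

def missExpr (a t : ℕ) : Expr :=
  truth (or (get a (var 9))
    (and (isEq (get 4 (var 12)) (lit t)) (not (isEq (entry 3 12 9) (lit 2)))))

def touchProg (a t : ℕ) : Prog := .fill a 9 (touchExpr a t)

def missProg (a t : ℕ) : Prog := .fill a 9 (missExpr a t)

theorem touch_insert {τ : Fin n → ℕ} {S : Set (Fin n)} {t : ℕ} {g v : Fin n} :
    T.Touch τ (insert g S) t v ↔ T.Touch τ S t v ∨ τ g = t ∧ ¬ T.StrongAnti g v := by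
  simp only [Touch, part, Set.mem_ofPred_eq, Set.mem_insert_iff]
  constructor
  · rintro ⟨w, ⟨rfl | hw, hwt⟩, hwv⟩
    · exact Or.inr ⟨hwt, hwv⟩
    · exact Or.inl ⟨w, ⟨hw, hwt⟩, hwv⟩
  · rintro (⟨w, ⟨hw, hwt⟩, hwv⟩ | ⟨h1, h2⟩)
    · exact ⟨w, ⟨Or.inr hw, hwt⟩, hwv⟩
    · exact ⟨g, ⟨Or.inl rfl, h1⟩, h2⟩

theorem miss_insert {τ : Fin n → ℕ} {S : Set (Fin n)} {t : ℕ} {g v : Fin n} :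
    T.Miss τ (insert g S) t v ↔ T.Miss τ S t v ∨ τ g = t ∧ ¬ T.StrongAdj g v := by
  simp only [Miss, part, Set.mem_ofPred_eq, Set.mem_insert_iff]
  constructor
  · rintro ⟨w, ⟨rfl | hw, hwt⟩, hwv⟩
    · exact Or.inr ⟨hwt, hwv⟩
    · exact Or.inl ⟨w, ⟨hw, hwt⟩, hwv⟩
  · rintro (⟨w, ⟨hw, hwt⟩, hwv⟩ | ⟨h1, h2⟩)
    · exact ⟨w, ⟨Or.inr hw, hwt⟩, hwv⟩
    · exact ⟨g, ⟨Or.inl rfl, h1⟩, h2⟩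

/-- The array `4` holds the types of the vertices. -/
def Typed (τ : Fin n → ℕ) (s : State) : Prop := ∀ v : Fin n, s.arr 4 v = τ v

theorem Loaded.marks_touchProg {τ : Fin n → ℕ} {S : Set (Fin n)} {s : State} (h : T.Loaded s)
    (hτ : Typed τ s) {g : Fin n} (hg : s.var 12 = g) {a t : ℕ}
    (ha : (touchExpr a t).readsOnly a 9 = true) (hS : Marks a (T.Touch τ S t) s) :
    Marks a (T.Touch τ (insert g S) t) ((touchProg a t).run n s) := by
  intro v
  have h9 := h.setVar (x := 9) (by norm_num) v
  rw [touchProg, Prog.fill_arr ha _ v.2]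
  change Holds _ _ ↔ _
  have e12 : (s.setVar 9 v).var 12 = g := hg
  rw [touchExpr, holds_truth, holds_or, holds_and, holds_isEq, h9.holds_entry (i := 12) (j := 9) e12
    (State.setVar_var_self _ _ _)]
  simp only [holds_get_var, eval, State.setVar_var_self, State.setVar_arr, e12, hτ g, hS v,
    touch_insert]

theorem Loaded.marks_missProg {τ : Fin n → ℕ} {S : Set (Fin n)} {s : State} (h : T.Loaded s)
    (hτ : Typed τ s) {g : Fin n} (hg : s.var 12 = g) {a t : ℕ}
    (ha : (missExpr a t).readsOnly a 9 = true) (hS : Marks a (T.Miss τ S t) s) :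
    Marks a (T.Miss τ (insert g S) t) ((missProg a t).run n s) := by
  intro v
  have h9 := h.setVar (x := 9) (by norm_num) v
  rw [missProg, Prog.fill_arr ha _ v.2]
  change Holds _ _ ↔ _
  have e12 : (s.setVar 9 v).var 12 = g := hg
  rw [missExpr, holds_truth, holds_or, holds_and, holds_isEq, holds_not,
    h9.holds_entry_eq (i := 12) (j := 9) e12 (State.setVar_var_self _ _ _)]
  simp only [holds_get_var, eval, State.setVar_var_self, State.setVar_arr, e12, hτ g, hS v,
    miss_insert]

/-- Adds the vertex in the variable `12` to the set. -/
def insertProg : Prog :=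
  .seq (.store 5 (var 12) (lit 1)) (.seq (touchProg 6 1) (.seq (missProg 7 1)
    (.seq (touchProg 8 2) (.seq (missProg 9 2) (touchProg 10 3)))))

theorem Loaded.describes_insertProg {τ : Fin n → ℕ} {S : Set (Fin n)} {s : State} (h : T.Loaded s)
    (hτ : Typed τ s) {g : Fin n} (hg : s.var 12 = g) (hS : T.Describes τ S s) :
    T.Describes τ (insert g S) (insertProg.run n s) := by
  have frame : ∀ {c : Prog}, c.writesVar 0 = false → c.writesVar 12 = false →
      c.writesArr 3 = false → c.writesArr 4 = false → ∀ s, T.Loaded s ∧ Typed τ s ∧ s.var 12 = g →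
      T.Loaded (c.run n s) ∧ Typed τ (c.run n s) ∧ (c.run n s).var 12 = g := by
    rintro c h0 h12 h3 h4 s ⟨h, hτ, hg⟩
    refine ⟨h.run c h0 h3, fun v => ?_, (c.run_var n h12 s).trans hg⟩
    rw [c.run_arr n h4]
    exact hτ v
  have move : ∀ {c : Prog} {a : ℕ} {p : Fin n → Prop} {s : State}, c.writesArr a = false →
      Marks a p s → Marks a p (c.run n s) := by
    intro c a p s hc hp v
    rw [c.run_arr n hc]
    exact hp v
  set s₁ := (Prog.store 5 (var 12) (lit 1)).run n s with hs₁
  have f₁ := frame (c := .store 5 (var 12) (lit 1)) rfl rfl rfl rfl s ⟨h, hτ, hg⟩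
  set s₂ := (touchProg 6 1).run n s₁ with hs₂
  have f₂ := frame (c := touchProg 6 1) rfl rfl rfl rfl s₁ f₁
  set s₃ := (missProg 7 1).run n s₂ with hs₃
  have f₃ := frame (c := missProg 7 1) rfl rfl rfl rfl s₂ f₂
  set s₄ := (touchProg 8 2).run n s₃ with hs₄
  have f₄ := frame (c := touchProg 8 2) rfl rfl rfl rfl s₃ f₃
  set s₅ := (missProg 9 2).run n s₄ with hs₅
  have f₅ := frame (c := missProg 9 2) rfl rfl rfl rfl s₄ f₄
  have hrun : insertProg.run n s = (touchProg 10 3).run n s₅ := rfl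
  rw [hrun]
  refine ⟨?_, ?_, ?_, ?_, ?_, ?_⟩
  · refine move rfl (move rfl (move rfl (move rfl (move rfl ?_))))
    intro v
    rw [hs₁]
    simp only [Prog.run, State.setArr_arr_self, eval, hg]
    by_cases hv : v = g
    · subst hv; simp
    · rw [Function.update_of_ne (by simpa [Fin.val_inj] using hv)]
      simp [hv, hS.mem v]
  · exact move rfl (move rfl (move rfl (move rfl
      (f₁.1.marks_touchProg f₁.2.1 f₁.2.2 rfl (move rfl hS.touch₁)))))
  · exact move rfl (move rfl (move rfl
      (f₂.1.marks_missProg f₂.2.1 f₂.2.2 rfl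
        (move rfl (move rfl hS.miss₁)))))
  · exact move rfl (move rfl
      (f₃.1.marks_touchProg f₃.2.1 f₃.2.2 rfl
        (move rfl (move rfl (move rfl hS.touch₂)))))
  · exact move rfl (f₄.1.marks_missProg f₄.2.1 f₄.2.2 rfl
      (move rfl (move rfl (move rfl (move rfl hS.miss₂)))))
  · exact f₅.1.marks_touchProg f₅.2.1 f₅.2.2 rfl
      (move rfl (move rfl (move rfl (move rfl (move rfl hS.touch₃)))))

/-- Adds a vertex to the set, if one has to be added. -/
def growProg (m : Bool) (y z : ℕ) : Prog :=
  .seq (.count 11 9 (wantedExpr m y z))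
    (.ite (var 11) (.seq (.find 12 9 (wantedExpr m y z)) insertProg) .skip)

/-- Computes the least closed set that contains the vertices in the variables `y` and `z`. -/
def closureProg (m : Bool) (y z : ℕ) : Prog := .seq clearProg (.range 8 0 (growProg m y z))

/-- The memory at the beginning of a closure computation. -/
structure Ready (T : Trigraph (Fin n)) (τ : Fin n → ℕ) (y z : ℕ) (u v : Fin n) (s : State) :
    Prop where
  loaded : T.Loaded s
  typed : Typed τ s
  left : s.var y = u
  right : s.var z = v

theorem Ready.run {τ : Fin n → ℕ} {y z : ℕ} {u v : Fin n} {s : State} (h : T.Ready τ y z u v s)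
    {c : Prog} (h0 : c.writesVar 0 = false) (hy : c.writesVar y = false)
    (hz : c.writesVar z = false) (h3 : c.writesArr 3 = false) (h4 : c.writesArr 4 = false) :
    T.Ready τ y z u v (c.run n s) :=
  ⟨h.loaded.run c h0 h3, fun v => by rw [c.run_arr n h4]; exact h.typed v,
    (c.run_var n hy s).trans h.left, (c.run_var n hz s).trans h.right⟩

theorem Ready.grow {τ : Fin n → ℕ} {y z : ℕ} {u v : Fin n} {s : State} (h : T.Ready τ y z u v s)
    (hy : y = 6 ∨ y = 7) (hz : z = 7) (m : Bool) {S : Set (Fin n)} (hS : T.Describes τ S s) :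
    ((∀ w ∉ S, ¬ (w = u ∨ w = v ∨ T.Bad τ m S w)) ∧ T.Describes τ S ((growProg m y z).run n s)) ∨
    ∃ g, g ∉ S ∧ (g = u ∨ g = v ∨ T.Bad τ m S g) ∧
      T.Describes τ (insert g S) ((growProg m y z).run n s) := by
  have hw := fun w => hS.holds_wantedExpr m (y := y) (z := z) (by omega) (by omega) h.left h.right w
  have hr : ∀ c, c = 11 ∨ c = 12 → (wantedExpr m y z).readsVar c = false := by
    subst hz
    rcases hy with rfl | rfl <;> rintro c (rfl | rfl) <;> rfl
  set s₁ := (Prog.count 11 9 (wantedExpr m y z)).run n s with hs₁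
  have h11 : s₁.var 11 = {w | w ∉ S ∧ (w = u ∨ w = v ∨ T.Bad τ m S w)}.ncard :=
    Prog.count_var h.loaded.var_zero (by norm_num) (by norm_num) (by norm_num) (hr 11 (Or.inl rfl)) hw
  have harr : ∀ a, s₁.arr a = s.arr a := fun a => Prog.run_arr n _ rfl s
  have hS₁ : T.Describes τ S s₁ := hS.of_eq fun a _ _ => harr a
  have hR : T.Ready τ y z u v s₁ := h.run rfl (by rcases hy with rfl | rfl <;> rfl)
    (by subst hz; rfl) rfl rfl
  have hrun : (growProg m y z).run n s = if s₁.var 11 ≠ 0 then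
      insertProg.run n ((Prog.find 12 9 (wantedExpr m y z)).run n s₁) else s₁ := rfl
  by_cases h0 : s₁.var 11 = 0
  · left
    rw [hrun, if_neg (by simpa using h0)]
    rw [h11, Set.ncard_eq_zero] at h0
    refine ⟨fun w hwS hw' => ?_, hS₁⟩
    have : w ∈ (∅ : Set (Fin n)) := h0 ▸ ⟨hwS, hw'⟩
    exact this
  · right
    rw [hrun, if_pos h0]
    rw [h11, Set.ncard_eq_zero, ← Ne, ← Set.nonempty_iff_ne_empty] at h0
    obtain ⟨w, hwS⟩ := h0
    have hw₁ := fun w => hS₁.holds_wantedExpr m (y := y) (z := z) (by omega) (by omega) hR.left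
      hR.right w
    obtain ⟨g, hg, hg', hrun'⟩ := Prog.run_find (n := n) (g := 12) (x := 9) (s := s₁)
      (by norm_num) (hr 12 (Or.inr rfl)) ⟨w, w.2, (hw₁ w).2 hwS⟩
    have hg'' := (hw₁ ⟨g, hg⟩).1 hg'
    refine ⟨⟨g, hg⟩, hg''.1, hg''.2, ?_⟩
    have hR₂ := hR.run (c := .find 12 9 (wantedExpr m y z)) rfl
      (by rcases hy with rfl | rfl <;> rfl) (by subst hz; rfl) rfl rfl
    refine hR₂.loaded.describes_insertProg hR₂.typed ?_ (hS₁.of_eq fun a _ _ => ?_)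
    · rw [hrun']
      rfl
    · exact Prog.run_arr n _ rfl s₁

theorem Ready.closure {τ : Fin n → ℕ} {y z : ℕ} {u v : Fin n} {s : State} (h : T.Ready τ y z u v s)
    (hy : y = 6 ∨ y = 7) (hz : z = 7) (m : Bool) :
    ∃ S, T.IsClosure τ m u v S ∧ T.Describes τ S ((closureProg m y z).run n s) := by
  have hyw : ∀ {c : Prog}, c.writesVar 6 = false → c.writesVar 7 = false →
      c.writesVar y = false ∧ c.writesVar z = false := by
    rintro c h6 h7
    subst hz
    rcases hy with rfl | rfl
    · exact ⟨h6, h7⟩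
    · exact ⟨h7, h7⟩
  have hR₁ : T.Ready τ y z u v (clearProg.run n s) :=
    h.run rfl (hyw (c := clearProg) rfl rfl).1 (hyw (c := clearProg) rfl rfl).2 rfl rfl
  obtain ⟨⟨-, S, hS, hsub, hdone⟩, -⟩ := Prog.range_invariant (n := n) (x := 8) (k := 0)
    (c := growProg m y z) (s := clearProg.run n s)
    (fun j t => T.Ready τ y z u v t ∧ ∃ S, T.Describes τ S t ∧
      (∀ Y, u ∈ Y → v ∈ Y → T.ClosedUnder τ m Y → S ⊆ Y) ∧
      ((∀ w ∉ S, ¬ (w = u ∨ w = v ∨ T.Bad τ m S w)) ∨ j ≤ S.ncard)) rfl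
    (by
      refine ⟨hR₁.run (c := .assign 8 (lit 0)) rfl (hyw (c := .assign 8 (lit 0)) rfl rfl).1
        (hyw (c := .assign 8 (lit 0)) rfl rfl).2 rfl rfl, ∅,
        (describes_clear T τ s).of_eq fun _ _ _ => rfl, by simp, Or.inr (by simp)⟩)
    (by
      rintro j t - - ⟨hR, S, hS, hsub, hdone⟩
      have hR' : T.Ready τ y z u v (((growProg m y z).run n t).setVar 8 (j + 1)) :=
        (hR.run (c := growProg m y z) rfl (hyw (c := growProg m y z) rfl rfl).1
          (hyw (c := growProg m y z) rfl rfl).2 rfl rfl).run (c := .assign 8 (lit (j + 1))) rfl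
          (hyw (c := .assign 8 (lit (j + 1))) rfl rfl).1
          (hyw (c := .assign 8 (lit (j + 1))) rfl rfl).2 rfl rfl
      refine ⟨hR', ?_⟩
      rcases hR.grow hy hz m hS with ⟨h1, h2⟩ | ⟨g, h1, h2, h3⟩
      · exact ⟨S, h2.of_eq fun _ _ _ => rfl, hsub, Or.inl h1⟩
      · refine ⟨insert g S, h3.of_eq fun _ _ _ => rfl, fun Y hu hv hY => ?_, Or.inr ?_⟩
        · refine Set.insert_subset ?_ (hsub Y hu hv hY)
          by_contra hgY
          rcases h2 with rfl | rfl | h2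
          · exact hgY hu
          · exact hgY hv
          · exact hY g hgY (h2.mono (hsub Y hu hv hY))
        · rw [Set.ncard_insert_of_notMem h1]
          rcases hdone with h4 | h4
          · exact absurd h2 (h4 g h1)
          · omega)
  have hdone' : ∀ w ∉ S, ¬ (w = u ∨ w = v ∨ T.Bad τ m S w) := by
    rcases hdone with h1 | h1
    · exact h1
    · have : S = Set.univ := by
        rw [← Set.compl_empty_iff, ← Set.ncard_eq_zero]
        have := Set.ncard_add_ncard_compl S
        rw [Nat.card_fin] at this
        omega
      intro w hw
      simp [this] at hw
  refine ⟨S, ⟨?_, ?_, fun w hw hbad => hdone' w hw (Or.inr (Or.inr hbad)), hsub⟩, hS⟩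
  · by_contra hu
    exact hdone' u hu (Or.inl rfl)
  · by_contra hv
    exact hdone' v hv (Or.inr (Or.inl rfl))

end Trigraph

namespace RAM

namespace Prog

/-- Counts several sets of numbers, given by conditions on the variable `9`. -/
def counts : List (ℕ × Expr) → Prog
  | [] => skip
  | p :: l => seq (count p.1 9 p.2) (counts l)

theorem counts_writesVar {l : List (ℕ × Expr)} {c : ℕ} (h : ∀ p ∈ l, p.1 ≠ c) (hc : c ≠ 9) :
    (counts l).writesVar c = false := by
  induction l with
  | nil => rfl
  | cons p l ih =>
    have h1 := h p (by simp)
    have h2 := ih fun q hq => h q (by simp [hq])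
    simp [counts, count, writesVar, h1, h2, hc.symm]

theorem counts_writesArr (l : List (ℕ × Expr)) (a : ℕ) : (counts l).writesArr a = false := by
  induction l with
  | nil => rfl
  | cons p l ih => simp [counts, count, writesArr, ih]

theorem run_counts {n : ℕ} {l : List (ℕ × Expr)} {s : State} (hn : s.var 0 = n)
    (hl : ∀ p ∈ l, p.1 ≠ 0 ∧ p.1 ≠ 9) (hd : (l.map Prod.fst).Nodup)
    (hr : ∀ p ∈ l, ∀ q ∈ l, q.2.readsVar p.1 = false) : ∀ p ∈ l,
      ((counts l).run n s).var p.1 = {v : Fin n | p.2.Holds (s.setVar 9 v)}.ncard := by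
  induction l generalizing s with
  | nil => simp
  | cons p l ih =>
    have hp := hl p (by simp)
    rw [List.map_cons, List.nodup_cons] at hd
    have hrun := run_count (n := n) (c := p.1) (x := 9) (e := p.2) hn hp.1 (by norm_num) hp.2
      (hr p (by simp) p (by simp))
    have hfirst := count_var (n := n) (c := p.1) (x := 9) (e := p.2) hn hp.1 (by norm_num) hp.2
      (hr p (by simp) p (by simp)) fun v => Iff.rfl
    intro q hq
    rcases List.mem_cons.1 hq with rfl | hq
    · rw [counts, run, run_var n _ (counts_writesVar (fun q' hq' h => ?_) hp.2), hfirst]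
      exact hd.1 (h ▸ List.mem_map_of_mem hq')
    · rw [counts, run, ih ?_ (fun q' hq' => hl q' (by simp [hq'])) hd.2
        (fun q' hq' q'' hq'' => hr q' (by simp [hq']) q'' (by simp [hq''])) q hq, hrun]
      · congr 1
        ext v
        simp only [Set.mem_ofPred_eq, Expr.Holds]
        rw [State.setVar_setVar, State.setVar_comm _ hp.2,
          Expr.eval_setVar (hr p (by simp) q (by simp [hq]))]
      · rw [run_var n _ (by simp [count, writesVar, hp.1]), hn]

end Prog

end RAM

namespace Trigraph

open RAM RAM.Expr

variable {n : ℕ} {T : Trigraph (Fin n)}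

theorem Loaded.eval_entry_eq {s : State} (h : T.Loaded s) {i j : ℕ} {u v : Fin n}
    (hi : s.var i = u) (hj : s.var j = v) [Decidable (T.StrongAdj u v)] :
    (isEq (entry 3 i j) (lit 2)).eval s = if T.StrongAdj u v then 1 else 0 := by
  have h1 := h.holds_entry_eq hi hj
  simp only [Holds, isEq, eval, Op.apply] at h1 ⊢
  split_ifs at h1 ⊢ <;> simp_all

/-- The ways in which the types of the vertices are determined by at most two vertices. -/
inductive Typing
  | pair
  | join
  | link

noncomputable def Typing.fn (T : Trigraph (Fin n)) (x y : Fin n) : Typing → Fin n → ℕ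
  | .pair => T.typePair x
  | .join => T.typeJoin x y
  | .link => T.typeLink x

/-- The variable that holds the first vertex of the set whose closure is computed. -/
def Typing.start : Typing → ℕ
  | .pair => 6
  | .join => 7
  | .link => 6

def Typing.prog : Typing → Prog
  | .pair => .fill 4 9 (.op .sub (lit 2) (isEq (entry 3 5 9) (lit 2)))
  | .join => .fill 4 9 (.op .sub (.op .sub (lit 3) (.op .mul (lit 2) (isEq (entry 3 5 9) (lit 2))))
      (.op .mul (not (isEq (entry 3 5 9) (lit 2))) (isEq (entry 3 6 9) (lit 2))))
  | .link => .range 9 0 (.seq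
      (.count 11 10 (and (entry 3 9 10) (isEq (entry 3 5 10) (lit 2))))
      (.store 4 (var 9) (.op .sub
        (.op .sub (lit 3) (.op .mul (lit 2) (isEq (entry 3 5 9) (lit 2))))
        (.op .mul (not (isEq (entry 3 5 9) (lit 2))) (not (var 11))))))

theorem Loaded.typed {s : State} (h : T.Loaded s) {x y : Fin n} (hx : s.var 5 = x)
    (hy : s.var 6 = y) (k : Typing) : Typed (k.fn T x y) (k.prog.run n s) := by
  classical
  cases k with
  | pair =>
    intro w
    have h9 := h.setVar (x := 9) (by norm_num) w
    rw [Typing.prog, Prog.fill_arr rfl _ w.2]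
    have e := h9.eval_entry_eq (i := 5) (j := 9) (u := x) (v := w) hx (State.setVar_var_self _ _ _)
    simp only [eval, Op.apply, e, Typing.fn, typePair]
    split_ifs <;> rfl
  | join =>
    intro w
    have h9 := h.setVar (x := 9) (by norm_num) w
    rw [Typing.prog, Prog.fill_arr rfl _ w.2]
    have e := h9.eval_entry_eq (i := 5) (j := 9) (u := x) (v := w) hx (State.setVar_var_self _ _ _)
    have e' := h9.eval_entry_eq (i := 6) (j := 9) (u := y) (v := w) hy
      (State.setVar_var_self _ _ _)
    simp only [eval, Op.apply, e, e', Expr.not, Typing.fn, typeJoin]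
    split_ifs <;> rfl
  | link =>
    obtain ⟨⟨-, -, hI⟩, -⟩ := Prog.range_invariant (n := n) (x := 9) (k := 0) (s := s)
      (c := .seq (.count 11 10 (and (entry 3 9 10) (isEq (entry 3 5 10) (lit 2))))
        (.store 4 (var 9) (.op .sub
          (.op .sub (lit 3) (.op .mul (lit 2) (isEq (entry 3 5 9) (lit 2))))
          (.op .mul (not (isEq (entry 3 5 9) (lit 2))) (not (var 11))))))
      (fun j t => T.Loaded t ∧ t.var 5 = x ∧ ∀ w : Fin n, (w : ℕ) < j →
        t.arr 4 w = T.typeLink x w) rfl ⟨h.setVar (by norm_num) 0, hx, by simp⟩ (by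
      rintro j t hj htj ⟨ht, hx, hI⟩
      obtain ⟨w, rfl⟩ : ∃ w : Fin n, j = w := ⟨⟨j, by simpa using hj⟩, rfl⟩
      set t₁ := (Prog.count 11 10 (and (entry 3 9 10) (isEq (entry 3 5 10) (lit 2)))).run n t
        with ht₁
      have hL : T.Loaded t₁ := ht.run _ rfl rfl
      have e5 : t₁.var 5 = x := (Prog.run_var n _ rfl t).trans hx
      have e9 : t₁.var 9 = w := (Prog.run_var n _ rfl t).trans htj
      have e11 : t₁.var 11 = {u | ¬ T.StrongAnti w u ∧ T.StrongAdj x u}.ncard := by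
        refine Prog.count_var ht.var_zero (by norm_num) (by norm_num) (by norm_num) rfl fun u => ?_
        have h10 := ht.setVar (x := 10) (by norm_num) u
        rw [holds_and, h10.holds_entry_eq (i := 5) (j := 10) (u := x) (v := u) hx
          (State.setVar_var_self _ _ _), h10.holds_entry (i := 9) (j := 10) (u := w) (v := u) htj
          (State.setVar_var_self _ _ _)]
      have hzero : t₁.var 11 = 0 ↔ ¬ ∃ u, ¬ T.StrongAnti w u ∧ T.StrongAdj x u := by
        rw [e11, Set.ncard_eq_zero, Set.eq_empty_iff_forall_notMem, not_exists]
        rfl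
      refine ⟨(hL.run (.store 4 _ _) rfl rfl).setVar (by norm_num) _, e5, fun v hv => ?_⟩
      change Function.update (t₁.arr 4) (t₁.var 9) (Expr.eval t₁ _) v = _
      rw [e9]
      by_cases hvw : v = w
      · subst hvw
        rw [Function.update_self]
        simp only [eval, Op.apply, hL.eval_entry_eq e5 e9, Expr.not, typeLink]
        split_ifs with h1 h2
        · simp
        · have h3 : t₁.var 11 ≠ 0 := fun h3 => hzero.1 h3 h2
          have : 1 - t₁.var 11 = 0 := by omega
          rw [this]
        · rw [hzero.2 h2]
      · rw [Function.update_of_ne (by simpa [Fin.val_inj] using hvw), ht₁,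
          Prog.run_arr n _ rfl]
        refine hI v ?_
        have : (v : ℕ) ≠ w := fun h => hvw (Fin.ext h)
        omega)
    exact fun w => hI w (by simp)

/-- Certificates for sides of `2`-joins or for homogeneous pairs. -/
def Valid (T : Trigraph (Fin n)) (τ : Fin n → ℕ) (S : Set (Fin n)) : Bool → Prop
  | true => T.JoinValid τ S
  | false => T.PairValid τ S

def partExpr (t : ℕ) : Expr := and (get 5 (var 9)) (isEq (get 4 (var 9)) (lit t))

def outsideExpr (e : Expr) : Expr := and (not (get 5 (var 9))) e

def countList : Bool → List (ℕ × Expr)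
  | true => [(14, partExpr 1), (15, partExpr 2), (16, get 5 (var 9)),
      (17, outsideExpr (get 6 (var 9))), (18, outsideExpr (get 8 (var 9)))]
  | false => [(14, partExpr 1), (15, partExpr 2), (16, get 5 (var 9)),
      (17, and (partExpr 1) (not (and (get 8 (var 9)) (get 9 (var 9))))),
      (18, and (partExpr 2) (not (and (get 6 (var 9)) (get 7 (var 9))))),
      (19, outsideExpr (and (get 6 (var 9)) (get 8 (var 9)))),
      (20, outsideExpr (and (get 6 (var 9)) (not (get 8 (var 9))))),
      (21, outsideExpr (and (not (get 6 (var 9))) (get 8 (var 9)))),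
      (22, outsideExpr (and (not (get 6 (var 9))) (not (get 8 (var 9)))))]

def validExpr : Bool → Expr
  | true => and (var 14) (and (var 15) (and (isLt (lit 3) (var 16))
      (and (isLt (.op .add (lit 3) (var 16)) (var 0)) (and (var 17) (var 18)))))
  | false => and (isLt (lit 1) (var 14)) (and (isLt (lit 1) (var 15)) (and (not (var 17))
      (and (not (var 18)) (and (var 19) (and (var 20) (and (var 21) (var 22)))))))

theorem Describes.counts {τ : Fin n → ℕ} {S : Set (Fin n)} {s : State} (h : T.Describes τ S s)
    (h0 : s.var 0 = n) (hτ : Typed τ s) (J : Bool) :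
    ((validExpr J).Holds ((Prog.counts (countList J)).run n s) ↔ T.Valid τ S J) ∧
      ((Prog.counts (countList J)).run n s).var 16 = S.ncard := by
  have hrun := Prog.run_counts (n := n) (s := s) (l := countList J) h0
    (by cases J <;> decide) (by cases J <;> decide) (by cases J <;> decide)
  have hz : ((Prog.counts (countList J)).run n s).var 0 = n := by
    rw [Prog.run_var n _ (by cases J <;> rfl), h0]
  set t := (Prog.counts (countList J)).run n s with ht
  have hpart : ∀ (k : ℕ) (w : Fin n), (partExpr k).Holds (s.setVar 9 w) ↔ w ∈ part τ S k := by
    intro k w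
    simp only [partExpr, holds_and, holds_get_var, holds_isEq, eval, State.setVar_var_self,
      State.setVar_arr, hτ w, h.mem w]
    rfl
  have hne : ∀ {p : Fin n → Prop}, {w | p w}.ncard ≠ 0 ↔ ∃ w, p w := by
    intro p
    rw [Ne, Set.ncard_eq_zero, ← Ne, ← Set.nonempty_iff_ne_empty]
    rfl
  have hmem : ∀ {A : Set (Fin n)}, {w | w ∈ A} = A := rfl
  cases J with
  | true =>
    simp only [countList, List.mem_cons, List.not_mem_nil, or_false, forall_eq_or_imp,
      forall_eq, hpart, outsideExpr, holds_and, holds_not, holds_get_var, State.setVar_var_self,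
      State.setVar_arr, h.mem _, h.touch₁ _, h.touch₂ _, hmem] at hrun
    obtain ⟨e14, e15, e16, e17, e18⟩ := hrun
    refine ⟨?_, e16⟩
    simp only [validExpr, holds_and, holds_isLt, holds_var, eval, Op.apply, e14, e15, e16, e17,
      e18, hz, hne, Valid]
    rw [Ne, Ne, Set.ncard_eq_zero, Set.ncard_eq_zero, ← Ne, ← Ne, ← Set.nonempty_iff_ne_empty,
      ← Set.nonempty_iff_ne_empty]
    constructor
    · rintro ⟨h1, h2, h3, h4, h5, h6⟩
      exact ⟨h1, h2, by omega, by rw [Nat.card_fin]; omega, h5, h6⟩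
    · rintro ⟨h1, h2, h3, h4, h5, h6⟩
      rw [Nat.card_fin] at h4
      exact ⟨h1, h2, by omega, by omega, h5, h6⟩
  | false =>
    simp only [countList, List.mem_cons, List.not_mem_nil, or_false, forall_eq_or_imp,
      forall_eq, hpart, outsideExpr, holds_and, holds_not, holds_get_var, State.setVar_var_self,
      State.setVar_arr, h.mem _, h.touch₁ _, h.touch₂ _, h.miss₁ _, h.miss₂ _, hmem] at hrun
    obtain ⟨e14, e15, e16, e17, e18, e19, e20, e21, e22⟩ := hrun
    refine ⟨?_, e16⟩
    simp only [validExpr, holds_and, holds_not, holds_isLt, holds_var, eval, e14, e15, e17,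
      e18, e19, e20, e21, e22, hne, Valid]
    constructor
    · rintro ⟨h1, h2, h3, h4, h5, h6, h7, h8⟩
      exact ⟨h1, h2, fun x hx => by_contra fun hx' => h3 ⟨x, hx, hx'⟩,
        fun x hx => by_contra fun hx' => h4 ⟨x, hx, hx'⟩, h5, h6, h7, h8⟩
    · rintro ⟨h1, h2, h3, h4, h5, h6, h7, h8⟩
      exact ⟨h1, h2, fun ⟨x, hx, hx'⟩ => hx' (h3 x hx), fun ⟨x, hx, hx'⟩ => hx' (h4 x hx),
        h5, h6, h7, h8⟩

/-- The trigraph or its complement. -/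
def flip (T : Trigraph (Fin n)) : Bool → Trigraph (Fin n)
  | true => T.compl
  | false => T

open Classical in
/-- The memory holds the set `S`, with its types. -/
structure Records (J co : Bool) (τ : Fin n → ℕ) (S : Set (Fin n)) (s : State) : Prop where
  found : s.var 1 = 1
  card : s.var 3 = S.ncard
  flipped : s.var 23 = co.toNat
  isJoin : s.var 24 = J.toNat
  label : ∀ v : Fin n, s.arr 11 v = if v ∈ S then τ v else 0

def recordProg (J co : Bool) : Prog :=
  .seq (.fill 11 9 (.op .sub (lit 3)
      (.op .sub (lit 3) (.op .mul (truth (get 5 (var 9))) (get 4 (var 9))))))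
    (.seq (.assign 1 (lit 1)) (.seq (.assign 3 (var 16))
      (.seq (.assign 23 (lit co.toNat)) (.assign 24 (lit J.toNat)))))

/-- Computes a closure, and records it if it is valid and smaller than what was found before. -/
def searchProg (J co : Bool) (k : Typing) : Prog :=
  .seq k.prog (.seq (closureProg J k.start 7) (.seq (.counts (countList J))
    (.ite (and (validExpr J) (or (not (var 1)) (isLt (var 16) (var 3))))
      (recordProg J co) .skip)))

/-- Everything that is remembered about the best set found so far is the same. -/
structure SameRecord (s t : State) : Prop where
  found : t.var 1 = s.var 1
  card : t.var 3 = s.var 3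
  flipped : t.var 23 = s.var 23
  isJoin : t.var 24 = s.var 24
  label : t.arr 11 = s.arr 11

theorem SameRecord.trans {s t u : State} (h : SameRecord s t) (h' : SameRecord t u) :
    SameRecord s u :=
  ⟨h'.found.trans h.found, h'.card.trans h.card, h'.flipped.trans h.flipped,
    h'.isJoin.trans h.isJoin, h'.label.trans h.label⟩

theorem SameRecord.of_run (c : Prog) (h1 : c.writesVar 1 = false) (h3 : c.writesVar 3 = false)
    (h23 : c.writesVar 23 = false) (h24 : c.writesVar 24 = false) (h11 : c.writesArr 11 = false)
    (s : State) : SameRecord s (c.run n s) :=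
  ⟨c.run_var n h1 s, c.run_var n h3 s, c.run_var n h23 s, c.run_var n h24 s, c.run_arr n h11 s⟩

theorem Records.of_same {J co : Bool} {τ : Fin n → ℕ} {S : Set (Fin n)} {s t : State}
    (h : Records J co τ S s) (hst : SameRecord s t) : Records J co τ S t :=
  ⟨hst.found.trans h.found, hst.card.trans h.card, hst.flipped.trans h.flipped,
    hst.isJoin.trans h.isJoin, fun v => by rw [hst.label]; exact h.label v⟩

theorem Typing.fn_eq (T : Trigraph (Fin n)) (x y : Fin n) (k : Typing) (v : Fin n) :
    k.fn T x y v = 1 ∨ k.fn T x y v = 2 ∨ k.fn T x y v = 3 := by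
  cases k
  · exact T.typePair_eq' x v
  · exact T.typeJoin_eq x y v
  · exact T.typeLink_eq x v

theorem records_recordProg (J co : Bool) {τ : Fin n → ℕ} {S : Set (Fin n)} {s : State}
    (hS : Marks 5 (· ∈ S) s) (hτ : Typed τ s) (hτ3 : ∀ v, τ v ≤ 3) (hc : s.var 16 = S.ncard) :
    Records J co τ S ((recordProg J co).run n s) := by
  refine ⟨rfl, ?_, rfl, rfl, fun v => ?_⟩
  · rw [← hc]
    exact Prog.run_var n (.fill 11 9 _) rfl s
  · have := (Prog.fill_arr (a := 11) (x := 9) (e := .op .sub (lit 3)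
      (.op .sub (lit 3) (.op .mul (truth (get 5 (var 9))) (get 4 (var 9))))) rfl s v.2)
    refine Eq.trans this ?_
    have h3 := hτ3 v
    simp only [eval, Op.apply, State.setVar_var_self, State.setVar_arr, truth, Expr.not, hτ v]
    split_ifs with hv
    · have : s.arr 5 v ≠ 0 := (hS v).2 hv
      have : 1 - (1 - s.arr 5 v) = 1 := by omega
      rw [this]
      omega
    · have : s.arr 5 v = 0 := by
        by_contra h
        exact hv ((hS v).1 h)
      simp [this]

/-- The vertex that starts the closure. -/
def Typing.first (y z : Fin n) : Typing → Fin n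
  | .pair => y
  | .join => z
  | .link => y

/-- What `searchProg` achieves for the vertices `x`, `y`, `z`. -/
def Searched (T : Trigraph (Fin n)) (J : Bool) (k : Typing) (x y z : Fin n) (s : State) : Prop :=
  ∀ S, T.IsClosure (k.fn T x y) J (k.first y z) z S → T.Valid (k.fn T x y) S J →
    s.var 1 ≠ 0 ∧ s.var 3 ≤ S.ncard

theorem Loaded.search {s : State} (h : T.Loaded s) {x y z : Fin n} (hx : s.var 5 = x)
    (hy : s.var 6 = y) (hz : s.var 7 = z) (J co : Bool) (k : Typing) :
    T.Searched J k x y z ((searchProg J co k).run n s) ∧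
      (SameRecord s ((searchProg J co k).run n s) ∨
        (s.var 1 ≠ 0 → ((searchProg J co k).run n s).var 3 < s.var 3) ∧
        ∃ S, T.ClosedUnder (k.fn T x y) J S ∧ T.Valid (k.fn T x y) S J ∧
          Records J co (k.fn T x y) S ((searchProg J co k).run n s)) := by
  set s₁ := k.prog.run n s with hs₁
  have hτ₁ : Typed (k.fn T x y) s₁ := h.typed hx hy k
  have hR₁ : T.Ready (k.fn T x y) k.start 7 (k.first y z) z s₁ := by
    refine ⟨h.run _ (by cases k <;> rfl) (by cases k <;> rfl), hτ₁, ?_,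
      (Prog.run_var n _ (by cases k <;> rfl) s).trans hz⟩
    cases k
    · exact (Prog.run_var n _ rfl s).trans hy
    · exact (Prog.run_var n _ rfl s).trans hz
    · exact (Prog.run_var n _ rfl s).trans hy
  have hsame₁ : SameRecord s s₁ := SameRecord.of_run _ (by cases k <;> rfl) (by cases k <;> rfl)
    (by cases k <;> rfl) (by cases k <;> rfl) (by cases k <;> rfl) s
  obtain ⟨S, hcl, hS₂⟩ := hR₁.closure (by cases k <;> simp [Typing.start]) rfl J
  set s₂ := (closureProg J k.start 7).run n s₁ with hs₂
  have hsame₂ : SameRecord s₁ s₂ := SameRecord.of_run _ rfl rfl rfl rfl rfl s₁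
  have hz₂ : s₂.var 0 = n := (Prog.run_var n _ rfl s₁).trans hR₁.loaded.var_zero
  have hτ₂ : Typed (k.fn T x y) s₂ := fun v => by
    rw [hs₂, Prog.run_arr n _ rfl]
    exact hτ₁ v
  obtain ⟨hval, hcard⟩ := hS₂.counts hz₂ hτ₂ J
  set s₃ := (Prog.counts (countList J)).run n s₂ with hs₃
  have hsame₃ : SameRecord s₂ s₃ := SameRecord.of_run _ (by cases J <;> rfl) (by cases J <;> rfl)
    (by cases J <;> rfl) (by cases J <;> rfl) (Prog.counts_writesArr _ _) s₂
  have hsame := (hsame₁.trans hsame₂).trans hsame₃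
  have hτ₃ : Typed (k.fn T x y) s₃ := fun v => by
    rw [hs₃, Prog.run_arr n _ (Prog.counts_writesArr _ _)]
    exact hτ₂ v
  have hm₃ : Marks 5 (· ∈ S) s₃ := fun v => by
    rw [hs₃, Prog.run_arr n _ (Prog.counts_writesArr _ _)]
    exact hS₂.mem v
  have hrun : (searchProg J co k).run n s =
      if (and (validExpr J) (or (Expr.not (var 1)) (isLt (var 16) (var 3)))).eval s₃ ≠ 0 then
        (recordProg J co).run n s₃ else s₃ := rfl
  have hcond : (and (validExpr J) (or (Expr.not (var 1)) (isLt (var 16) (var 3)))).eval s₃ ≠ 0 ↔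
      T.Valid (k.fn T x y) S J ∧ (s₃.var 1 = 0 ∨ S.ncard < s₃.var 3) := by
    change Holds _ _ ↔ _
    simp only [holds_and, hval, holds_or, holds_not, holds_var, holds_isLt, eval, hcard, not_not]
  rw [hrun]
  by_cases hc : T.Valid (k.fn T x y) S J ∧ (s₃.var 1 = 0 ∨ S.ncard < s₃.var 3)
  · rw [if_pos (hcond.2 hc)]
    have hrec := records_recordProg J co hm₃ hτ₃ (fun v => by
      have := k.fn_eq T x y v
      omega) hcard
    refine ⟨fun S' hS' _ => ?_, Or.inr ⟨fun h1 => ?_, S, hcl.closed, hc.1, hrec⟩⟩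
    · rw [hcl.unique hS'] at hrec
      rw [hrec.found, hrec.card]
      exact ⟨one_ne_zero, le_rfl⟩
    · rw [hrec.card, ← hsame.card]
      exact hc.2.resolve_left (by rw [hsame.found]; exact h1)
  · rw [if_neg fun h' => hc (hcond.1 h')]
    refine ⟨fun S' hS' hv => ?_, Or.inl hsame⟩
    rw [← hcl.unique hS'] at hv ⊢
    have := not_or.1 fun h' => hc ⟨hv, h'⟩
    exact ⟨this.1, not_lt.1 this.2⟩

end Trigraph

namespace RAM.Prog

/-- A rule for counting loops in which every round makes progress, in the sense of a preorder
`R`, and achieves a goal `D j` that is not lost later. -/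
theorem range_relation {n x k : ℕ} {c : Prog} (R : State → State → Prop) (D : ℕ → State → Prop)
    {s : State} (hx : c.writesVar x = false) (hset : ∀ s v, R s (s.setVar x v))
    (htrans : ∀ s t u, R s t → R t u → R s u) (hD : ∀ j s t, R s t → D j s → D j t)
    (hstep : ∀ j t, j < n + k → t.var x = j →
      (∀ y, (range x k c).writesVar y = false → t.var y = s.var y) →
      (∀ a, c.writesArr a = false → t.arr a = s.arr a) → R t (c.run n t) ∧ D j (c.run n t)) :
    R s ((range x k c).run n s) ∧ ∀ j < n + k, D j ((range x k c).run n s) := by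
  obtain ⟨⟨-, -, h1, h2⟩, -⟩ := range_invariant (n := n) (x := x) (k := k) (c := c) (s := s)
    (fun j t => (∀ y, (range x k c).writesVar y = false → t.var y = s.var y) ∧
      (∀ a, c.writesArr a = false → t.arr a = s.arr a) ∧ R s t ∧ ∀ i < j, D i t) hx
    ⟨fun y hy => by
      simp only [writesVar, Bool.or_eq_false_iff, beq_eq_false_iff_ne] at hy
      exact s.setVar_var_of_ne hy.1.symm 0, fun a ha => rfl, hset s 0, by simp⟩
    (by
      rintro j t hj htj ⟨h1, h2, h3, h4⟩
      obtain ⟨h5, h6⟩ := hstep j t hj htj h1 h2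
      have h7 := hset (c.run n t) (j + 1)
      refine ⟨fun y hy => ?_, fun a ha => ?_, htrans _ _ _ h3 (htrans _ _ _ h5 h7),
        fun i hi => hD i _ _ h7 ?_⟩
      · have hy' := hy
        simp only [writesVar, Bool.or_eq_false_iff, beq_eq_false_iff_ne] at hy'
        rw [State.setVar_var_of_ne _ hy'.1.symm, run_var n c hy'.2, h1 y hy]
      · rw [State.setVar_arr, run_arr n c ha, h2 a ha]
      · rcases Nat.lt_succ_iff_lt_or_eq.1 hi with h | rfl
        · exact hD i _ _ h5 (h4 i h)
        · exact h6)
  exact ⟨h1, h2⟩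

end RAM.Prog

namespace Trigraph

open RAM RAM.Expr

variable {n : ℕ} {T : Trigraph (Fin n)}

/-- The array `0` holds the adjacency matrix of `T`. -/
structure Input (T : Trigraph (Fin n)) (s : State) : Prop where
  var_zero : s.var 0 = n
  arr : ∀ u v : Fin n, s.arr 0 (u * n + v) = code (T.θ u v)

theorem Input.run {s : State} (h : T.Input s) (c : Prog) (h0 : c.writesVar 0 = false)
    (h0' : c.writesArr 0 = false) : T.Input (c.run n s) :=
  ⟨(c.run_var n h0 s).trans h.var_zero, fun u v => by rw [c.run_arr n h0']; exact h.arr u v⟩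

theorem input_inputState (T : Trigraph (Fin n)) : T.Input T.inputState := by
  refine ⟨rfl, fun u v => ?_⟩
  have hn : 0 < n := u.pos
  have h1 : (u : ℕ) * n + v < n * n := by
    have := Nat.mul_le_mul_right n u.2
    have := v.2
    rw [Nat.succ_mul] at *
    omega
  have h2 : ((u : ℕ) * n + v) / n = u := by
    rw [Nat.add_comm, Nat.add_mul_div_right _ _ hn, Nat.div_eq_of_lt v.2, Nat.zero_add]
  have h3 : ((u : ℕ) * n + v) % n = v := by
    rw [Nat.add_comm, Nat.add_mul_mod_self_right, Nat.mod_eq_of_lt v.2]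
  simp [inputState, h1, h2, h3]

/-- Copies the input, or its complement, to the array `3`. -/
def loadProg : Bool → Prog
  | true => .fillMatrix 3 5 6 0 (.op .sub (lit 2) (entry 0 5 6))
  | false => .fillMatrix 3 5 6 0 (entry 0 5 6)

theorem Input.loaded {s : State} (h : T.Input s) (co : Bool) :
    (T.flip co).Loaded ((loadProg co).run n s) := by
  refine ⟨(Prog.run_var n _ (by cases co <;> rfl) s).trans h.var_zero, fun u v => ?_⟩
  have he : (entry 0 5 6).eval ((s.setVar 5 u).setVar 6 v) = code (T.θ u v) := by
    have e : ((s.setVar 5 u).setVar 6 v).var 0 = n := h.var_zero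
    rw [eval_entry, ← h.arr u v, e]
    rfl
  cases co with
  | false =>
    obtain ⟨f, hf, hrun⟩ := Prog.run_fillMatrix (n := n) (a := 3) (x := 5) (y := 6) (k := 0)
      (e := entry 0 5 6) h.var_zero (by norm_num) (by norm_num) (by norm_num) rfl
    rw [loadProg, hrun]
    exact (hf u u.2 v v.2).trans he
  | true =>
    obtain ⟨f, hf, hrun⟩ := Prog.run_fillMatrix (n := n) (a := 3) (x := 5) (y := 6) (k := 0)
      (e := .op .sub (lit 2) (entry 0 5 6)) h.var_zero (by norm_num) (by norm_num) (by norm_num) rfl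
    rw [loadProg, hrun]
    refine (hf u u.2 v v.2).trans ?_
    simp only [eval, Op.apply, he]
    exact (code_neg _).symm

/-- The certificate of a proper fragment. -/
structure Candidate (T : Trigraph (Fin n)) (J co : Bool) (τ : Fin n → ℕ) (S : Set (Fin n)) :
    Prop where
  co_eq : J = false → co = false
  type_eq : ∀ v, τ v = 1 ∨ τ v = 2 ∨ (J = true ∧ τ v = 3)
  closed : (T.flip co).ClosedUnder τ J S
  valid : (T.flip co).Valid τ S J

/-- If something was found, then it is a proper fragment. -/
def Sound (T : Trigraph (Fin n)) (s : State) : Prop :=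
  s.var 1 = 0 ∨ ∃ J co τ S, T.Candidate J co τ S ∧ Records J co τ S s

/-- Progress in the search for a small proper fragment. -/
structure Improves (T : Trigraph (Fin n)) (s t : State) : Prop where
  sound : T.Sound s → T.Sound t
  better : s.var 1 ≠ 0 → t.var 1 ≠ 0 ∧ t.var 3 ≤ s.var 3

theorem Improves.trans {s t u : State} (h : T.Improves s t) (h' : T.Improves t u) :
    T.Improves s u :=
  ⟨fun hs => h'.sound (h.sound hs), fun hs =>
    ⟨(h'.better (h.better hs).1).1, (h'.better (h.better hs).1).2.trans (h.better hs).2⟩⟩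

theorem SameRecord.improves {s t : State} (h : SameRecord s t) : T.Improves s t := by
  refine ⟨?_, fun hs => ⟨by rwa [h.found], h.card.le⟩⟩
  rintro (h1 | ⟨J, co, τ, S, h1, h2⟩)
  · exact Or.inl (h.found.trans h1)
  · exact Or.inr ⟨J, co, τ, S, h1, h2.of_same h⟩

theorem Searched.of_improves {T' : Trigraph (Fin n)} {J : Bool} {k : Typing} {x y z : Fin n}
    {s t : State} (h : T'.Searched J k x y z s) (hst : T.Improves s t) :
    T'.Searched J k x y z t := fun S hS hv =>
  ⟨(hst.better (h S hS hv).1).1, (hst.better (h S hS hv).1).2.trans (h S hS hv).2⟩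

/-- The choices of a typing for which the search makes sense. -/
def Sensible (J co : Bool) (k : Typing) : Prop := J = false → co = false ∧ k = .pair

theorem Loaded.improves {co : Bool} {s : State} (h : (T.flip co).Loaded s) {x y z : Fin n}
    (hx : s.var 5 = x) (hy : s.var 6 = y) (hz : s.var 7 = z) {J : Bool} {k : Typing}
    (hk : Sensible J co k) : T.Improves s ((searchProg J co k).run n s) := by
  rcases (h.search hx hy hz J co k).2 with h1 | ⟨h1, S, h2, h3, h4⟩
  · exact h1.improves
  · refine ⟨fun _ => Or.inr ⟨J, co, _, S, ⟨fun hJ => (hk hJ).1, fun v => ?_, h2, h3⟩, h4⟩,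
      fun h0 => ⟨by rw [h4.found]; exact one_ne_zero, (h1 h0).le⟩⟩
    cases J with
    | true => simpa using k.fn_eq (T.flip co) x y v
    | false =>
      rw [(hk rfl).2]
      have := (T.flip co).typePair_eq x v
      simp only [Typing.fn]
      tauto

/-- Runs `searchProg` for all triples of vertices. -/
def passProg (J co : Bool) (k : Typing) : Prog :=
  .seq (loadProg co) (.range 5 0 (.range 6 0 (.range 7 0 (searchProg J co k))))

theorem Input.pass {s : State} (h : T.Input s) {J co : Bool} {k : Typing} (hk : Sensible J co k) :
    T.Improves s ((passProg J co k).run n s) ∧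
      ∀ x y z, (T.flip co).Searched J k x y z ((passProg J co k).run n s) := by
  have hL := h.loaded co
  set s₁ := (loadProg co).run n s with hs₁
  have hsame : SameRecord s s₁ := SameRecord.of_run _ (by cases co <;> rfl) (by cases co <;> rfl)
    (by cases co <;> rfl) (by cases co <;> rfl) (by cases co <;> rfl) s
  have hset : ∀ x, 5 ≤ x → x ≤ 7 → ∀ (s : State) v, T.Improves s (s.setVar x v) := by
    intro x h5 h7 s v
    refine SameRecord.improves ⟨?_, ?_, ?_, ?_, rfl⟩ <;> rw [State.setVar_var_of_ne] <;> omega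
  have hw : ∀ x, x ≤ 7 → x ≠ 1 → x ≠ 3 → (searchProg J co k).writesVar x = false := by
    intro x hx h1 h3
    interval_cases x <;> first | (exact absurd rfl ‹_›) | (cases k <;> cases J <;> rfl)
  have hw3 : (searchProg J co k).writesArr 3 = false := by cases k <;> cases J <;> rfl
  have htrans : ∀ s t u, T.Improves s t → T.Improves t u → T.Improves s u :=
    fun _ _ _ h h' => h.trans h'
  have inner : ∀ (x y : Fin n) (t : State), (T.flip co).Loaded t → t.var 5 = x → t.var 6 = y →
      T.Improves t ((Prog.range 7 0 (searchProg J co k)).run n t) ∧ ∀ j < n + 0, ∀ z : Fin n,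
        z = j → (T.flip co).Searched J k x y z ((Prog.range 7 0 (searchProg J co k)).run n t) := by
    intro x y t ht hx hy
    refine Prog.range_relation T.Improves
      (fun j t => ∀ z : Fin n, z = j → (T.flip co).Searched J k x y z t)
      (hw 7 (by norm_num) (by norm_num) (by norm_num)) (hset 7 (by norm_num) (by norm_num)) htrans
      (fun j s t hst hs z hz => (hs z hz).of_improves hst) fun j u hj huj hvar harr => ?_
    have hu : (T.flip co).Loaded u := ht.of_eq
      (hvar 0 (by simp [Prog.writesVar, hw])) (harr 3 hw3)
    have hux : u.var 5 = x := (hvar 5 (by simp [Prog.writesVar, hw])).trans hx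
    have huy : u.var 6 = y := (hvar 6 (by simp [Prog.writesVar, hw])).trans hy
    refine ⟨hu.improves (z := ⟨j, hj⟩) hux huy huj hk, fun z hz => ?_⟩
    exact (hu.search hux huy (huj.trans hz.symm) J co k).1
  have middle : ∀ (x : Fin n) (t : State), (T.flip co).Loaded t → t.var 5 = x →
      T.Improves t ((Prog.range 6 0 (.range 7 0 (searchProg J co k))).run n t) ∧
      ∀ j < n + 0, ∀ y : Fin n, y = j → ∀ z, (T.flip co).Searched J k x y z
        ((Prog.range 6 0 (.range 7 0 (searchProg J co k))).run n t) := by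
    intro x t ht hx
    refine Prog.range_relation T.Improves
      (fun j t => ∀ y : Fin n, y = j → ∀ z, (T.flip co).Searched J k x y z t)
      (by simp [Prog.writesVar, hw]) (hset 6 (by norm_num) (by norm_num)) htrans
      (fun j s t hst hs y hy z => (hs y hy z).of_improves hst) fun j u hj huj hvar harr => ?_
    have hu : (T.flip co).Loaded u := ht.of_eq
      (hvar 0 (by simp [Prog.writesVar, hw])) (harr 3 hw3)
    have hux : u.var 5 = x := (hvar 5 (by simp [Prog.writesVar, hw])).trans hx
    have key := inner x ⟨j, hj⟩ u hu hux huj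
    refine ⟨key.1, fun y hy z => ?_⟩
    obtain rfl : y = ⟨j, hj⟩ := Fin.ext hy
    exact key.2 z z.2 z rfl
  have outer := Prog.range_relation (n := n) (x := 5) (k := 0) (s := s₁)
    (c := .range 6 0 (.range 7 0 (searchProg J co k))) T.Improves
    (fun j t => ∀ x : Fin n, x = j → ∀ y z, (T.flip co).Searched J k x y z t)
    (by simp [Prog.writesVar, hw]) (hset 5 (by norm_num) (by norm_num)) htrans
    (fun j s t hst hs x hx y z => (hs x hx y z).of_improves hst) fun j u hj huj hvar harr => by
      have hu : (T.flip co).Loaded u := hL.of_eq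
        (hvar 0 (by simp [Prog.writesVar, hw])) (harr 3 hw3)
      have key := middle ⟨j, hj⟩ u hu huj
      refine ⟨key.1, fun x hx y z => ?_⟩
      obtain rfl : x = ⟨j, hj⟩ := Fin.ext hx
      exact key.2 y y.2 y rfl z
  exact ⟨hsame.improves.trans outer.1, fun x y z => outer.2 x x.2 x rfl y z⟩

def passes : List (Bool × Bool × Typing) → Prog
  | [] => .skip
  | p :: l => .seq (passProg p.1 p.2.1 p.2.2) (passes l)

theorem Input.passes {l : List (Bool × Bool × Typing)} (hl : ∀ p ∈ l, Sensible p.1 p.2.1 p.2.2)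
    {s : State} (h : T.Input s) : T.Input ((passes l).run n s) ∧
      T.Improves s ((Trigraph.passes l).run n s) ∧
      ∀ p ∈ l, ∀ x y z, (T.flip p.2.1).Searched p.1 p.2.2 x y z ((Trigraph.passes l).run n s) := by
  induction l generalizing s with
  | nil => exact ⟨h, SameRecord.improves ⟨rfl, rfl, rfl, rfl, rfl⟩, by simp⟩
  | cons p l ih =>
    obtain ⟨J, co, k⟩ := p
    obtain ⟨h1, h2⟩ := h.pass (hl (J, co, k) (by simp))
    have h3 : T.Input ((passProg J co k).run n s) := h.run _
      (by cases J <;> cases co <;> cases k <;> rfl) (by cases J <;> cases co <;> cases k <;> rfl)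
    obtain ⟨h4, h5, h6⟩ := ih (fun p hp => hl p (by simp [hp])) h3
    refine ⟨h4, h1.trans h5, fun q hq x y z => ?_⟩
    rcases List.mem_cons.1 hq with rfl | hq
    · exact (h2 x y z).of_improves h5
    · exact h6 q hq x y z

/-- All searches. -/
def searches : List (Bool × Bool × Typing) :=
  [(false, false, .pair), (true, false, .pair), (true, false, .join), (true, false, .link),
    (true, true, .pair), (true, true, .join), (true, true, .link)]

theorem sensible_of_mem_searches : ∀ p ∈ searches, Sensible p.1 p.2.1 p.2.2 := by
  simp [searches, Sensible]

theorem InF.flip (h : T.InF) (co : Bool) : (T.flip co).InF := by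
  cases co
  · exact h
  · exact h.compl

theorem not_hasBalancedSkewPartition_flip (h : ¬ T.HasBalancedSkewPartition) (co : Bool) :
    ¬ (T.flip co).HasBalancedSkewPartition := by
  cases co
  · exact h
  · exact fun h' => h h'.of_compl

theorem Candidate.isProperTwoJoinSplit {co : Bool} {τ : Fin n → ℕ} {S : Set (Fin n)}
    (h : T.Candidate true co τ S) (hF : T.InF) (hT : ¬ T.HasBalancedSkewPartition) :
    (T.flip co).IsProperTwoJoinSplit (part τ S 1) (part τ S 2) (part τ S 3)
      {x | x ∉ S ∧ (T.flip co).Touch τ S 1 x} {x | x ∉ S ∧ (T.flip co).Touch τ S 2 x}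
      {x | x ∉ S ∧ ¬ (T.flip co).Touch τ S 1 x ∧ ¬ (T.flip co).Touch τ S 2 x} :=
  (JoinValid.split (fun v => by simpa using h.type_eq v) h.closed h.valid).isProper
    (hF.flip co).berge (not_hasBalancedSkewPartition_flip hT co)

theorem Candidate.isProperFragment {J co : Bool} {τ : Fin n → ℕ} {S : Set (Fin n)}
    (h : T.Candidate J co τ S) (hF : T.InF) (hT : ¬ T.HasBalancedSkewPartition) :
    T.IsProperFragment S := by
  cases J with
  | true =>
    have h1 : (T.flip co).IsProperTwoJoinSide S := ⟨_, _, _, _, _, _,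
      h.isProperTwoJoinSplit hF hT, (part_union (fun v => by simpa using h.type_eq v) S).symm⟩
    cases co
    · exact Or.inl h1
    · exact Or.inr (Or.inl h1)
  | false =>
    obtain rfl := h.co_eq rfl
    have h1 := PairValid.isProperHomogeneousPair (fun v => by simpa using h.type_eq v) h.closed
      h.valid
    exact Or.inr (Or.inr ⟨_, _, h1.1, h1.2.symm⟩)

theorem IsEnd.exists_search (hF : T.InF) (hT : ¬ T.HasBalancedSkewPartition) {X : Set (Fin n)}
    (h : T.IsEnd X) : ∃ p ∈ searches, ∃ x y z, ∀ S,
      (T.flip p.2.1).IsClosure (p.2.2.fn (T.flip p.2.1) x y) p.1 (p.2.2.first y z) z S →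
      (T.flip p.2.1).Valid (p.2.2.fn (T.flip p.2.1) x y) S p.1 ∧ S = X := by
  obtain ⟨hX, hmin⟩ := h
  have join : ∀ co, (T.flip co).IsProperTwoJoinSide X →
      (∀ Y, Y ⊂ X → ¬ (T.flip co).IsProperTwoJoinSide Y) → ∃ k : Typing, ∃ x y z, ∀ S,
      (T.flip co).IsClosure (k.fn (T.flip co) x y) true (k.first y z) z S →
      (T.flip co).Valid (k.fn (T.flip co) x y) S true ∧ S = X := by
    rintro co ⟨A₁, B₁, C₁, A₂, B₂, C₂, h1, rfl⟩ hmin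
    rcases h1.toIsTwoJoinSplit.exists_seed (hF.flip co) (not_hasBalancedSkewPartition_flip hT co)
      hmin with ⟨c, u, v, h2⟩ | ⟨a, b, s, h2⟩ | ⟨a, u, v, h2⟩
    · exact ⟨.pair, c, u, v, h2⟩
    · exact ⟨.join, a, b, s, h2⟩
    · exact ⟨.link, a, u, v, h2⟩
  rcases hX with h1 | h1 | ⟨A, B, h1, rfl⟩
  · obtain ⟨k, x, y, z, h2⟩ := join false h1 fun Y hY h' => hmin Y hY (Or.inl h')
    exact ⟨(true, false, k), by cases k <;> simp [searches], x, y, z, h2⟩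
  · obtain ⟨k, x, y, z, h2⟩ := join true h1 fun Y hY h' => hmin Y hY (Or.inr (Or.inl h'))
    exact ⟨(true, true, k), by cases k <;> simp [searches], x, y, z, h2⟩
  · obtain ⟨c, u, v, h2⟩ := exists_pair_seed hF hT h1 fun A' B' h' h'' =>
      hmin _ h'' (Or.inr (Or.inr ⟨A', B', h', rfl⟩))
    exact ⟨(false, false, .pair), by simp [searches], c, u, v, h2⟩

theorem IsProperFragment.exists_isEnd {V : Type*} [Finite V] {T : Trigraph V} {X : Set V}
    (h : T.IsProperFragment X) : ∃ Y ⊆ X, T.IsEnd Y := by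
  induction hk : X.ncard using Nat.strong_induction_on generalizing X with
  | _ k ih =>
    by_cases hmin : ∀ Y, Y ⊂ X → ¬ T.IsProperFragment Y
    · exact ⟨X, subset_rfl, h, hmin⟩
    · push Not at hmin
      obtain ⟨Y, hY, hY'⟩ := hmin
      obtain ⟨Z, hZ, hZ'⟩ := ih Y.ncard (hk ▸ Set.ncard_lt_ncard hY) hY' rfl
      exact ⟨Z, hZ.trans hY.subset, hZ'⟩

theorem Sound.isEnd (hF : T.InF) (hT : ¬ T.HasBalancedSkewPartition) {s : State} (h : T.Sound s)
    (hs : ∀ p ∈ searches, ∀ x y z, (T.flip p.2.1).Searched p.1 p.2.2 x y z s) :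
    (s.var 1 = 0 ∧ ¬ ∃ X, T.IsEnd X) ∨
      ∃ J co τ S, T.Candidate J co τ S ∧ Records J co τ S s ∧ T.IsEnd S := by
  have hend : ∀ X, T.IsEnd X → s.var 1 ≠ 0 ∧ s.var 3 ≤ X.ncard := by
    intro X hX
    obtain ⟨p, hp, x, y, z, h1⟩ := hX.exists_search hF hT
    obtain ⟨S, hS⟩ := (T.flip p.2.1).exists_isClosure (p.2.2.fn (T.flip p.2.1) x y) p.1
      (p.2.2.first y z) z
    obtain ⟨h2, rfl⟩ := h1 S hS
    exact hs p hp x y z S hS h2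
  rcases h with h | ⟨J, co, τ, S, h1, h2⟩
  · exact Or.inl ⟨h, fun ⟨X, hX⟩ => (hend X hX).1 h⟩
  · refine Or.inr ⟨J, co, τ, S, h1, h2, h1.isProperFragment hF hT, fun Y hY hY' => ?_⟩
    obtain ⟨Z, hZ, hZ'⟩ := hY'.exists_isEnd
    have h3 := (hend Z hZ').2
    rw [h2.card] at h3
    have h4 := Set.ncard_lt_ncard (hZ.trans_ssubset hY)
    omega

end Trigraph

namespace Trigraph

open RAM RAM.Expr

variable {n : ℕ} {T : Trigraph (Fin n)}

theorem eval_truth_eq (s : State) (e : Expr) [Decidable (e.Holds s)] :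
    (truth e).eval s = if e.Holds s then 1 else 0 := by
  have h := e.eval_truth s
  have h' := holds_truth (s := s) (e := e)
  by_cases h1 : e.Holds s
  · rw [if_pos h1]
    exact h.resolve_left (h'.2 h1)
  · rw [if_neg h1]
    exact not_not.1 fun h2 => h1 (h'.1 h2)

open Classical in
/-- The array `11` holds the types of the vertices of `S`. -/
def Labels (τ : Fin n → ℕ) (S : Set (Fin n)) (s : State) : Prop :=
  ∀ v : Fin n, s.arr 11 v = if v ∈ S then τ v else 0

theorem Labels.eq_iff {τ : Fin n → ℕ} {S : Set (Fin n)} {s : State} (h : Labels τ S s) {k : ℕ}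
    (hk : k ≠ 0) (v : Fin n) : s.arr 11 v = k ↔ v ∈ part τ S k := by
  rw [h v]
  split_ifs with hv
  · simp [part, hv]
  · simp [part, hv, hk.symm]

theorem Labels.ne_zero_iff {τ : Fin n → ℕ} {S : Set (Fin n)} {s : State} (h : Labels τ S s)
    (hτ : ∀ v, τ v ≠ 0) (v : Fin n) : s.arr 11 v ≠ 0 ↔ v ∈ S := by
  rw [h v]
  split_ifs with hv
  · simp [hv, hτ v]
  · simp [hv]

theorem Labels.run {τ : Fin n → ℕ} {S : Set (Fin n)} {s : State} (h : Labels τ S s) {c : Prog}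
    (hc : c.writesArr 11 = false) : Labels τ S (c.run n s) := fun v => by
  rw [c.run_arr n hc]
  exact h v

def neighborProg : Prog :=
  .seq (.count 26 10 (and (get 12 (var 10)) (entry 3 10 9)))
    (.store 13 (var 9) (truth (and (var 26) (get 11 (var 9)))))

/-- Replaces the set in the array `12` by the set of its neighbors. -/
def expandProg : Prog := .seq (.range 9 0 neighborProg) (.fill 12 9 (get 13 (var 9)))

theorem Loaded.expand {s : State} (h : T.Loaded s) {R S : Set (Fin n)} (hR : Marks 12 (· ∈ R) s)
    (hS : Marks 11 (· ∈ S) s) :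
    Marks 12 (· ∈ {v | v ∈ S ∧ ∃ u ∈ R, ¬ T.StrongAnti u v}) (expandProg.run n s) := by
  obtain ⟨⟨-, -, -, hI⟩, -⟩ := Prog.range_invariant (n := n) (x := 9) (k := 0) (s := s)
    (c := neighborProg) (fun j t => T.Loaded t ∧ Marks 12 (· ∈ R) t ∧ Marks 11 (· ∈ S) t ∧
      ∀ v : Fin n, (v : ℕ) < j → (t.arr 13 v ≠ 0 ↔ v ∈ S ∧ ∃ u ∈ R, ¬ T.StrongAnti u v)) rfl
    ⟨h.setVar (by norm_num) 0, hR, hS, by simp⟩ (by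
    rintro j t hj htj ⟨ht, hR, hS, hI⟩
    obtain ⟨w, rfl⟩ : ∃ w : Fin n, j = w := ⟨⟨j, by simpa using hj⟩, rfl⟩
    refine ⟨(ht.run neighborProg rfl rfl).setVar (by norm_num) _, fun v => ?_, fun v => ?_,
      fun v hv => ?_⟩
    · rw [State.setVar_arr, Prog.run_arr n _ rfl]
      exact hR v
    · rw [State.setVar_arr, Prog.run_arr n _ rfl]
      exact hS v
    · set t₁ := (Prog.count 26 10 (and (get 12 (var 10)) (entry 3 10 9))).run n t with ht₁
      have e9 : t₁.var 9 = w := (Prog.run_var n _ rfl t).trans htj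
      have e26 : t₁.var 26 = {u | u ∈ R ∧ ¬ T.StrongAnti u w}.ncard := by
        refine Prog.count_var ht.var_zero (by norm_num) (by norm_num) (by norm_num) rfl fun u => ?_
        have h10 := ht.setVar (x := 10) (by norm_num) u
        rw [holds_and, h10.holds_entry (i := 10) (j := 9) (u := u) (v := w)
          (State.setVar_var_self _ _ _) htj, holds_get_var, State.setVar_var_self, State.setVar_arr,
          hR u]
      have h26 : t₁.var 26 ≠ 0 ↔ ∃ u ∈ R, ¬ T.StrongAnti u w := by
        rw [e26, Ne, Set.ncard_eq_zero, ← Ne, ← Set.nonempty_iff_ne_empty]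
        rfl
      have h11 : t₁.arr 11 = t.arr 11 := Prog.run_arr n _ rfl t
      change Function.update (t₁.arr 13) (t₁.var 9)
        (Expr.eval t₁ (truth (and (var 26) (get 11 (var 9))))) v ≠ 0 ↔ _
      rw [e9]
      by_cases hvw : v = w
      · subst hvw
        rw [Function.update_self]
        change Holds _ _ ↔ _
        rw [holds_truth, holds_and, holds_var, holds_get_var, h26, e9, h11, hS v, and_comm]
      · rw [Function.update_of_ne (by simpa [Fin.val_inj] using hvw), ht₁, Prog.run_arr n _ rfl]
        refine hI v ?_
        have : (v : ℕ) ≠ w := fun h => hvw (Fin.ext h)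
        omega)
  intro v
  rw [expandProg, Prog.run, Prog.fill_arr rfl _ v.2]
  exact hI v (by simp)

/-- Moves to the next distance class, unless the vertices of type `2` have been reached; the
variable `25` holds the parity of the distance. -/
def levelProg : Prog :=
  .seq (.count 26 9 (and (get 12 (var 9)) (isEq (get 11 (var 9)) (lit 2))))
    (.ite (var 26) .skip (.seq (.assign 25 (.op .sub (lit 1) (var 25))) expandProg))

/-- Stores the number of markers in the variable `2`. -/
def markersProg : Bool → Prog
  | true => .seq (.fill 12 9 (isEq (get 11 (var 9)) (lit 1))) (.seq (.assign 25 (lit 0))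
      (.seq (.range 8 0 levelProg) (.assign 2 (.op .sub (lit 3) (var 25)))))
  | false => .assign 2 (lit 2)

theorem Loaded.markers {τ : Fin n → ℕ} {S : Set (Fin n)} {s : State} (h : T.Loaded s)
    (hτ : ∀ v, τ v ≠ 0) (hS : Labels τ S s) {m : ℕ} (hmn : m < n)
    (hm : (T.reach S (part τ S 1) m ∩ part τ S 2).Nonempty)
    (hm' : ∀ i < m, T.reach S (part τ S 1) i ∩ part τ S 2 = ∅) :
    ((markersProg true).run n s).var 2 = 3 - m % 2 := by
  set s₁ := (Prog.fill 12 9 (isEq (get 11 (var 9)) (lit 1))).run n s with hs₁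
  have hL₁ : T.Loaded s₁ := h.run _ rfl rfl
  have hS₁ : Labels τ S s₁ := hS.run rfl
  have hR₁ : Marks 12 (· ∈ T.reach S (part τ S 1) 0) s₁ := by
    intro v
    rw [hs₁, Prog.fill_arr rfl _ v.2]
    change Holds _ _ ↔ _
    rw [holds_isEq]
    simp only [eval, State.setVar_var_self, State.setVar_arr]
    exact hS.eq_iff one_ne_zero v
  obtain ⟨⟨-, -, -, hI⟩, -⟩ := Prog.range_invariant (n := n) (x := 8) (k := 0)
    (s := s₁.setVar 25 0) (c := levelProg) (fun j t => T.Loaded t ∧ Labels τ S t ∧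
      Marks 12 (· ∈ T.reach S (part τ S 1) (min j m)) t ∧ t.var 25 = min j m % 2) rfl
    ⟨(hL₁.setVar (by norm_num) 0).setVar (by norm_num) 0, hS₁, by rw [Nat.zero_min]; exact hR₁, by simp; rfl⟩ (by
    rintro j t hj - ⟨ht, hS, hR, hp⟩
    refine ⟨(ht.run levelProg rfl rfl).setVar (by norm_num) _, hS.run (c := levelProg) rfl, ?_⟩
    set t₁ := (Prog.count 26 9 (and (get 12 (var 9)) (isEq (get 11 (var 9)) (lit 2)))).run n t
      with ht₁
    have harr : t₁.arr = t.arr := funext fun a => Prog.run_arr n _ rfl t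
    have e26 : t₁.var 26 = (T.reach S (part τ S 1) (min j m) ∩ part τ S 2).ncard := by
      refine Prog.count_var ht.var_zero (by norm_num) (by norm_num) (by norm_num) rfl fun u => ?_
      rw [holds_and, holds_isEq, holds_get_var]
      simp only [eval, State.setVar_var_self, State.setVar_arr]
      rw [hR u, hS.eq_iff two_ne_zero]
      rfl
    have e25 : t₁.var 25 = min j m % 2 := (Prog.run_var n _ rfl t).trans hp
    have hrun : levelProg.run n t = if t₁.var 26 ≠ 0 then t₁ else
      expandProg.run n (t₁.setVar 25 (1 - t₁.var 25)) := rfl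
    rw [hrun]
    rcases lt_or_ge j m with hjm | hjm
    · rw [min_eq_left hjm.le] at e26 e25 hR
      rw [hm' j hjm, Set.ncard_empty] at e26
      rw [if_neg (by simpa using e26), min_eq_left (by omega)]
      refine ⟨?_, ?_⟩
      · have hL : T.Loaded (t₁.setVar 25 (1 - t₁.var 25)) := (ht.run _ rfl rfl).setVar (by norm_num) _
        refine hL.expand (fun v => ?_) fun v => ?_
        · rw [State.setVar_arr, harr]
          exact hR v
        · rw [State.setVar_arr, harr]
          exact hS.ne_zero_iff hτ v
      · rw [State.setVar_var_of_ne _ (by norm_num), Prog.run_var n expandProg rfl,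
          State.setVar_var_self, e25]
        omega
    · rw [min_eq_right hjm] at e26 e25 hR
      have h0 : t₁.var 26 ≠ 0 := by
        rw [e26, Ne, Set.ncard_eq_zero, ← Ne, ← Set.nonempty_iff_ne_empty]
        exact hm
      rw [if_pos h0, min_eq_right (by omega)]
      refine ⟨fun v => ?_, ?_⟩
      · rw [State.setVar_arr, harr]
        exact hR v
      · rw [State.setVar_var_of_ne _ (by norm_num), e25])
  rw [min_eq_right (by omega)] at hI
  rw [← hI]
  rfl

/-- The marker in the variable `t` is strongly adjacent to the vertex in the variable `v`. -/
def sideExpr (t v : ℕ) : Expr :=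
  or (and (isEq (var t) (var 0)) (isEq (get 11 (var v)) (lit 1)))
    (and (isEq (var t) (.op .add (var 0) (lit 1))) (isEq (get 11 (var v)) (lit 2)))

/-- The markers in the variables `9` and `10` form a strong antiedge. -/
def antiExpr : Expr :=
  and (isEq (var 2) (lit 3))
    (or (and (isEq (var 9) (var 0)) (isEq (var 10) (.op .add (var 0) (lit 1))))
      (and (isEq (var 9) (.op .add (var 0) (lit 1))) (isEq (var 10) (var 0))))

def inside (x : ℕ) : Expr := isLt (var x) (var 0)

/-- The entry of the adjacency matrix of the block in the row `9` and the column `10`. -/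
def blockExpr : Expr :=
  .op .add
    (.op .add (.op .mul (.op .mul (inside 9) (inside 10)) (entry 3 9 10))
      (.op .mul (.op .mul (inside 9) (not (inside 10))) (.op .mul (lit 2) (truth (sideExpr 10 9)))))
    (.op .add
      (.op .mul (.op .mul (not (inside 9)) (inside 10)) (.op .mul (lit 2) (truth (sideExpr 9 10))))
      (.op .mul (.op .mul (not (inside 9)) (not (inside 10))) (not antiExpr)))

/-- The markers are attached as in the block of a `2`-join or homogeneous pair. -/
structure Attached (r : ℕ) (M : Trigraph (Fin r)) (N : Fin r → Set (Fin n)) (τ : Fin n → ℕ)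
    (S : Set (Fin n)) : Prop where
  side : ∀ (k : Fin r) (v : Fin n), v ∈ N k ↔
    ((k : ℕ) = 0 ∧ v ∈ part τ S 1) ∨ ((k : ℕ) = 1 ∧ v ∈ part τ S 2)
  anti : ∀ k l : Fin r, code (M.θ k l) =
    if r = 3 ∧ ((k : ℕ) = 0 ∧ (l : ℕ) = 1 ∨ (k : ℕ) = 1 ∧ (l : ℕ) = 0) then 0 else 1

theorem attached_pair (τ : Fin n → ℕ) (S : Set (Fin n)) :
    Attached 2 markerPair ![part τ S 1, part τ S 2] τ S := by
  refine ⟨fun k v => ?_, fun k l => by simp [markerPair]; rfl⟩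
  fin_cases k <;> simp

theorem attached_light (τ : Fin n → ℕ) (S : Set (Fin n)) :
    Attached 3 markerLight ![part τ S 1, part τ S 2, ∅] τ S := by
  refine ⟨fun k v => ?_, fun k l => ?_⟩
  · fin_cases k <;> simp
  · fin_cases k <;> fin_cases l <;> rfl

theorem Attached.eval_blockExpr {r : ℕ} {M : Trigraph (Fin r)} {N : Fin r → Set (Fin n)}
    {τ : Fin n → ℕ} {S : Set (Fin n)} (h : Attached r M N τ S) {s : State} (hL : T.Loaded s)
    (hS : Labels τ S s) (hr : s.var 2 = r) (p q : S ⊕ Fin r) :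
    blockExpr.eval ((s.setVar 9 (blockName p)).setVar 10 (blockName q)) =
      code ((T.addMarkers S M N).θ p q) := by
  classical
  set t := (s.setVar 9 (blockName p)).setVar 10 (blockName q) with ht
  have hLt : T.Loaded t := (hL.setVar (by norm_num) _).setVar (by norm_num) _
  have e0 : t.var 0 = n := hLt.var_zero
  have e2 : t.var 2 = r := hr
  have e9 : t.var 9 = blockName p := rfl
  have e10 : t.var 10 = blockName q := rfl
  have e11 : t.arr 11 = s.arr 11 := rfl
  have hin : ∀ {x : ℕ} {u : S}, t.var x = blockName (r := r) (.inl u) → (inside x).eval t = 1 := by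
    intro x u hx
    simp only [inside, isLt, eval, Op.apply, hx, e0, blockName]
    exact if_pos u.1.2
  have hout : ∀ {x : ℕ} {k : Fin r}, t.var x = blockName (X := S) (.inr k) →
      (inside x).eval t = 0 := by
    intro x k hx
    simp only [inside, isLt, eval, Op.apply, hx, e0, blockName]
    exact if_neg (by omega)
  have hside : ∀ {x y : ℕ} {k : Fin r} {u : S}, t.var x = blockName (X := S) (.inr k) →
      t.var y = blockName (r := r) (.inl u) → ((sideExpr x y).Holds t ↔ (u : Fin n) ∈ N k) := by
    intro x y k u hx hy
    simp only [sideExpr, holds_or, holds_and, holds_isEq, eval, Op.apply, hx, hy, e0, e11,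
      blockName, hS.eq_iff one_ne_zero, hS.eq_iff two_ne_zero, h.side]
    have h1 : n + (k : ℕ) = n ↔ (k : ℕ) = 0 := by omega
    have h2 : n + (k : ℕ) = n + 1 ↔ (k : ℕ) = 1 := by omega
    rw [h1, h2]
  rcases p with u | k <;> rcases q with v | l
  · have e := hLt.eval_entry (i := 9) (j := 10) (u := (u : Fin n)) (v := (v : Fin n)) e9 e10
    simp only [blockExpr, eval, Op.apply, Expr.not, hin e9, hin e10, e]
    simp [addMarkers]
  · have hc := hside e10 e9
    simp only [blockExpr, eval, Op.apply, Expr.not, hin e9, hout e10, eval_truth_eq, hc]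
    simp only [addMarkers]
    split_ifs <;> simp [code]
  · have hc := hside e9 e10
    simp only [blockExpr, eval, Op.apply, Expr.not, hout e9, hin e10, eval_truth_eq, hc]
    simp only [addMarkers]
    split_ifs <;> simp [code]
  · have hc : antiExpr.Holds t ↔
        r = 3 ∧ ((k : ℕ) = 0 ∧ (l : ℕ) = 1 ∨ (k : ℕ) = 1 ∧ (l : ℕ) = 0) := by
      simp only [antiExpr, holds_or, holds_and, holds_isEq, eval, Op.apply, e9, e10, e0, e2,
        blockName]
      have h1 : ∀ k : Fin r, n + (k : ℕ) = n ↔ (k : ℕ) = 0 := fun k => by omega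
      have h2 : ∀ k : Fin r, n + (k : ℕ) = n + 1 ↔ (k : ℕ) = 1 := fun k => by omega
      rw [h1, h2, h1, h2]
    have hv : 1 - antiExpr.eval t = code (M.θ k l) := by
      rw [h.anti]
      split_ifs with h1
      · have : antiExpr.eval t ≠ 0 := hc.2 h1
        omega
      · have : antiExpr.eval t = 0 := by
          by_contra h2
          exact h1 (hc.1 h2)
        rw [this]
    simp only [blockExpr, eval, Op.apply, Expr.not, hout e9, hout e10, hv]
    simp [addMarkers]

theorem neg_addMarkers_compl {V ι : Type*} [Finite V] [Finite ι] (T : Trigraph V) (X : Set V)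
    {M M' : Trigraph ι} {N N' : ι → Set V} (hM : ∀ k l, M'.θ k l = -M.θ k l)
    (hN : ∀ k, ∀ v ∈ X, v ∈ N' k ↔ v ∉ N k) (p q : X ⊕ ι) :
    (T.addMarkers X M' N').θ p q = -(T.compl.addMarkers X M N).θ p q := by
  rcases p with u | k <;> rcases q with v | l
  · simp [addMarkers, compl]
  · by_cases h : (u : V) ∈ N l <;> simp [addMarkers, hN l u u.2, h]
  · by_cases h : (v : V) ∈ N k <;> simp [addMarkers, hN k v v.2, h]
  · exact hM k l

theorem IsProperTwoJoinSplit.exists_block {A₁ B₁ C₁ A₂ B₂ C₂ : Set (Fin n)} (co : Bool)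
    (h : (T.flip co).IsProperTwoJoinSplit A₁ B₁ C₁ A₂ B₂ C₂) {S : Set (Fin n)}
    (hS : S = A₁ ∪ B₁ ∪ C₁) :
    ((T.flip co).IsOddSplit A₁ B₁ C₁ A₂ B₂ C₂ → ∃ T', T.IsBlock S 2 T' ∧ ∀ p q, T'.θ p q =
      (bif co then -1 else 1) * ((T.flip co).addMarkers S markerPair ![A₁, B₁]).θ p q) ∧
    ((T.flip co).IsEvenSplit A₁ B₁ C₁ A₂ B₂ C₂ → ∃ T', T.IsBlock S 3 T' ∧ ∀ p q, T'.θ p q =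
      (bif co then -1 else 1) * ((T.flip co).addMarkers S markerLight ![A₁, B₁, ∅]).θ p q) := by
  cases co with
  | false =>
    exact ⟨fun h1 => ⟨_, .oddTwoJoin _ _ _ _ _ _ h h1 hS, fun p q => (one_mul _).symm⟩,
      fun h1 => ⟨_, .evenTwoJoin _ _ _ _ _ _ h h1 hS, fun p q => (one_mul _).symm⟩⟩
  | true =>
    have hd := h.disj'
    have hA : ∀ v ∈ S, v ∈ B₁ ∪ C₁ ↔ v ∉ A₁ := by
      intro v hv
      rw [hS] at hv
      have := hd v
      simp only [Set.mem_union] at hv ⊢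
      tauto
    have hB : ∀ v ∈ S, v ∈ A₁ ∪ C₁ ↔ v ∉ B₁ := by
      intro v hv
      rw [hS] at hv
      have := hd v
      simp only [Set.mem_union] at hv ⊢
      tauto
    refine ⟨fun h1 => ⟨_, .oddComplTwoJoin _ _ _ _ _ _ h h1 hS, fun p q => ?_⟩,
      fun h1 => ⟨_, .evenComplTwoJoin _ _ _ _ _ _ h h1 hS, fun p q => ?_⟩⟩
    · rw [T.neg_addMarkers_compl S (M := markerPair) (N := ![A₁, B₁]) (fun _ _ => rfl)]
      · simp [flip]
      · intro k
        fin_cases k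
        · exact hA
        · exact hB
    · rw [T.neg_addMarkers_compl S (M := markerLight) (N := ![A₁, B₁, ∅]) (by decide)]
      · simp [flip]
      · intro k
        fin_cases k
        · exact hA
        · exact hB
        · simp

/-- Outputs the recorded set and its block. -/
def outputProg (J co : Bool) : Prog :=
  .seq (loadProg co) (.seq (.fill 1 9 (truth (get 11 (var 9)))) (.seq (markersProg J)
    (.fillMatrix 2 9 10 3 (.op .sub (lit 2)
      (bif co then blockExpr else .op .sub (lit 2) blockExpr)))))

theorem Candidate.exists_block {J co : Bool} {τ : Fin n → ℕ} {S : Set (Fin n)}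
    (h : T.Candidate J co τ S) (hF : T.InF) (hT : ¬ T.HasBalancedSkewPartition) {s : State}
    (hL : (T.flip co).Loaded s) (hS : Labels τ S s) : ∃ (r : ℕ) (M : Trigraph (Fin r))
      (N : Fin r → Set (Fin n)) (T' : Trigraph (S ⊕ Fin r)), r ≤ 3 ∧ Attached r M N τ S ∧
      T.IsBlock S r T' ∧ ((markersProg J).run n s).var 2 = r ∧ ∀ p q, T'.θ p q =
        (bif co then -1 else 1) * ((T.flip co).addMarkers S M N).θ p q := by
  cases J with
  | false =>
    obtain rfl := h.co_eq rfl
    have h1 := PairValid.isProperHomogeneousPair (fun v => by simpa using h.type_eq v) h.closed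
      h.valid
    exact ⟨2, _, _, _, by norm_num, attached_pair τ S, .homogeneousPair _ _ h1.1 h1.2.symm, rfl,
      fun p q => (one_mul _).symm⟩
  | true =>
    have h1 := h.isProperTwoJoinSplit hF hT
    have hSu := part_union (fun v => by simpa using h.type_eq v) S
    obtain ⟨m, hmn, hm, hm'⟩ := exists_least_reach h1.nonempty.1 h1.meet₁
    obtain ⟨p, hp⟩ := exists_pathVia hm hm'
    obtain ⟨hodd, heven⟩ := h1.parity (hF.flip co).berge hp
    obtain ⟨h2, h3⟩ := h1.exists_block co hSu.symm
    rw [hSu] at hm hm'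
    rw [Nat.card_fin] at hmn
    have hvar := hL.markers (fun v => by have := h.type_eq v; omega) hS hmn hm hm'
    rcases Nat.even_or_odd m with hpar | hpar
    · obtain ⟨T', h4, h5⟩ := h3 (heven hpar)
      exact ⟨3, _, _, T', le_rfl, attached_light τ S, h4,
        by rw [hvar, Nat.even_iff.1 hpar], h5⟩
    · obtain ⟨T', h4, h5⟩ := h2 (hodd hpar)
      exact ⟨2, _, _, T', by norm_num, attached_pair τ S, h4,
        by rw [hvar, Nat.odd_iff.1 hpar], h5⟩

theorem Candidate.output {J co : Bool} {τ : Fin n → ℕ} {S : Set (Fin n)}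
    (h : T.Candidate J co τ S) (hF : T.InF) (hT : ¬ T.HasBalancedSkewPartition) {s : State}
    (hs : T.Input s) (hrec : Records J co τ S s) (hend : T.IsEnd S) :
    T.IsAnswer ((outputProg J co).run n s) := by
  classical
  have hL₁ := hs.loaded co
  set s₁ := (loadProg co).run n s with hs₁
  have hS₁ : Labels τ S s₁ := Labels.run hrec.label (by cases co <;> rfl)
  set s₂ := (Prog.fill 1 9 (truth (get 11 (var 9)))).run n s₁ with hs₂
  have hL₂ : (T.flip co).Loaded s₂ := hL₁.run _ rfl rfl
  have hS₂ : Labels τ S s₂ := hS₁.run rfl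
  have hτ : ∀ v, τ v ≠ 0 := fun v => by have := h.type_eq v; omega
  have h1 : ∀ v : Fin n, s₂.arr 1 v = if v ∈ S then 1 else 0 := by
    intro v
    rw [hs₂, Prog.fill_arr rfl _ v.2, eval_truth_eq, holds_get_var, State.setVar_var_self,
      State.setVar_arr]
    simp only [hS₁.ne_zero_iff hτ]
  obtain ⟨r, M, N, T', hr3, hatt, hblock, hr, hθ⟩ := h.exists_block hF hT hL₂ hS₂
  set s₃ := (markersProg J).run n s₂ with hs₃
  have hL₃ : (T.flip co).Loaded s₃ := hL₂.run _ (by cases J <;> rfl) (by cases J <;> rfl)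
  have hS₃ : Labels τ S s₃ := hS₂.run (by cases J <;> rfl)
  obtain ⟨f, hf, hrun⟩ := Prog.run_fillMatrix (n := n) (a := 2) (x := 9) (y := 10) (k := 3)
    (e := .op .sub (lit 2) (bif co then blockExpr else .op .sub (lit 2) blockExpr))
    hL₃.var_zero (by norm_num) (by norm_num) (by norm_num) (by cases co <;> rfl)
  have hname : ∀ p : S ⊕ Fin r, blockName p < n + 3 := by
    rintro (u | k)
    · exact u.1.2.trans (by omega)
    · have := k.2
      simp only [blockName]
      omega
  refine Or.inr ⟨?_, S, hend, fun v => ?_, r, T', hblock, ?_, fun p q => ?_⟩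
  · rw [Prog.run_var n _ (by cases J <;> cases co <;> rfl), hrec.found]
  · rw [← h1 v]
    change ((Prog.fillMatrix 2 9 10 3 _).run n s₃).arr 1 v = _
    rw [Prog.run_arr n _ rfl, hs₃, Prog.run_arr n _ (by cases J <;> rfl)]
  · rw [← hr]
    exact Prog.run_var n _ rfl s₃
  · change ((Prog.fillMatrix 2 9 10 3 _).run n s₃).arr 2 _ = _
    rw [hrun, hf _ (hname p) _ (hname q), hθ]
    have he := hatt.eval_blockExpr hL₃ hS₃ hr p q
    have h2 := code_le (((T.flip co).addMarkers S M N).θ p q)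
    cases co with
    | true =>
      simp only [eval, Op.apply, cond_true, he, neg_mul, one_mul, code_neg]
    | false =>
      simp only [eval, Op.apply, cond_false, he, one_mul]
      omega

/-- Finds an end, and outputs it with its block. -/
def endProg : Prog :=
  .seq (passes searches) (.ite (var 1) (.ite (var 23) (outputProg true true)
    (.ite (var 24) (outputProg true false) (outputProg false false))) .skip)

theorem isAnswer_endProg (hF : T.InF) (hT : ¬ T.HasBalancedSkewPartition) :
    T.IsAnswer (endProg.run n T.inputState) := by
  obtain ⟨h1, h2, h3⟩ := T.input_inputState.passes sensible_of_mem_searches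
  set s := (passes searches).run n T.inputState with hs
  have hrun : endProg.run n T.inputState = if s.var 1 ≠ 0 then (if s.var 23 ≠ 0 then
    (outputProg true true).run n s else if s.var 24 ≠ 0 then (outputProg true false).run n s else
      (outputProg false false).run n s) else s := rfl
  rw [hrun]
  rcases (h2.sound (Or.inl rfl)).isEnd hF hT h3 with ⟨h4, h5⟩ | ⟨J, co, τ, S, h4, h5, h6⟩
  · rw [if_neg (not_not.2 h4)]
    exact Or.inl ⟨h4, h5⟩
  · have h7 := h4.output hF hT h1 h5 h6
    rw [if_pos (by rw [h5.found]; exact one_ne_zero), h5.flipped, h5.isJoin]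
    cases J <;> cases co
    · exact h7
    · exact absurd (h4.co_eq rfl) (by simp)
    · exact h7
    · exact h7

theorem small_inputState (T : Trigraph (Fin n)) : T.inputState.Small n := by
  refine ⟨rfl, fun x => ?_, fun a k => ?_⟩
  · simp only [inputState]
    split_ifs <;> omega
  · simp only [inputState]
    split_ifs
    · exact (code_le _).trans (by omega)
    · omega

end Trigraph
theorem mainTheorem9 :
    ∃ (P : RAM.Cmd) (C c : ℕ), ∀ (n : ℕ) (T : Trigraph (Fin n)),
      T.InF → ¬ T.HasBalancedSkewPartition →
        ∃ (t : ℕ) (s : RAM.State),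
          P.Runs ((n + 2) ^ c) T.inputState t s ∧ t ≤ C * (n + 1) ^ 5 ∧ T.IsAnswer s := by
  refine ⟨Trigraph.endProg.compile, Trigraph.endProg.coef, 4 * Trigraph.endProg.size,
    fun n T hF hT => ?_⟩
  have hW : (n + 10) ^ Trigraph.endProg.size < (n + 2) ^ (4 * Trigraph.endProg.size) := by
    rw [pow_mul]
    refine Nat.pow_lt_pow_left ?_ (by decide)
    have : (n + 2) ^ 4 = n ^ 4 + 8 * n ^ 3 + 24 * n ^ 2 + 32 * n + 16 := by ring
    rw [this]
    omega
  obtain ⟨-, t, ht, hrun⟩ := Trigraph.endProg.runs (by decide) hW T.small_inputState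
  exact ⟨t, _, hrun, ht.trans (Trigraph.endProg.time_le n (by decide)),
    Trigraph.isAnswer_endProg hF hT⟩
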